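/- **Setting.** Let $J$ be the number of items. Participants $i=1,2,\dots$ are i.i.d. copies of $(X_i,B_i(1),B_i(0),W_i)$ with covariates $X_i\in\mathcal X$, potential submissions $B_i(w)\in\mathcal B$ (depending only on $i$'s own treatment $w\in\{0,1\}$) and binary treatment $W_i$; $(X_i,W_i,B_i)$ with $B_i=B_i(W_i)$ is observed. The functions $d:\mathcal B\times\mathbb R^J\to\mathbb R^J$ (allocations) and $y:\mathcal B\times\mathbb R^J\to\mathbb R$ (outcomes) give the allocation and the outcome of a submission at a cutoff vector $p$; $s^*\in[0,1]^J$ is the fractional capacity, $\mathcal S\subset\mathbb R^J$ the set of cutoffs, and $m(\mathbf b,\boldsymbol\gamma,s)$ the cutoff vector that the mechanism computes from submissions, weights and capacities. A rule is a measurable $\pi:\mathcal X\to[0,1]$, and $\Pi$ is a class of rules; write $\pi_1(x)=\pi(x)$, $\pi_0(x)=1-\pi(x)$. Put $$y_\pi(p)=\mathbb E\Big[\sum_{w}\pi_w(X_i)\,y(B_i(w),p)\Big],\qquad z_\pi(p)=\mathbb E\Big[\sum_{w}\pi_w(X_i)\,d(B_i(w),p)\Big]-s^*,$$ $e(x)=P(W_i=1\mid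 X_i=x)$, $e_1=e$, $e_0=1-e$, $\mu^y_w(x,p)=\mathbb E[y(B_i(w),p)\mid X_i=x]$, $\mu^d_w(x,p)=\mathbb E[d(B_i(w),p)\mid X_i=x]$. All functions are measurable. **Assumptions.** 1. (Identification) $\{B_i(1),B_i(0)\}\perp W_i\mid X_i$, and $0<e(x)<1$ for all $x$. 2. (Cutoff mechanism) There are $a_n=o(n^{-1/2})$ and $c>0$ such that: for all $n$ and $\mathbf w\in\{0,1\}^n$, with probability at least $1-e^{-cn}$ some $p\in\mathbb R^J$ satisfies $\|\frac1n\sum_{i\le n}d(B_i(w_i),p)-s^*\|\le a_n$; the market cutoffs $P_n(\mathbf w)=m(\mathbf B(\mathbf w),\frac1n\mathbf 1,s^*)$ lie in $\mathcal S$ almost surely; and for $\boldsymbol\gamma$ in the simplex and $s\in[0,1]^J$, $m(\mathbf b,\boldsymbol\gamma,s)$ satisfies $\|\sum_i\gamma_i d(b_i,m(\mathbf b,\boldsymbol\gamma,s))-s\|\le a_n$ whenever some cutoff vector does. 3. (Regularity of outcomes) The classes $\{d_j(\cdot,p):p\in\mathcal S\}$, $j\le J$, and $\{y(\cdot,p):p\in\mathcal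 S\}$ have uniform $L_2$ covering numbers at most $C\varepsilon^{-h_d}$ and $C\varepsilon^{-h_y}$, respectively, for $0<\varepsilon<1$; $y$ and $d$ are bounded on $\mathcal B\times\mathcal S$; for some $L$ and all $p,p'\in\mathcal S$, $w$, $j$, $\mathbb E[(d_j(B_i(w),p)-d_j(B_i(w),p'))^2]\le L\|p-p'\|$ and likewise for $y$; there are versions of $\mu^d_w(x,\cdot)$ and $\mu^y_w(x,\cdot)$ that are, for every $x$, $C^2$ on the interior of $\mathcal S$ with first and second derivatives bounded by a constant $c'>0$; and for $\pi\in\Pi$ the singular values of the Jacobian $\nabla_p z_\pi(p^*_\pi)$ lie in $[c_3,c_4]$ with $c_3>0$. 4. (Regularity of equilibrium) $\mathcal S$ is compact; there are $c_1,c_2>0$ such that for $\pi\in\Pi$, $\mathcal S$ contains the ball of radius $c_1$ around $p^*_\pi$, $p^*_\pi$ is the unique zero of $z_\pi$ in $\mathcal S$, and $2\|z_\pi(p)\|\ge c_2$ for all $p\in\mathcal S$ with $\|p-p^*_\pi\|\ge c_3/(2Jc')$. **Estimator.** The sample of size $n$ is split into three folds, and the complement of each fold $k$ into parts $\mathcal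 H_{-k}$ and $\mathcal G_{-k}$, by a possibly random rule. The split and the (possibly randomized) regression algorithms use an auxiliary random seed independent of the participants. For each $k$: (i) on $\mathcal H_{-k}$, estimate a propensity score $\tilde e$ and set $\tilde P_\pi=\tilde P^k_\pi=m(\mathbf B,\tilde{\boldsymbol\gamma},s^*)$ with weights $\tilde\gamma_i=\frac1{|\mathcal H_{-k}|}\sum_w\pi_w(X_i)\mathbf 1\{W_i=w\}/\tilde e_w(X_i)$, $i\in\mathcal H_{-k}$; (ii) on $\mathcal G_{-k}$, estimate a propensity score $\hat e^k$ from $(X_i,W_i)$; (iii) on $\mathcal G_{-k}$, let $\hat\mu^{y,k}_w(x,p)$ and $\hat\mu^{d,k}_w(x,p)$ be the fitted regressions of $y(B_i,p)$ and $d(B_i,p)$ on $(X_i,W_i)$, and put $\hat\mu^{\cdot,k}_w(x)=\hat\mu^{\cdot,k}_w(x,\tilde P_\pi)$. With $k(i)$ the fold of $i$ and $\hat e_1=\hat e$, $\hat e_0=1-\hat e$, let $\hat P_\pi=m(\mathbf B,\hat{\boldsymbol\gamma},\hat s)$ on the full sample, where $$\hat\gamma_i=\frac1n\sum_w\pi_w(X_i)\frac{\mathbf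 1\{W_i=w\}}{\hat e^{k(i)}_w(X_i)},\qquad \hat s=s^*+\frac1n\sum_{i\le n}\sum_w\Big(\frac{\mathbf 1\{W_i=w\}}{\hat e^{k(i)}_w(X_i)}-1\Big)\pi_w(X_i)\,\hat\mu^{d,k(i)}_w(X_i),$$ and $$\hat V_n(\pi)=\frac1n\sum_{i\le n}\sum_w\pi_w(X_i)\,\hat\Gamma^y_{wi}(\hat P_\pi),\qquad \hat\Gamma^y_{wi}(p)=\hat\mu^{y,k(i)}_w(X_i)+\frac{\mathbf 1\{W_i=w\}}{\hat e^{k(i)}_w(X_i)}\big(y(B_i,p)-\hat\mu^{y,k(i)}_w(X_i)\big);$$ define $\hat\Gamma^d_{wi}(p)$ in the same way from $d$ and $\hat\mu^d$. 5. (Nuisance estimation) (a) For some $\kappa>0$, for all $n$ and $k$, almost surely $\hat e^k(x)\in(\kappa,1-\kappa)$ for almost every $x$ under the law of $X_i$. (b) For some constant $K$, almost surely the entries of $\hat\mu^{y,k}_w(x,p)$ and $\hat\mu^{d,k}_w(x,p)$ are bounded by $K$ in absolute value for all $w$, $x\in\mathcal X$, $p\in\mathcal S$. (c) There are nonnegative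 $\rho_{e,n}=o(1)$, $\rho_{\mu,n}+\rho_{\theta,n}=o(1)$ with $\rho_{e,n}\rho_{\mu,n}=o(n^{-1/2})$ and $\rho_{e,n}\rho_{\theta,n}=o(n^{-1/2})$ such that for each $\pi\in\Pi$ and $k$, with probability $1-o(1)$: $\big(\mathbb E_T\|\hat\mu^k_w(X)-\mu_w(X,\tilde P_\pi)\|^2\big)^{1/2}\le\rho_{\mu,n}$ for $w=0,1$, $\big(\mathbb E_T(\hat e^k(X)-e(X))^2\big)^{1/2}\le\rho_{e,n}$ and $\|\tilde P_\pi-p^*_\pi\|\le\rho_{\theta,n}$. Here $\mu=(\mu^y,\mu^d)$, $\hat\mu=(\hat\mu^y,\hat\mu^d)$, and $\mathbb E_T$ is the expectation over an independent copy $X$ of the covariates with the training data fixed. (d) There is $\rho_{g,n}=o(n^{-1/2})$ such that for each $\pi\in\Pi$, with probability $1-o(1)$, $\hat P_\pi\in\mathcal S$ and $\big\|\frac1n\sum_{i\le n}\sum_w\pi_w(X_i)\hat\Gamma^d_{wi}(\hat P_\pi)-s^*\big\|\le\rho_{g,n}$. **Theorem.** Under Assumptions 1–5, for every $\pi\in\Pi$,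 $$\hat V_n(\pi)=\frac1n\sum_{i=1}^n\Gamma^{*q}_{\pi i}(p^*_\pi)+o_p(n^{-1/2}),$$ $$\Gamma^{*q}_{\pi i}(p)=\sum_w\pi_w(X_i)\Gamma^{*y}_{wi}(p)-\nu^*_\pi\Big(\sum_w\pi_w(X_i)\Gamma^{*d}_{wi}(p)-s^*\Big),\qquad \nu^*_\pi=\nabla_p^\top y_\pi(p^*_\pi)\,[\nabla_p z_\pi(p^*_\pi)]^{-1},$$ where $\Gamma^{*y}_{wi}(p)=\mu^y_w(X_i,p)+\frac{\mathbf 1\{W_i=w\}}{e_w(X_i)}\big(y(B_i,p)-\mu^y_w(X_i,p)\big)$, and $\Gamma^{*d}_{wi}$ is defined in the same way from $d$ and $\mu^d$. -/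

import Mathlib

open MeasureTheory ProbabilityTheory Filter Topology
open scoped ENNReal NNReal

noncomputable section

namespace CutoffMarket

/-- Vectors indexed by the `J` items (cutoffs, allocations, capacities), with the Euclidean norm. -/
abbrev Vec (J : ℕ) := EuclideanSpace ℝ (Fin J)

/-! ### The market -/

/-- A population of market participants together with a centralized mechanism for `J` items.

Participant `i` has covariates `X i`, a binary treatment `W i` and potential submissions `B w i`,
`w` being the participant's *own* treatment (`true` means treated), so that there is no interference
at the level of submissions. With the cutoff vector `p`, the submission `b` is allocated `d b p` and
has outcome `y b p`. `m n b γ s` is the cutoff vector that the mechanism computes from `n`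
submissions `b`, weights `γ` and capacities `s`. `sStar` is the fractional capacity and `S` the set
of admissible cutoffs. -/
structure Model (Ω 𝒳 𝓑 : Type*) [MeasurableSpace Ω] [MeasurableSpace 𝒳] [MeasurableSpace 𝓑]
    (J : ℕ) where
  P : Measure Ω
  isProb : IsProbabilityMeasure P
  X : ℕ → Ω → 𝒳
  W : ℕ → Ω → Bool
  B : Bool → ℕ → Ω → 𝓑
  d : 𝓑 → Vec J → Vec J
  y : 𝓑 → Vec J → ℝ
  m : (n : ℕ) → (Fin n → 𝓑) → (Fin n → ℝ) → Vec J → Vec J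
  sStar : Vec J
  S : Set (Vec J)
  measurable_X : ∀ i, Measurable (X i)
  measurable_W : ∀ i, Measurable (W i)
  measurable_B : ∀ w i, Measurable (B w i)
  measurable_d : Measurable (fun q : 𝓑 × Vec J => d q.1 q.2)
  measurable_y : Measurable (fun q : 𝓑 × Vec J => y q.1 q.2)
  measurable_m : ∀ n, Measurable
    (fun q : (Fin n → 𝓑) × (Fin n → ℝ) × Vec J => m n q.1 q.2.1 q.2.2)
  sStar_mem : ∀ j, sStar j ∈ Set.Icc (0 : ℝ) 1

/-- The probability `π x` or `1 - π x` with which the rule `π` assigns the treatment arm `w` to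
covariates `x`. -/
def armProb {𝒳 : Type*} (π : 𝒳 → ℝ) (w : Bool) (x : 𝒳) : ℝ := if w then π x else 1 - π x

/-- The inverse propensity weight `𝟙{Wi = w} / P(W = w)`, where `e` is the probability of
treatment. -/
def ipw (w Wi : Bool) (e : ℝ) : ℝ := if Wi = w then 1 / (if w then e else 1 - e) else 0

/-- The doubly-robust score `μ + 𝟙{Wi = w} / P(W = w) · (v - μ)`. -/
def drScore {V : Type*} [AddCommGroup V] [Module ℝ V] (w Wi : Bool) (e : ℝ) (μ v : V) : V :=
  μ + ipw w Wi e • (v - μ)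

/-- Treatment rules: measurable maps from covariates to treatment probabilities. -/
def IsRule {𝒳 : Type*} [MeasurableSpace 𝒳] (π : 𝒳 → ℝ) : Prop :=
  Measurable π ∧ ∀ x, π x ∈ Set.Icc (0 : ℝ) 1

/-- `U` and `V` are conditionally independent given `X`. -/
def CondIndepGiven {Ω α β γ : Type*} [MeasurableSpace Ω] [MeasurableSpace α] [MeasurableSpace β]
    [MeasurableSpace γ] (P : Measure Ω) (U : Ω → α) (V : Ω → β) (X : Ω → γ) : Prop :=
  ∀ (s : Set α) (t : Set β), MeasurableSet s → MeasurableSet t →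
    P[(U ⁻¹' s ∩ V ⁻¹' t).indicator (fun _ => (1 : ℝ)) | MeasurableSpace.comap X inferInstance]
      =ᵐ[P] fun ω =>
        (P[(U ⁻¹' s).indicator (fun _ => (1 : ℝ)) | MeasurableSpace.comap X inferInstance]) ω *
        (P[(V ⁻¹' t).indicator (fun _ => (1 : ℝ)) | MeasurableSpace.comap X inferInstance]) ω

/-- The nuisance functions: `e x` is the propensity score, `muY w x p` and `muD w x p` are the
conditional means of outcomes and allocations in arm `w` at the cutoffs `p`. -/
structure Nuisance (𝒳 : Type*) (J : ℕ) where
  e : 𝒳 → ℝ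
  muY : Bool → 𝒳 → Vec J → ℝ
  muD : Bool → 𝒳 → Vec J → Vec J

namespace Model

variable {Ω 𝒳 𝓑 : Type*} [MeasurableSpace Ω] [MeasurableSpace 𝒳] [MeasurableSpace 𝓑] {J : ℕ}
  (M : Model Ω 𝒳 𝓑 J)

/-- The full (partly unobserved) record of participant `i`. -/
def participant (i : ℕ) (ω : Ω) : 𝒳 × (𝓑 × 𝓑) × Bool :=
  (M.X i ω, (M.B true i ω, M.B false i ω), M.W i ω)

/-- The observed submission `B_i = B_i(W_i)`. -/
def obsB (i : ℕ) (ω : Ω) : 𝓑 := M.B (M.W i ω) i ω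

/-- The law of the covariates of one participant. -/
def lawX : Measure 𝒳 := M.P.map (M.X 0)

/-- The cutoffs `P_n(w)` of the finite market under the treatment vector `w`. -/
def cutoff (n : ℕ) (w : Fin n → Bool) (ω : Ω) : Vec J :=
  M.m n (fun i => M.B (w i) i ω) (fun _ => (n : ℝ)⁻¹) M.sStar

/-- Expected outcome `y_π(p)` in the continuum market at the cutoffs `p`. -/
def meanOutcome (π : 𝒳 → ℝ) (p : Vec J) : ℝ :=
  ∫ ω, ∑ w, armProb π w (M.X 0 ω) * M.y (M.B w 0 ω) p ∂M.P

/-- Expected net demand `z_π(p)` in the continuum market at the cutoffs `p`. -/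
def netDemand (π : 𝒳 → ℝ) (p : Vec J) : Vec J :=
  (∫ ω, ∑ w, armProb π w (M.X 0 ω) • M.d (M.B w 0 ω) p ∂M.P) - M.sStar

/-- The row vector `∇ᵀ y_π(p) [∇ z_π(p)]⁻¹`. -/
def nu (π : 𝒳 → ℝ) (p : Vec J) : Vec J →L[ℝ] ℝ :=
  (fderiv ℝ (M.meanOutcome π) p).comp (fderiv ℝ (M.netDemand π) p).inverse

/-- `η` consists of versions of the true propensity score `P(W = 1 | X = x)` and of the true
conditional means `E[y(B(w), p) | X = x]` and `E[d(B(w), p) | X = x]`, `p ∈ S`. -/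
structure IsTrueNuisance (η : Nuisance 𝒳 J) : Prop where
  measurable_e : Measurable η.e
  measurable_muY : ∀ w, ∀ p ∈ M.S, Measurable (fun x => η.muY w x p)
  measurable_muD : ∀ w, ∀ p ∈ M.S, Measurable (fun x => η.muD w x p)
  e_eq : (fun ω => η.e (M.X 0 ω)) =ᵐ[M.P]
    M.P[(M.W 0 ⁻¹' {true}).indicator (fun _ => (1 : ℝ)) |
      MeasurableSpace.comap (M.X 0) inferInstance]
  muY_eq : ∀ w, ∀ p ∈ M.S, (fun ω => η.muY w (M.X 0 ω) p) =ᵐ[M.P]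
    M.P[fun ω => M.y (M.B w 0 ω) p | MeasurableSpace.comap (M.X 0) inferInstance]
  muD_eq : ∀ w, ∀ p ∈ M.S, (fun ω => η.muD w (M.X 0 ω) p) =ᵐ[M.P]
    M.P[fun ω => M.d (M.B w 0 ω) p | MeasurableSpace.comap (M.X 0) inferInstance]

/-- The efficient score of participant `i` under the rule `π` at the cutoffs `p`: the doubly-robust
outcome score minus `∇ᵀ y_π(p) [∇ z_π(p)]⁻¹` times the doubly-robust net-demand score. -/
def efficientScore (η : Nuisance 𝒳 J) (π : 𝒳 → ℝ) (p : Vec J) (i : ℕ) (ω : Ω) : ℝ :=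
  (∑ w, armProb π w (M.X i ω) *
      drScore w (M.W i ω) (η.e (M.X i ω)) (η.muY w (M.X i ω) p) (M.y (M.obsB i ω) p)) -
    M.nu π p ((∑ w, armProb π w (M.X i ω) •
      drScore w (M.W i ω) (η.e (M.X i ω)) (η.muD w (M.X i ω) p) (M.d (M.obsB i ω) p)) - M.sStar)

/-! ### Assumptions on the market -/

/-- Participants are sampled i.i.d.; treatment is unconfounded given covariates; overlap holds.
(The absence of interference in submissions is built into `Model`.) -/
structure Identification (η : Nuisance 𝒳 J) : Prop where
  indep : iIndepFun M.participant M.P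
  identDistrib : ∀ i, IdentDistrib (M.participant i) (M.participant 0) M.P M.P
  unconfounded : CondIndepGiven M.P (fun ω => (M.B true 0 ω, M.B false 0 ω)) (M.W 0) (M.X 0)
  overlap : ∀ x, 0 < η.e x ∧ η.e x < 1

/-- The mechanism is a cutoff mechanism: the cutoffs it computes clear the (weighted) market up to
`a n = o(n^{-1/2})` whenever such cutoffs exist, and in the market formed by the `n` sampled
participants under a treatment vector `w` they exist except with probability at most
`exp (- c n)`. -/
def CutoffMechanism : Prop :=
  ∃ (a : ℕ → ℝ) (c : ℝ), Tendsto (fun n : ℕ => a n * √(n : ℝ)) atTop (𝓝 0) ∧ 0 < c ∧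
    (∀ (n : ℕ) (w : Fin n → Bool),
      M.P {ω | ¬ ∃ p : Vec J,
        ‖(∑ i : Fin n, (n : ℝ)⁻¹ • M.d (M.B (w i) i ω) p) - M.sStar‖ ≤ a n}
        ≤ ENNReal.ofReal (Real.exp (-(c * n)))) ∧
    (∀ (n : ℕ) (w : Fin n → Bool), ∀ᵐ ω ∂M.P, M.cutoff n w ω ∈ M.S) ∧
    (∀ (n : ℕ) (b : Fin n → 𝓑), ∀ γ ∈ stdSimplex ℝ (Fin n), ∀ s : Vec J,
      (∀ j, s j ∈ Set.Icc (0 : ℝ) 1) →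
      (∃ p : Vec J, ‖(∑ i, γ i • M.d (b i) p) - s‖ ≤ a n) →
      ‖(∑ i, γ i • M.d (b i) (M.m n b γ s)) - s‖ ≤ a n)

end Model

/-- The values of `f` at the atoms `b i` of the finitely discrete probability measure
`Q = ∑ q i δ_{b i}`, scaled so that Euclidean distances are `L²(Q)` distances. -/
def l2Vec {𝓑 : Type*} {N : ℕ} (b : Fin N → 𝓑) (q : Fin N → ℝ) (f : 𝓑 → ℝ) :
    EuclideanSpace ℝ (Fin N) :=
  WithLp.toLp 2 (fun i => √(q i) * f (b i))

/-- The uniform covering numbers `sup_Q N(ε, F, L²(Q))`, `0 < ε < 1`, the supremum over all finitely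
discrete probability measures `Q`, are at most `C (1/ε)^h`. -/
def PolynomialCovering {𝓑 : Type*} (F : Set (𝓑 → ℝ)) (C h : ℝ) : Prop :=
  ∀ (N : ℕ) (b : Fin N → 𝓑), ∀ q ∈ stdSimplex ℝ (Fin N), ∀ ε : ℝ≥0, 0 < ε → ε < 1 →
    ((Metric.externalCoveringNumber ε (l2Vec b q '' F) : ℕ∞) : ℝ≥0∞)
      ≤ ENNReal.ofReal (C * (1 / (ε : ℝ)) ^ h)

namespace Model

variable {Ω 𝒳 𝓑 : Type*} [MeasurableSpace Ω] [MeasurableSpace 𝒳] [MeasurableSpace 𝓑] {J : ℕ}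
  (M : Model Ω 𝒳 𝓑 J)

/-- Regularity of allocations and outcomes in the cutoffs. `c'` bounds the derivatives of the
conditional means; `c₃`, `c₄` bound the singular values of the Jacobian of net demand at the
continuum cutoffs `pStar π`. -/
structure RegularOutcomes (Pol : Set (𝒳 → ℝ)) (η : Nuisance 𝒳 J) (pStar : (𝒳 → ℝ) → Vec J)
    (c' c₃ c₄ : ℝ) : Prop where
  entropy : ∃ hd hy C : ℝ, 0 < hd ∧ 0 < hy ∧ 0 < C ∧
    (∀ j, PolynomialCovering ((fun p b => M.d b p j) '' M.S) C hd) ∧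
    PolynomialCovering ((fun p b => M.y b p) '' M.S) C hy
  bounded : ∃ K : ℝ, ∀ b, ∀ p ∈ M.S, |M.y b p| ≤ K ∧ ‖M.d b p‖ ≤ K
  weakly_continuous : ∃ L : ℝ, 0 < L ∧ ∀ w, ∀ p ∈ M.S, ∀ p' ∈ M.S,
    (∀ j, ∫ ω, (M.d (M.B w 0 ω) p j - M.d (M.B w 0 ω) p' j) ^ 2 ∂M.P ≤ L * ‖p - p'‖) ∧
    ∫ ω, (M.y (M.B w 0 ω) p - M.y (M.B w 0 ω) p') ^ 2 ∂M.P ≤ L * ‖p - p'‖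
  c'_pos : 0 < c'
  smooth_muD : ∀ w x, ContDiffOn ℝ 2 (η.muD w x) (interior M.S) ∧ ∀ p ∈ interior M.S,
    ‖fderiv ℝ (η.muD w x) p‖ ≤ c' ∧ ‖iteratedFDeriv ℝ 2 (η.muD w x) p‖ ≤ c'
  smooth_muY : ∀ w x, ContDiffOn ℝ 2 (η.muY w x) (interior M.S) ∧ ∀ p ∈ interior M.S,
    ‖fderiv ℝ (η.muY w x) p‖ ≤ c' ∧ ‖iteratedFDeriv ℝ 2 (η.muY w x) p‖ ≤ c'
  c₃_pos : 0 < c₃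
  singular_values : ∀ π ∈ Pol, ∀ i < J,
    (fderiv ℝ (M.netDemand π) (pStar π)).toLinearMap.singularValues i ∈ Set.Icc c₃ c₄

/-- `S` is compact, and for every rule `π` in the class, `pStar π` is the unique, interior and
well-separated market-clearing cutoff vector of the continuum market. -/
structure RegularEquilibrium (Pol : Set (𝒳 → ℝ)) (pStar : (𝒳 → ℝ) → Vec J) (c' c₃ : ℝ) : Prop where
  compact : IsCompact M.S
  clears : ∀ π ∈ Pol, M.netDemand π (pStar π) = 0
  unique : ∀ π ∈ Pol, ∀ p ∈ M.S, M.netDemand π p = 0 → p = pStar π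
  ball_subset : ∃ c₁ : ℝ, 0 < c₁ ∧ ∀ π ∈ Pol, Metric.ball (pStar π) c₁ ⊆ M.S
  separated : ∃ c₂ : ℝ, 0 < c₂ ∧ ∀ π ∈ Pol, ∀ p ∈ M.S,
    c₃ / (2 * J * c') ≤ ‖p - pStar π‖ → c₂ ≤ 2 * ‖M.netDemand π p‖

end Model

/-! ### The estimator -/

/-- The part of the sample `f` with indices in `I`, listed in increasing order of the index. -/
def subsample {α : Type*} {n : ℕ} (I : Finset (Fin n)) (f : Fin n → α) : Fin I.card → α :=
  fun j => f (I.orderEmbOfFin rfl j)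

/-- Sample splitting rules and learning algorithms. All of them may use an auxiliary random seed
`z : Z`. For sample size `n`, `fold` assigns each observation to one of three folds, and
`inH n z k` selects the observations outside of fold `k` that belong to the first of the two
parts into which the complement of fold `k` is split.
The learners take a training sample of any size `h` and return a fitted function of the covariates:
`propensity₀` and `propensity` estimate the propensity score from pairs `(X_i, W_i)` (in the first
and in the second part), and `regressY`, `regressD` regress a response on `(X_i, W_i)`. -/
structure Algorithm (Z 𝒳 : Type*) [MeasurableSpace Z] [MeasurableSpace 𝒳] (J : ℕ) where
  fold : (n : ℕ) → Z → Fin n → Fin 3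
  inH : (n : ℕ) → Z → Fin 3 → Fin n → Bool
  propensity₀ : (n : ℕ) → Fin 3 → (h : ℕ) → Z → (Fin h → 𝒳 × Bool) → 𝒳 → ℝ
  propensity : (n : ℕ) → Fin 3 → (h : ℕ) → Z → (Fin h → 𝒳 × Bool) → 𝒳 → ℝ
  regressY : (n : ℕ) → Fin 3 → (h : ℕ) → Z → (Fin h → 𝒳 × Bool × ℝ) → Bool → 𝒳 → ℝ
  regressD : (n : ℕ) → Fin 3 → (h : ℕ) → Z → (Fin h → 𝒳 × Bool × Vec J) → Bool → 𝒳 → Vec J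
  measurable_fold : ∀ n, Measurable (fold n)
  measurable_inH : ∀ n, Measurable (inH n)
  measurable_propensity₀ : ∀ n k h, Measurable
    (fun q : Z × (Fin h → 𝒳 × Bool) × 𝒳 => propensity₀ n k h q.1 q.2.1 q.2.2)
  measurable_propensity : ∀ n k h, Measurable
    (fun q : Z × (Fin h → 𝒳 × Bool) × 𝒳 => propensity n k h q.1 q.2.1 q.2.2)
  measurable_regressY : ∀ n k h w, Measurable
    (fun q : Z × (Fin h → 𝒳 × Bool × ℝ) × 𝒳 => regressY n k h q.1 q.2.1 w q.2.2)
  measurable_regressD : ∀ n k h w, Measurable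
    (fun q : Z × (Fin h → 𝒳 × Bool × Vec J) × 𝒳 => regressD n k h q.1 q.2.1 w q.2.2)

/-- A market, an algorithm, and the auxiliary random seed used by the algorithm, which is
independent of the participants. -/
structure Study (Ω 𝒳 𝓑 Z : Type*) [MeasurableSpace Ω] [MeasurableSpace 𝒳] [MeasurableSpace 𝓑]
    [MeasurableSpace Z] (J : ℕ) extends Model Ω 𝒳 𝓑 J, Algorithm Z 𝒳 J where
  seed : Ω → Z
  measurable_seed : Measurable seed
  seed_indep : IndepFun seed (fun ω i => toModel.participant i ω) P

namespace Study

variable {Ω 𝒳 𝓑 Z : Type*} [MeasurableSpace Ω] [MeasurableSpace 𝒳] [MeasurableSpace 𝓑]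
  [MeasurableSpace Z] {J : ℕ} (T : Study Ω 𝒳 𝓑 Z J)

/-- The fold `k(i)` of observation `i`. -/
def foldOf (n : ℕ) (ω : Ω) (i : Fin n) : Fin 3 := T.fold n (T.seed ω) i

/-- The first part of the complement of fold `k`. -/
def setH (n : ℕ) (k : Fin 3) (ω : Ω) : Finset (Fin n) :=
  {i | T.foldOf n ω i ≠ k ∧ T.inH n (T.seed ω) k i = true}

/-- The second part of the complement of fold `k`. -/
def setG (n : ℕ) (k : Fin 3) (ω : Ω) : Finset (Fin n) :=
  {i | T.foldOf n ω i ≠ k ∧ T.inH n (T.seed ω) k i = false}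

/-- The preliminary propensity score, estimated on the first part of the complement of fold `k`. -/
def eTilde (n : ℕ) (k : Fin 3) (ω : Ω) (x : 𝒳) : ℝ :=
  T.propensity₀ n k _ (T.seed ω) (subsample (T.setH n k ω) (fun i => (T.X i ω, T.W i ω))) x

/-- The first-step cutoffs: the mechanism is run on the first part of the complement of fold `k`,
with estimated inverse propensity weights. -/
def pTilde (π : 𝒳 → ℝ) (n : ℕ) (k : Fin 3) (ω : Ω) : Vec J :=
  T.m (T.setH n k ω).card (subsample (T.setH n k ω) (fun i => T.obsB i ω))
    (subsample (T.setH n k ω) (fun i => ∑ w, armProb π w (T.X i ω) *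
      (ipw w (T.W i ω) (T.eTilde n k ω (T.X i ω)) / ((T.setH n k ω).card : ℝ))))
    T.sStar

/-- The propensity score estimated on the second part of the complement of fold `k`. -/
def eHat (n : ℕ) (k : Fin 3) (ω : Ω) (x : 𝒳) : ℝ :=
  T.propensity n k _ (T.seed ω) (subsample (T.setG n k ω) (fun i => (T.X i ω, T.W i ω))) x

/-- The regression of `y(B_i, p)` on `(X_i, W_i)` in the second part of the complement of fold
`k`. -/
def muYHatAt (n : ℕ) (k : Fin 3) (ω : Ω) (w : Bool) (x : 𝒳) (p : Vec J) : ℝ :=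
  T.regressY n k _ (T.seed ω)
    (subsample (T.setG n k ω) (fun i => (T.X i ω, T.W i ω, T.y (T.obsB i ω) p))) w x

/-- The regression of `d(B_i, p)` on `(X_i, W_i)` in the second part of the complement of fold
`k`. -/
def muDHatAt (n : ℕ) (k : Fin 3) (ω : Ω) (w : Bool) (x : 𝒳) (p : Vec J) : Vec J :=
  T.regressD n k _ (T.seed ω)
    (subsample (T.setG n k ω) (fun i => (T.X i ω, T.W i ω, T.d (T.obsB i ω) p))) w x

/-- The localized outcome regression, computed at the first-step cutoffs only. -/
def muYHat (π : 𝒳 → ℝ) (n : ℕ) (k : Fin 3) (ω : Ω) (w : Bool) (x : 𝒳) : ℝ :=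
  T.muYHatAt n k ω w x (T.pTilde π n k ω)

/-- The localized allocation regression, computed at the first-step cutoffs only. -/
def muDHat (π : 𝒳 → ℝ) (n : ℕ) (k : Fin 3) (ω : Ω) (w : Bool) (x : 𝒳) : Vec J :=
  T.muDHatAt n k ω w x (T.pTilde π n k ω)

/-- The second-step weight of observation `i`. -/
def gammaHat (π : 𝒳 → ℝ) (n : ℕ) (ω : Ω) (i : Fin n) : ℝ :=
  ∑ w, armProb π w (T.X i ω) *
    (ipw w (T.W i ω) (T.eHat n (T.foldOf n ω i) ω (T.X i ω)) / (n : ℝ))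

/-- The perturbed capacities. -/
def sHat (π : 𝒳 → ℝ) (n : ℕ) (ω : Ω) : Vec J :=
  T.sStar + (n : ℝ)⁻¹ • ∑ i : Fin n, ∑ w,
    ((ipw w (T.W i ω) (T.eHat n (T.foldOf n ω i) ω (T.X i ω)) - 1) * armProb π w (T.X i ω)) •
      T.muDHat π n (T.foldOf n ω i) ω w (T.X i ω)

/-- The second-step cutoffs: the mechanism is re-run on the full sample with the estimated weights
and the perturbed capacities. -/
def pHat (π : 𝒳 → ℝ) (n : ℕ) (ω : Ω) : Vec J :=
  T.m n (fun i => T.obsB i ω) (T.gammaHat π n ω) (T.sHat π n ω)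

/-- The localized, cross-fitted doubly-robust estimator of the value of the rule `π`. -/
def vHat (π : 𝒳 → ℝ) (n : ℕ) (ω : Ω) : ℝ :=
  (n : ℝ)⁻¹ * ∑ i : Fin n, ∑ w, armProb π w (T.X i ω) *
    drScore w (T.W i ω) (T.eHat n (T.foldOf n ω i) ω (T.X i ω))
      (T.muYHat π n (T.foldOf n ω i) ω w (T.X i ω)) (T.y (T.obsB i ω) (T.pHat π n ω))

/-- The average estimated doubly-robust net-demand score at the cutoffs `p`. -/
def netDemandHat (π : 𝒳 → ℝ) (n : ℕ) (ω : Ω) (p : Vec J) : Vec J :=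
  ((n : ℝ)⁻¹ • ∑ i : Fin n, ∑ w, armProb π w (T.X i ω) •
    drScore w (T.W i ω) (T.eHat n (T.foldOf n ω i) ω (T.X i ω))
      (T.muDHat π n (T.foldOf n ω i) ω w (T.X i ω)) (T.d (T.obsB i ω) p)) - T.sStar

/-- The event that the first-step estimators for fold `k` satisfy the error bounds `rhoMu`, `rhoE`
and `rhoTheta`. The `L²` norms are with respect to the law of the covariates of a test observation,
conditionally on the training data. -/
def goodFit (η : Nuisance 𝒳 J) (pStar : (𝒳 → ℝ) → Vec J) (rhoMu rhoE rhoTheta : ℝ)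
    (π : 𝒳 → ℝ) (n : ℕ) (k : Fin 3) : Set Ω :=
  {ω | (∀ w, eLpNorm (fun x => √(
          (T.muYHat π n k ω w x - η.muY w x (T.pTilde π n k ω)) ^ 2 +
          ‖T.muDHat π n k ω w x - η.muD w x (T.pTilde π n k ω)‖ ^ 2)) 2 T.lawX
        ≤ ENNReal.ofReal rhoMu) ∧
      eLpNorm (fun x => T.eHat n k ω x - η.e x) 2 T.lawX ≤ ENNReal.ofReal rhoE ∧
      ‖T.pTilde π n k ω - pStar π‖ ≤ rhoTheta}

/-- Conditions on the nuisance estimators and on the accuracy of the second-step cutoffs. -/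
structure NuisanceConditions (Pol : Set (𝒳 → ℝ)) (η : Nuisance 𝒳 J)
    (pStar : (𝒳 → ℝ) → Vec J) : Prop where
  overlap : ∃ κ : ℝ, 0 < κ ∧ ∀ n k, ∀ᵐ ω ∂T.P, ∀ᵐ x ∂T.lawX,
    T.eHat n k ω x ∈ Set.Ioo κ (1 - κ)
  bounded : ∃ K : ℝ, ∀ n k, ∀ᵐ ω ∂T.P, ∀ w x, ∀ p ∈ T.S,
    |T.muYHatAt n k ω w x p| ≤ K ∧ ∀ j, |T.muDHatAt n k ω w x p j| ≤ K
  rates : ∃ rhoMu rhoE rhoTheta : ℕ → ℝ,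
    (∀ n, 0 ≤ rhoMu n ∧ 0 ≤ rhoE n ∧ 0 ≤ rhoTheta n) ∧
    Tendsto rhoE atTop (𝓝 0) ∧ Tendsto (fun n => rhoMu n + rhoTheta n) atTop (𝓝 0) ∧
    (fun n => rhoE n * rhoMu n) =o[atTop] (fun n : ℕ => (√(n : ℝ))⁻¹) ∧
    (fun n => rhoE n * rhoTheta n) =o[atTop] (fun n : ℕ => (√(n : ℝ))⁻¹) ∧
    ∀ π ∈ Pol, ∀ k, Tendsto
      (fun n => T.P (T.goodFit η pStar (rhoMu n) (rhoE n) (rhoTheta n) π n k)ᶜ) atTop (𝓝 0)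
  clearing : ∃ rhoG : ℕ → ℝ, rhoG =o[atTop] (fun n : ℕ => (√(n : ℝ))⁻¹) ∧
    ∀ π ∈ Pol, Tendsto
      (fun n => T.P {ω | T.pHat π n ω ∈ T.S ∧
        ‖T.netDemandHat π n ω (T.pHat π n ω)‖ ≤ rhoG n}ᶜ) atTop (𝓝 0)

end Study

end CutoffMarket

end

/-! Write p₀ for the continuum cutoffs and p̂ for the second-step cutoffs. A doubly-robust score is
affine in the response, with the inverse propensity weight as slope. So, for y and for each
coordinate of d, the difference between the estimated score at p̂ and the true score at p₀ splits in
two (`recScore_sub_recScore`): a weighted response increment from p₀ to p̂, and the error at p₀ of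
plugging in estimated nuisance functions.

The plug-in error is a cross-fitted sum. Given the seed and the other folds its terms are i.i.d.,
their mean is bounded by the propensity error times the regression error (`recScore_error`), and
their variance vanishes, so Chebyshev's inequality makes the sum o_p(√n) (`tendsto_crossfit_score`).

The increment is harder, because p̂ depends on the whole sample, test fold included. Its mean,
computed with the fit and the cutoffs held fixed, is the change of the population mean from p₀ to p̂
up to O(ρ_e ‖p̂ - p₀‖) (`abs_integral_recWeight_mul_sub_le`). Its fluctuation is bounded by a
maximal inequality evaluated directly at the random point p̂ (`pi_symmetrization`): ghost sample,
average over swaps of coordinates, finite net, Hoeffding for random signs. Evaluating at one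
measurable random point avoids suprema over uncountable classes. Increments have second moment of
order ‖p - p₀‖, so the fluctuation shrinks near p₀; to use this, the empirical second moment is
first controlled by the same inequality for the squares (`pi_local_deviation_le`).

The outcome is `IsExpansionError`: an averaged score difference is the population change plus an
error that is at most n^(-7/16) plus a small multiple of ‖p̂ - p₀‖ everywhere on S, and o(n^(-1/2))
plus such a multiple within n^(-3/8) of p₀.

Net demand z then pins p̂ down. Approximate clearing makes the estimated net demand at p̂ of order
o(n^(-1/2)). It equals A + z(p̂) + error, where A = O_p(n^(-1/2)) is the average true net-demand
score at p₀. Since c ‖p - p₀‖ ≤ ‖z(p)‖ on all of S (`exists_mul_norm_sub_le`), the rough error gives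
the rate n^(-3/8), the sharp error then gives n^(-1/2), and z(p̂) = -A + o_p(n^(-1/2)). Linearizing
y along z turns y(p̂) - y(p₀) into ν z(p̂) = -ν A up to o_p(n^(-1/2)), which is the correction term
of the efficient score (`tendstoInMeasure_of_isExpansionError`).

Two devices make this rigorous: the estimators are rewritten on the product space of seeds and
records (`map_seed_sample`), and propensity scores are truncated to [κ, 1 - κ], which almost surely
changes nothing at the sample points. -/

noncomputable section

namespace CutoffMarket

/-! ### Resampling and swapping coordinates of a product measure -/

section Resampling

variable {ι R : Type*} [Fintype ι] [DecidableEq ι] [MeasurableSpace R] (Q : Measure R)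
  [IsProbabilityMeasure Q]

/-- Replacing the coordinates in `I` by those of an independent copy preserves the law. -/
lemma measurePreserving_piecewise (I : Finset ι) :
    MeasurePreserving (fun q : (ι → R) × (ι → R) => I.piecewise q.2 q.1)
      ((Measure.pi fun _ : ι => Q).prod (Measure.pi fun _ : ι => Q))
      (Measure.pi fun _ : ι => Q) := by
  -- Two independent vectors are one vector of independent pairs, on which the operation acts
  -- coordinate by coordinate.
  have h1 := (measurePreserving_arrowProdEquivProdArrow R R ι (fun _ => Q) (fun _ => Q)).symm
  have h2 : MeasurePreserving
      (fun (a : ι → R × R) i => (if i ∈ I then Prod.snd else Prod.fst : R × R → R) (a i))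
      (Measure.pi fun _ => Q.prod Q) (Measure.pi fun _ => Q) := by
    refine measurePreserving_pi (fun _ : ι => Q.prod Q) (fun _ => Q)
      (f := fun i => (if i ∈ I then Prod.snd else Prod.fst : R × R → R)) fun i => ?_
    by_cases h : i ∈ I
    · simpa [h] using measurePreserving_snd
    · simpa [h] using measurePreserving_fst
  convert h2.comp h1 using 1
  funext q i
  by_cases h : i ∈ I <;>
    simp [h, Finset.piecewise, MeasurableEquiv.arrowProdEquivProdArrow,
      Equiv.arrowProdEquivProdArrow]

/-- Swapping the coordinates in `I` of two independent copies preserves their joint law. -/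
lemma measurePreserving_swap_piecewise (I : Finset ι) :
    MeasurePreserving
      (fun q : (ι → R) × (ι → R) => (I.piecewise q.2 q.1, I.piecewise q.1 q.2))
      ((Measure.pi fun _ : ι => Q).prod (Measure.pi fun _ : ι => Q))
      ((Measure.pi fun _ : ι => Q).prod (Measure.pi fun _ : ι => Q)) := by
  have h0 := measurePreserving_arrowProdEquivProdArrow R R ι (fun _ => Q) (fun _ => Q)
  have h2 : MeasurePreserving
      (fun (a : ι → R × R) i => (if i ∈ I then Prod.swap else id : R × R → R × R) (a i))
      (Measure.pi fun _ => Q.prod Q) (Measure.pi fun _ => Q.prod Q) := by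
    refine measurePreserving_pi (fun _ : ι => Q.prod Q) (fun _ => Q.prod Q)
      (f := fun i => (if i ∈ I then Prod.swap else id : R × R → R × R)) fun i => ?_
    by_cases h : i ∈ I
    · simpa [h] using Measure.measurePreserving_swap
    · simpa [h] using MeasurePreserving.id _
  convert h0.comp (h2.comp h0.symm) using 1
  funext q
  ext i <;> by_cases h : i ∈ I <;>
    simp [h, Finset.piecewise, MeasurableEquiv.arrowProdEquivProdArrow,
      Equiv.arrowProdEquivProdArrow]

/-- Chebyshev's inequality for sums of functions of independent coordinates. -/
lemma pi_abs_sum_sub_ge_le (I : Finset ι) {h : R → ℝ} (hh : MemLp h 2 Q) {s t : ℝ}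
    (hs : ∫ r, h r ^ 2 ∂Q ≤ s) (ht : 0 < t) :
    (Measure.pi fun _ : ι => Q) {u | t ≤ |∑ i ∈ I, (h (u i) - ∫ r, h r ∂Q)|}
      ≤ ENNReal.ofReal (I.card * s / t ^ 2) := by
  -- Padding with zero outside I turns the partial sum into a full one, to which the variance
  -- formula on the product space applies.
  set X : ι → R → ℝ := fun i => if i ∈ I then h else 0 with hX
  have hXm : ∀ i, MemLp (X i) 2 Q := by
    intro i; by_cases hi : i ∈ I
    · simpa [hX, hi] using hh
    · simp [hX, hi]
  have hmp : ∀ i, MeasurePreserving (fun u : ι → R => u i) (Measure.pi fun _ : ι => Q) Q :=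
    fun i => measurePreserving_eval (fun _ => Q) i
  have hXu : ∀ i, MemLp (fun u : ι → R => X i (u i)) 2 (Measure.pi fun _ : ι => Q) :=
    fun i => (hXm i).comp_measurePreserving (hmp i)
  have hsum : MemLp (∑ i, fun u : ι → R => X i (u i)) 2 (Measure.pi fun _ : ι => Q) :=
    memLp_finsetSum' _ fun i _ => hXu i
  have hvar := variance_sum_pi (μ := fun _ : ι => Q) hXm
  have hvarh : ∀ i, Var[X i; Q] ≤ if i ∈ I then s else 0 := by
    intro i; by_cases hi : i ∈ I
    · simp only [hX, hi, if_true]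
      refine le_trans ?_ hs
      have := variance_le_expectation_sq (μ := Q) hh.1
      simpa using this
    · simp [hX, hi]
  have hint : ∫ u, (∑ i, fun u : ι → R => X i (u i)) u ∂(Measure.pi fun _ : ι => Q)
      = ∑ i ∈ I, ∫ r, h r ∂Q := by
    simp only [Finset.sum_apply]
    rw [integral_finsetSum _ fun i _ => (hXu i).integrable (by norm_num)]
    rw [← Finset.sum_subset (Finset.subset_univ I)]
    · refine Finset.sum_congr rfl fun i hi => ?_
      simp only [hX, hi, if_true]
      have hQ := (hmp i).map_eq
      have := integral_map (hmp i).measurable.aemeasurable (hQ.symm ▸ hh.1)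
      rw [hQ] at this
      exact this.symm
    · intro i _ hi; simp [hX, hi]
  have := meas_ge_le_variance_div_sq hsum ht
  rw [hint] at this
  calc _ = (Measure.pi fun _ : ι => Q) {ω | t ≤ |(∑ i, fun u : ι → R => X i (u i)) ω
        - ∑ i ∈ I, ∫ r, h r ∂Q|} := by
        congr 1; ext u
        simp only [Set.mem_ofPred_eq, Finset.sum_apply, Finset.sum_sub_distrib]
        rw [← Finset.sum_subset (Finset.subset_univ I) (f := fun i => X i (u i))]
        · rw [Finset.sum_congr rfl fun i hi => show X i (u i) = h (u i) by simp [hX, hi]]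
        · intro i _ hi; simp [hX, hi]
    _ ≤ _ := this
    _ ≤ _ := by
        apply ENNReal.ofReal_le_ofReal
        gcongr
        rw [hvar]
        refine (Finset.sum_le_sum fun i _ => hvarh i).trans ?_
        simp

/-- `f` depends on the sample only through the observations outside of `I`. -/
def IndepOfCoords {β : Sort*} (I : Finset ι) (f : (ι → R) → β) : Prop :=
  ∀ u v : ι → R, (∀ i ∉ I, u i = v i) → f u = f v

/-- Chebyshev's inequality for a sum over the test sample `I` of a function that is fitted on the
remaining observations. -/
lemma pi_crossfit_chebyshev (I : Finset ι) {h : (ι → R) → R → ℝ}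
    (hm : Measurable fun q : (ι → R) × R => h q.1 q.2) (hI : IndepOfCoords I h)
    {G : Set (ι → R)} (hG : MeasurableSet G) (hGI : IndepOfCoords I fun u => u ∈ G)
    {s t : ℝ} (hL2 : ∀ u ∈ G, MemLp (h u) 2 Q) (hs : ∀ u ∈ G, ∫ r, h u r ^ 2 ∂Q ≤ s)
    (ht : 0 < t) :
    (Measure.pi fun _ : ι => Q) {u | u ∈ G ∧ t ≤ |∑ i ∈ I, (h u (u i) - ∫ r, h u r ∂Q)|}
      ≤ ENNReal.ofReal (I.card * s / t ^ 2) := by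
  set E : Set (ι → R) := {u | u ∈ G ∧ t ≤ |∑ i ∈ I, (h u (u i) - ∫ r, h u r ∂Q)|}
  have hE : MeasurableSet E := by
    have hS : Measurable fun u : ι → R => |∑ i ∈ I, (h u (u i) - ∫ r, h u r ∂Q)| := by
      refine (Finset.measurable_sum _ fun i _ => ?_).abs
      refine Measurable.sub (hm.comp (measurable_id.prodMk (measurable_pi_apply i))) ?_
      exact (hm.stronglyMeasurable.integral_prod_right).measurable
    exact hG.inter (measurableSet_le measurable_const hS)
  -- Resampling the coordinates in I keeps the law and separates training from test data: for fixed
  -- u the fitted h and the event G are frozen, and only the fresh coordinates v enter the sum.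
  have hmp := measurePreserving_piecewise Q I
  rw [← hmp.measure_preimage hE.nullMeasurableSet, Measure.prod_apply (hmp.measurable hE)]
  calc _ ≤ ∫⁻ _, ENNReal.ofReal (I.card * s / t ^ 2) ∂(Measure.pi fun _ : ι => Q) := by
        refine lintegral_mono fun u => ?_
        by_cases hu : u ∈ G
        · refine le_trans (measure_mono ?_)
            (pi_abs_sum_sub_ge_le Q I (hL2 u hu) (hs u hu) ht)
          rintro v ⟨-, hv⟩
          have hoff : h (I.piecewise v u) = h u := hI _ _ fun i hi => by simp [hi]
          simp only [hoff] at hv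
          rw [Set.mem_ofPred_eq]
          convert hv using 3 with i hi
          simp [hi]
        · have : (Prod.mk u ⁻¹' ((fun q : (ι → R) × (ι → R) => I.piecewise q.2 q.1) ⁻¹' E))
              = ∅ := by
            ext v
            simp only [Set.mem_preimage, Set.mem_empty_iff_false, iff_false]
            rintro ⟨hv, -⟩
            exact hu ((hGI _ u fun i hi => by simp [hi]).mp hv)
          simp [this]
    _ = _ := by simp

/-- A property that holds almost surely for an independent test observation holds almost surely for
all observations in the test sample `I`. -/
lemma pi_crossfit_ae (I : Finset ι) {N : Set ((ι → R) × R)} (hN : MeasurableSet N)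
    (hNI : IndepOfCoords I fun u r => (u, r) ∈ N) {G : Set (ι → R)} (hG : MeasurableSet G)
    (hGI : IndepOfCoords I fun u => u ∈ G) (h0 : ∀ u ∈ G, Q {r | (u, r) ∈ N} = 0) :
    (Measure.pi fun _ : ι => Q) {u | u ∈ G ∧ ∃ i ∈ I, (u, u i) ∈ N} = 0 := by
  set E : Set (ι → R) := {u | u ∈ G ∧ ∃ i ∈ I, (u, u i) ∈ N}
  have hE : MeasurableSet E := by
    have : E = G ∩ ⋃ i ∈ I, (fun u : ι → R => (u, u i)) ⁻¹' N := by ext u; simp [E]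
    rw [this]
    exact hG.inter (Finset.measurableSet_biUnion _ fun i _ =>
      (measurable_id.prodMk (measurable_pi_apply i)) hN)
  have hmp := measurePreserving_piecewise Q I
  rw [← hmp.measure_preimage hE.nullMeasurableSet, Measure.prod_apply (hmp.measurable hE)]
  refine (lintegral_congr fun u => ?_).trans (lintegral_zero)
  by_cases hu : u ∈ G
  · refine measure_mono_null (t := ⋃ i ∈ I, (fun v : ι → R => v i) ⁻¹' {r | (u, r) ∈ N}) ?_ ?_
    · rintro v ⟨-, i, hi, hv⟩
      have hoff := hNI (I.piecewise v u) u fun i hi => by simp [hi]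
      simp only [Set.mem_iUnion]
      refine ⟨i, hi, ?_⟩
      have := congrFun hoff (v i)
      simp only [eq_iff_iff] at this
      exact this.mp (by simpa [hi] using hv)
    · refine (measure_biUnion_null_iff (Finset.countable_toSet I)).mpr fun i _ => ?_
      rw [(measurePreserving_eval (fun _ : ι => Q) i).measure_preimage]
      · exact h0 u hu
      · exact (measurable_prodMk_left hN).nullMeasurableSet
  · refine measure_mono_null (t := ∅) ?_ (by simp)
    rintro v ⟨hv, -⟩
    exact hu ((hGI _ u fun i hi => by simp [hi]).mp hv)

end Resampling

/-! ### Concentration of signed sums -/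

section Signs

variable {ι : Type*} [DecidableEq ι]

/-- Up to the factor 2^|I| this is the moment generating function of a sum with random signs: it
factorizes into terms 2 cosh(l a_i), and cosh x ≤ exp(x²/2). -/
lemma sum_powerset_exp_signed_le (I : Finset ι) (a : ι → ℝ) (l : ℝ) :
    ∑ J ∈ I.powerset, Real.exp (l * ∑ i ∈ I, if i ∈ J then -a i else a i)
      ≤ 2 ^ I.card * Real.exp (l ^ 2 * (∑ i ∈ I, a i ^ 2) / 2) := by
  have h1 : ∑ J ∈ I.powerset, Real.exp (l * ∑ i ∈ I, if i ∈ J then -a i else a i)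
      = ∏ i ∈ I, (Real.exp (-(l * a i)) + Real.exp (l * a i)) := by
    rw [Finset.prod_add]
    refine Finset.sum_congr rfl fun J hJ => ?_
    rw [Finset.mul_sum, Real.exp_sum, ← Finset.prod_sdiff (Finset.mem_powerset.mp hJ), mul_comm]
    congr 1
    · refine Finset.prod_congr rfl fun i hi => by simp [hi]
    · refine Finset.prod_congr rfl fun i hi => by simp [(Finset.mem_sdiff.mp hi).2]
  have h2 : ∀ i ∈ I, Real.exp (-(l * a i)) + Real.exp (l * a i)
      ≤ 2 * Real.exp (l ^ 2 * a i ^ 2 / 2) := by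
    intro i _
    have := Real.cosh_le_exp_half_sq (l * a i)
    rw [Real.cosh_eq, mul_pow] at this
    linarith
  rw [h1]
  refine (Finset.prod_le_prod (fun i _ => by positivity) h2).trans ?_
  rw [Finset.prod_mul_distrib, Finset.prod_const, ← Real.exp_sum, Finset.mul_sum, Finset.sum_div]

/-- Hoeffding's inequality for uniform random signs, as a counting statement. -/
lemma card_signed_sum_ge_le (I : Finset ι) (a : ι → ℝ) {B s : ℝ} (hB : 0 < B) (hs : 0 ≤ s)
    (ha : ∑ i ∈ I, a i ^ 2 ≤ B) :
    ((I.powerset.filter fun J => s ≤ |∑ i ∈ I, if i ∈ J then -a i else a i|).card : ℝ)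
      ≤ 2 ^ I.card * (2 * Real.exp (-(s ^ 2 / (2 * B)))) := by
  set S : Finset ι → ℝ := fun J => ∑ i ∈ I, if i ∈ J then -a i else a i
  -- The minimizer of -l s + l² B / 2, which produces the exponent -s²/(2B).
  set l := s / B
  have hl : 0 ≤ l := by positivity
  have key : ∀ J, s ≤ |S J| →
      1 ≤ Real.exp (-(l * s)) * (Real.exp (l * S J) + Real.exp (-l * S J)) := by
    intro J hJ
    rw [mul_add, ← Real.exp_add, ← Real.exp_add]
    rcases abs_cases (S J) with ⟨h, -⟩ | ⟨h, -⟩ <;> rw [h] at hJ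
    · have : 1 ≤ Real.exp (-(l * s) + l * S J) := Real.one_le_exp (by nlinarith)
      linarith [Real.exp_pos (-(l * s) + -l * S J)]
    · have : 1 ≤ Real.exp (-(l * s) + -l * S J) := Real.one_le_exp (by nlinarith)
      linarith [Real.exp_pos (-(l * s) + l * S J)]
  have hmono : Real.exp (l ^ 2 * (∑ i ∈ I, a i ^ 2) / 2) ≤ Real.exp (l ^ 2 * B / 2) := by
    gcongr
  calc ((I.powerset.filter fun J => s ≤ |S J|).card : ℝ)
      = ∑ J ∈ I.powerset.filter fun J => s ≤ |S J|, (1 : ℝ) := by simp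
    _ ≤ ∑ J ∈ I.powerset.filter fun J => s ≤ |S J|,
        Real.exp (-(l * s)) * (Real.exp (l * S J) + Real.exp (-l * S J)) :=
        Finset.sum_le_sum fun J hJ => key J (Finset.mem_filter.mp hJ).2
    _ ≤ ∑ J ∈ I.powerset,
        Real.exp (-(l * s)) * (Real.exp (l * S J) + Real.exp (-l * S J)) :=
        Finset.sum_le_sum_of_subset_of_nonneg (Finset.filter_subset _ _)
          fun J _ _ => by positivity
    _ = Real.exp (-(l * s)) * (∑ J ∈ I.powerset, Real.exp (l * S J)
          + ∑ J ∈ I.powerset, Real.exp (-l * S J)) := by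
        rw [← Finset.mul_sum, Finset.sum_add_distrib]
    _ ≤ Real.exp (-(l * s)) * (2 ^ I.card * Real.exp (l ^ 2 * B / 2)
          + 2 ^ I.card * Real.exp (l ^ 2 * B / 2)) := by
        gcongr
        · exact (sum_powerset_exp_signed_le I a l).trans (by gcongr)
        · refine (sum_powerset_exp_signed_le I a (-l)).trans ?_
          rw [neg_sq]; gcongr
    _ = 2 ^ I.card * (2 * (Real.exp (-(l * s)) * Real.exp (l ^ 2 * B / 2))) := by ring
    _ = _ := by
        rw [← Real.exp_add]
        congr 3
        simp only [l]; field_simp; ring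

end Signs

/-! ### Nets from covering numbers -/

/-- The covering hypothesis, applied to the uniform measure on the points b k, gives L² balls whose
centres need not come from the class. Doubling the radius moves the centres into the image of A, and
Cauchy–Schwarz passes from L² distance to a sum of absolute values. Keeping the net inside A
matters: its points inherit every constraint that defines A. -/
lemma exists_net_of_polynomialCovering {𝓑 Θ κ : Type*} [Fintype κ] {v : 𝓑 → Θ → ℝ} {S A : Set Θ}
    {C h : ℝ} (hC : 0 ≤ C) (hcov : PolynomialCovering ((fun p b => v b p) '' S) C h)
    (b : κ → 𝓑) {ε : ℝ} (h0 : 0 < ε) (h1 : ε < 1) (hA : A ⊆ S) :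
    ∃ F : Finset Θ, ↑F ⊆ A ∧ (F.card : ℝ) ≤ 1 + C * (1 / ε) ^ h ∧
      ∀ θ ∈ A, ∃ θ' ∈ F, ∑ k, |v (b k) θ - v (b k) θ'| ≤ Fintype.card κ * (2 * ε) := by
  classical
  rcases A.eq_empty_or_nonempty with rfl | ⟨θ₀, hθ₀⟩
  · exact ⟨∅, by simp, by simp; positivity, by simp⟩
  -- Without points there is no uniform measure, but any single parameter will do; the 1 in the
  -- cardinality bound accounts for this case.
  rcases isEmpty_or_nonempty κ with hκ | hκ
  · refine ⟨{θ₀}, by simpa using hθ₀, ?_, fun θ _ => ⟨θ₀, by simp, by simp⟩⟩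
    simp; positivity
  set N := Fintype.card κ
  have hN : 0 < N := Fintype.card_pos
  have hN' : (0 : ℝ) < N := by exact_mod_cast hN
  let eq := Fintype.equivFin κ
  let b' : Fin N → 𝓑 := fun i => b (eq.symm i)
  let q : Fin N → ℝ := fun _ => (N : ℝ)⁻¹
  have hq : q ∈ stdSimplex ℝ (Fin N) :=
    ⟨fun _ => by positivity, by simp [q, hN'.ne']⟩
  have hc := hcov N b' q hq ⟨ε, h0.le⟩ (by exact_mod_cast h0) (by exact_mod_cast h1)
  let w : Θ → EuclideanSpace ℝ (Fin N) := fun θ => l2Vec b' q (fun b => v b θ)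
  set T := l2Vec b' q '' ((fun p b => v b p) '' S)
  set e : ℝ≥0 := ⟨ε, h0.le⟩
  have hwT : w '' A ⊆ T := by
    rintro _ ⟨θ, hθ, rfl⟩
    exact ⟨_, ⟨θ, hA hθ, rfl⟩, rfl⟩
  have hle : Metric.coveringNumber (2 * e) (w '' A) ≤ Metric.externalCoveringNumber e T :=
    (Metric.coveringNumber_two_mul_le_externalCoveringNumber e _).trans
      (Metric.externalCoveringNumber_mono_set hwT)
  have hlt : Metric.coveringNumber (2 * e) (w '' A) ≠ ⊤ := by
    intro h; rw [h, top_le_iff] at hle; rw [hle] at hc; simp at hc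
  obtain ⟨D, hDA, hDfin, hDcov, hDc⟩ := Metric.exists_set_encard_eq_coveringNumber hlt
  have hDcard : (hDfin.toFinset.card : ℝ) ≤ C * (1 / ε) ^ h := by
    have hc := (ENat.toENNReal_le.mpr hle).trans hc
    rw [← hDc, hDfin.encard_eq_coe_toFinset_card] at hc
    simp only [ENat.toENNReal_coe] at hc
    rw [← ENNReal.ofReal_natCast] at hc
    exact (ENNReal.ofReal_le_ofReal_iff (by positivity)).mp hc
  have : Nonempty Θ := ⟨θ₀⟩
  let pick := Function.invFunOn w A
  refine ⟨hDfin.toFinset.image pick, ?_, ?_, ?_⟩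
  · intro θ hθ
    obtain ⟨c, hc, rfl⟩ := Finset.mem_image.mp (Finset.mem_coe.mp hθ)
    exact Function.invFunOn_mem (hDA (hDfin.mem_toFinset.mp hc))
  · calc ((hDfin.toFinset.image pick).card : ℝ) ≤ hDfin.toFinset.card := by
          exact_mod_cast Finset.card_image_le
      _ ≤ _ := by linarith
  · intro θ hθ
    obtain ⟨c, hcD, hcd⟩ := hDcov (Set.mem_image_of_mem w hθ)
    have hcd : edist (w θ) c ≤ ((2 * e : ℝ≥0) : ℝ≥0∞) := hcd
    refine ⟨pick c, Finset.mem_image.mpr ⟨c, hDfin.mem_toFinset.mpr hcD, rfl⟩, ?_⟩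
    have hdist : dist (w θ) (w (pick c)) ≤ 2 * ε := by
      rw [show w (pick c) = c from Function.invFunOn_eq (hDA hcD)]
      rw [edist_nndist, ENNReal.coe_le_coe, ← NNReal.coe_le_coe, coe_nndist] at hcd
      exact hcd
    have hsq : ∑ i : Fin N, (N : ℝ)⁻¹ * (v (b' i) θ - v (b' i) (pick c)) ^ 2 ≤ (2 * ε) ^ 2 := by
      have : dist (w θ) (w (pick c)) ^ 2 ≤ (2 * ε) ^ 2 := by gcongr
      rw [EuclideanSpace.dist_eq, Real.sq_sqrt (by positivity)] at this
      refine le_of_eq_of_le (Finset.sum_congr rfl fun i _ => ?_) this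
      simp only [w, l2Vec, Real.dist_eq, sq_abs, q, ← mul_sub, mul_pow]
      rw [Real.sq_sqrt (by positivity)]
    have hsum : ∑ k, |v (b k) θ - v (b k) (pick c)|
        = ∑ i : Fin N, |v (b' i) θ - v (b' i) (pick c)| :=
      (eq.symm.sum_comp fun k => |v (b k) θ - v (b k) (pick c)|).symm
    rw [hsum]
    refine abs_le_of_sq_le_sq' ?_ (by positivity) |>.2
    have hcs := sq_sum_le_card_mul_sum_sq (s := (Finset.univ : Finset (Fin N)))
      (f := fun i => |v (b' i) θ - v (b' i) (pick c)|)
    simp only [sq_abs, Finset.card_univ, Fintype.card_fin] at hcs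
    refine hcs.trans ?_
    rw [← Finset.mul_sum, inv_mul_le_iff₀ hN'] at hsq
    calc _ ≤ (N : ℝ) * (N * (2 * ε) ^ 2) := by gcongr
      _ = _ := by ring

/-! ### Symmetrization at a random point -/

section Symmetrization

variable {ι R Θ : Type*} [DecidableEq ι]

/-- For fixed values of the sample and of the ghost sample, few patterns of swaps lead to a large
symmetrized sum. -/
lemma card_swap_deviation_le (I : Finset ι) {f : Θ → R → ℝ} {A : Set Θ} (x x' : ι → R) {V t m : ℝ}
    (hV : 0 < V) (ht : 0 < t)
    (hnet : ∀ A' ⊆ A, ∃ D : Finset Θ, ↑D ⊆ A' ∧ (D.card : ℝ) ≤ m ∧ ∀ θ ∈ A', ∃ θ' ∈ D,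
      ∑ i ∈ I, (|f θ (x i) - f θ' (x i)| + |f θ (x' i) - f θ' (x' i)|) ≤ t / 4) (s : Finset (Finset ι))
    (hs : s ⊆ I.powerset)
    (hdev : ∀ J ∈ s, ∃ θ ∈ A, ∑ i ∈ I, (f θ (x i) ^ 2 + f θ (x' i) ^ 2) ≤ 2 * V ∧
      t / 2 ≤ |∑ i ∈ I, if i ∈ J then -(f θ (x i) - f θ (x' i)) else f θ (x i) - f θ (x' i)|) :
    (s.card : ℝ) ≤ 2 ^ I.card * (2 * m * Real.exp (-(t ^ 2 / (128 * V)))) := by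
  classical
  -- The net is taken where the second moment over both samples is controlled, so that Hoeffding's
  -- bound applies at every net point.
  set A' : Set Θ := {θ | θ ∈ A ∧ ∑ i ∈ I, (f θ (x i) ^ 2 + f θ (x' i) ^ 2) ≤ 2 * V}
  obtain ⟨D, hDA, hDm, hD⟩ := hnet A' fun θ h => h.1
  set a : Θ → ι → ℝ := fun θ i => f θ (x i) - f θ (x' i)
  have hsub : s ⊆ D.biUnion fun θ' =>
      I.powerset.filter fun J => t / 4 ≤ |∑ i ∈ I, if i ∈ J then -a θ' i else a θ' i| := by
    intro J hJ
    obtain ⟨θ, hθA, hθV, hθt⟩ := hdev J hJ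
    obtain ⟨θ', hθ', hclose⟩ := hD θ ⟨hθA, hθV⟩
    refine Finset.mem_biUnion.mpr ⟨θ', hθ', Finset.mem_filter.mpr ⟨hs hJ, ?_⟩⟩
    have hdiff : |(∑ i ∈ I, if i ∈ J then -a θ i else a θ i)
        - ∑ i ∈ I, if i ∈ J then -a θ' i else a θ' i| ≤ t / 4 := by
      rw [← Finset.sum_sub_distrib]
      refine (Finset.abs_sum_le_sum_abs _ _).trans (le_trans ?_ hclose)
      refine Finset.sum_le_sum fun i _ => ?_
      have h1 : |a θ i - a θ' i| ≤ |f θ (x i) - f θ' (x i)| + |f θ (x' i) - f θ' (x' i)| := by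
        simp only [a]
        rw [show f θ (x i) - f θ (x' i) - (f θ' (x i) - f θ' (x' i))
          = (f θ (x i) - f θ' (x i)) - (f θ (x' i) - f θ' (x' i)) by ring]
        exact abs_sub _ _
      split_ifs
      · rwa [show -a θ i - -a θ' i = -(a θ i - a θ' i) by ring, abs_neg]
      · exact h1
    have := abs_sub_abs_le_abs_sub (∑ i ∈ I, if i ∈ J then -a θ i else a θ i)
      (∑ i ∈ I, if i ∈ J then -a θ' i else a θ' i)
    simp only [a] at *
    linarith
  have hB : ∀ θ' ∈ D, ∑ i ∈ I, a θ' i ^ 2 ≤ 4 * V := by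
    intro θ' hθ'
    have h2 := (hDA hθ').2
    calc ∑ i ∈ I, a θ' i ^ 2 ≤ ∑ i ∈ I, 2 * (f θ' (x i) ^ 2 + f θ' (x' i) ^ 2) := by
          refine Finset.sum_le_sum fun i _ => ?_
          simp only [a]; nlinarith [sq_nonneg (f θ' (x i) + f θ' (x' i))]
      _ ≤ 4 * V := by rw [← Finset.mul_sum]; linarith
  have hcount : ∀ θ' ∈ D, ((I.powerset.filter fun J =>
      t / 4 ≤ |∑ i ∈ I, if i ∈ J then -a θ' i else a θ' i|).card : ℝ)
      ≤ 2 ^ I.card * (2 * Real.exp (-(t ^ 2 / (128 * V)))) := by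
    intro θ' hθ'
    -- Passing to the net lowers the threshold from t/2 to t/4, and (t/4)² / (2 · 4V) = t² / (128
    -- V).
    have := card_signed_sum_ge_le I (a θ') (B := 4 * V) (s := t / 4) (by positivity)
      (by positivity) (hB θ' hθ')
    convert this using 5
    field_simp; ring
  calc (s.card : ℝ) ≤ ∑ θ' ∈ D, ((I.powerset.filter fun J =>
        t / 4 ≤ |∑ i ∈ I, if i ∈ J then -a θ' i else a θ' i|).card : ℝ) := by
        exact_mod_cast (Finset.card_le_card hsub).trans Finset.card_biUnion_le
    _ ≤ ∑ θ' ∈ D, 2 ^ I.card * (2 * Real.exp (-(t ^ 2 / (128 * V)))) := Finset.sum_le_sum hcount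
    _ = D.card * (2 ^ I.card * (2 * Real.exp (-(t ^ 2 / (128 * V))))) := by simp
    _ ≤ m * (2 ^ I.card * (2 * Real.exp (-(t ^ 2 / (128 * V))))) := by gcongr
    _ = _ := by ring

variable [Fintype ι] [MeasurableSpace R] [MeasurableSpace Θ] (Q : Measure R)
  [IsProbabilityMeasure Q]

/-- Maximal inequality at a data-dependent parameter `p u`: for functions `f u θ` that are fitted
outside of the test sample `I`, the centered sum over the test sample at `θ = p u` is small unless
its empirical second moment is large. -/
lemma pi_symmetrization (I : Finset ι) {f : (ι → R) → Θ → R → ℝ}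
    (hf : Measurable fun q : (ι → R) × Θ × R => f q.1 q.2.1 q.2.2) (hI : IndepOfCoords I f)
    {p : (ι → R) → Θ} (hp : Measurable p) {A : Set Θ} (hA : MeasurableSet A)
    {V t m s2 : ℝ} (hV : 0 < V) (ht : 0 < t)
    (hL2 : ∀ u, ∀ θ ∈ A, MemLp (f u θ) 2 Q) (hs : ∀ u, ∀ θ ∈ A, ∫ r, f u θ r ^ 2 ∂Q ≤ s2)
    (hcheb : I.card * s2 / (t / 2) ^ 2 ≤ 1 / 4) (hmark : I.card * s2 / V ≤ 1 / 4)
    (hnet : ∀ u (x x' : ι → R), ∀ A' ⊆ A, ∃ D : Finset Θ, ↑D ⊆ A' ∧ (D.card : ℝ) ≤ m ∧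
      ∀ θ ∈ A', ∃ θ' ∈ D, ∑ i ∈ I, (|f u θ (x i) - f u θ' (x i)|
        + |f u θ (x' i) - f u θ' (x' i)|) ≤ t / 4) :
    (Measure.pi fun _ : ι => Q) {u | p u ∈ A ∧ ∑ i ∈ I, f u (p u) (u i) ^ 2 ≤ V ∧
        t < |∑ i ∈ I, (f u (p u) (u i) - ∫ r, f u (p u) r ∂Q)|}
      ≤ ENNReal.ofReal (4 * m * Real.exp (-(t ^ 2 / (128 * V)))) := by
  set P := (Measure.pi fun _ : ι => Q) with hP
  set E : Set (ι → R) := {u | p u ∈ A ∧ ∑ i ∈ I, f u (p u) (u i) ^ 2 ≤ V ∧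
        t < |∑ i ∈ I, (f u (p u) (u i) - ∫ r, f u (p u) r ∂Q)|} with hEdef
  -- Pairs of a sample and a ghost sample, with the parameter still chosen by the first; the
  -- deviation is now between the two samples, at threshold t/2.
  set E2 : Set ((ι → R) × (ι → R)) := {q | p q.1 ∈ A ∧ ∑ i ∈ I, f q.1 (p q.1) (q.1 i) ^ 2 ≤ V ∧
      ∑ i ∈ I, f q.1 (p q.1) (q.2 i) ^ 2 ≤ V ∧
      t / 2 ≤ |∑ i ∈ I, (f q.1 (p q.1) (q.1 i) - f q.1 (p q.1) (q.2 i))|} with hE2def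
  have hfi : ∀ i, Measurable fun u : ι → R => f u (p u) (u i) := fun i =>
    hf.comp (measurable_id.prodMk (hp.prodMk (measurable_pi_apply i)))
  have hfint : Measurable fun u : ι → R => ∫ r, f u (p u) r ∂Q := by
    have : Measurable fun q : (ι → R) × R => f q.1 (p q.1) q.2 :=
      hf.comp (measurable_fst.prodMk ((hp.comp measurable_fst).prodMk measurable_snd))
    exact (this.stronglyMeasurable.integral_prod_right).measurable
  have hfi1 : ∀ i, Measurable fun q : (ι → R) × (ι → R) => f q.1 (p q.1) (q.1 i) := fun i =>
    (hfi i).comp measurable_fst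
  have hfi2 : ∀ i, Measurable fun q : (ι → R) × (ι → R) => f q.1 (p q.1) (q.2 i) := fun i =>
    hf.comp (measurable_fst.prodMk ((hp.comp measurable_fst).prodMk
      ((measurable_pi_apply i).comp measurable_snd)))
  have hE : MeasurableSet E := by
    have h1 : Measurable fun u : ι → R => ∑ i ∈ I, f u (p u) (u i) ^ 2 :=
      Finset.measurable_sum _ fun i _ => (hfi i).pow_const 2
    have h2 : Measurable fun u : ι → R => |∑ i ∈ I, (f u (p u) (u i) - ∫ r, f u (p u) r ∂Q)| :=
      (Finset.measurable_sum _ fun i _ => (hfi i).sub hfint).abs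
    exact (hp hA).inter ((measurableSet_le h1 measurable_const).inter
      (measurableSet_lt measurable_const h2))
  have hE2 : MeasurableSet E2 := by
    have h1 : Measurable fun q : (ι → R) × (ι → R) => ∑ i ∈ I, f q.1 (p q.1) (q.1 i) ^ 2 :=
      Finset.measurable_sum _ fun i _ => (hfi1 i).pow_const 2
    have h2 : Measurable fun q : (ι → R) × (ι → R) => ∑ i ∈ I, f q.1 (p q.1) (q.2 i) ^ 2 :=
      Finset.measurable_sum _ fun i _ => (hfi2 i).pow_const 2
    have h3 : Measurable fun q : (ι → R) × (ι → R) =>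
        |∑ i ∈ I, (f q.1 (p q.1) (q.1 i) - f q.1 (p q.1) (q.2 i))| :=
      (Finset.measurable_sum _ fun i _ => (hfi1 i).sub (hfi2 i)).abs
    exact ((hp.comp measurable_fst) hA).inter ((measurableSet_le h1 measurable_const).inter
      ((measurableSet_le h2 measurable_const).inter (measurableSet_le measurable_const h3)))
  -- For fixed u the parameter p u is fixed, so the ghost sums involve a single function: by
  -- Chebyshev and Markov, each of the two requirements on the ghost sample fails with probability
  -- at most 1/4.
  have hghost : ∀ u ∈ E, (1 / 2 : ℝ≥0∞) ≤ P (Prod.mk u ⁻¹' E2) := by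
    rintro u ⟨huA, huV, hut⟩
    set g := f u (p u)
    have hg : MemLp g 2 Q := hL2 u _ huA
    have hgs : ∫ r, g r ^ 2 ∂Q ≤ s2 := hs u _ huA
    have hc1 := pi_abs_sum_sub_ge_le Q I hg hgs (half_pos ht)
    have hc2 : P {v | V ≤ ∑ i ∈ I, g (v i) ^ 2} ≤ ENNReal.ofReal (I.card * s2 / V) := by
      have hmp : ∀ i, MeasurePreserving (fun u : ι → R => u i) P Q :=
        fun i => measurePreserving_eval (fun _ => Q) i
      have hgi : ∀ i, Integrable (fun v : ι → R => g (v i) ^ 2) P := fun i =>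
        (hmp i).integrable_comp_of_integrable hg.integrable_sq
      have hM := mul_meas_ge_le_integral_of_nonneg (μ := P)
        (f := fun v : ι → R => ∑ i ∈ I, g (v i) ^ 2)
        (Eventually.of_forall fun v => Finset.sum_nonneg fun i _ => sq_nonneg _)
        (integrable_finsetSum _ fun i _ => hgi i) V
      have hint : ∫ v, ∑ i ∈ I, g (v i) ^ 2 ∂P = I.card * ∫ r, g r ^ 2 ∂Q := by
        rw [integral_finsetSum _ fun i _ => hgi i]
        have : ∀ i ∈ I, ∫ v, g (v i) ^ 2 ∂P = ∫ r, g r ^ 2 ∂Q := by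
          intro i _
          have hQ := (hmp i).map_eq
          have := integral_map (hmp i).measurable.aemeasurable
            (hQ.symm ▸ hg.integrable_sq.1 : AEStronglyMeasurable (fun r => g r ^ 2) _)
          rw [hQ] at this
          exact this.symm
        rw [Finset.sum_congr rfl this]; simp
      rw [hint] at hM
      rw [← ofReal_measureReal]
      apply ENNReal.ofReal_le_ofReal
      rw [le_div_iff₀ hV, mul_comm]
      exact hM.trans (by gcongr)
    have hcompl : (Prod.mk u ⁻¹' E2)ᶜ ⊆
        {v | t / 2 ≤ |∑ i ∈ I, (g (v i) - ∫ r, g r ∂Q)|} ∪ {v | V ≤ ∑ i ∈ I, g (v i) ^ 2} := by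
      intro v hv
      by_contra hcon
      simp only [Set.mem_union, Set.mem_ofPred_eq, not_or, not_le] at hcon
      refine hv ⟨huA, huV, hcon.2.le, ?_⟩
      have h1 : (∑ i ∈ I, (g (u i) - ∫ r, g r ∂Q)) - ∑ i ∈ I, (g (v i) - ∫ r, g r ∂Q)
          = ∑ i ∈ I, (g (u i) - g (v i)) := by
        rw [← Finset.sum_sub_distrib]; exact Finset.sum_congr rfl fun i _ => by ring
      have h2 := abs_sub_abs_le_abs_sub (∑ i ∈ I, (g (u i) - ∫ r, g r ∂Q))
        (∑ i ∈ I, (g (v i) - ∫ r, g r ∂Q))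
      rw [h1] at h2
      change t / 2 ≤ |∑ i ∈ I, (g (u i) - g (v i))|
      have h3 := hcon.1
      change t < |∑ i ∈ I, (g (u i) - ∫ r, g r ∂Q)| at hut
      linarith
    have hle : P (Prod.mk u ⁻¹' E2)ᶜ ≤ 1 / 2 := by
      calc _ ≤ ENNReal.ofReal (I.card * s2 / (t / 2) ^ 2) + ENNReal.ofReal (I.card * s2 / V) :=
            (measure_mono hcompl).trans ((measure_union_le _ _).trans (add_le_add hc1 hc2))
        _ ≤ ENNReal.ofReal (1 / 4) + ENNReal.ofReal (1 / 4) := by gcongr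
        _ = ENNReal.ofReal (1 / 2) := by
            rw [← ENNReal.ofReal_add (by norm_num) (by norm_num)]; norm_num
        _ = 1 / 2 := by rw [ENNReal.ofReal_div_of_pos (by norm_num)]; simp
    have hms : MeasurableSet (Prod.mk u ⁻¹' E2) := measurable_prodMk_left hE2
    rw [prob_compl_eq_one_sub hms] at hle
    have h1 : (1 : ℝ≥0∞) ≤ 1 / 2 + P (Prod.mk u ⁻¹' E2) := tsub_le_iff_right.mp hle
    have h2 : (1 : ℝ≥0∞) - 1 / 2 ≤ P (Prod.mk u ⁻¹' E2) := tsub_le_iff_left.mpr h1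
    simpa using h2
  have hdouble : P E ≤ 2 * (P.prod P) E2 := by
    rw [Measure.prod_apply hE2]
    calc P E = 2 * ∫⁻ u, E.indicator (fun _ => (1 / 2 : ℝ≥0∞)) u ∂P := by
          rw [lintegral_indicator_const hE, ← mul_assoc, ENNReal.mul_div_cancel (by simp) (by simp),
            one_mul]
      _ ≤ _ := by
          gcongr with u
          by_cases hu : u ∈ E
          · simpa [hu] using hghost u hu
          · simp [hu]
  -- Average over all swaps J ⊆ I. Each swapped pair selects its own parameter, so the counting
  -- bound must allow θ to depend on J. The fitted functions stay the same, because swaps touch only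
  -- coordinates in I.
  have hswap : (P.prod P) E2
      ≤ ENNReal.ofReal (2 * m * Real.exp (-(t ^ 2 / (128 * V)))) := by
    classical
    set σ : Finset ι → (ι → R) × (ι → R) → (ι → R) × (ι → R) :=
      fun J q => (J.piecewise q.2 q.1, J.piecewise q.1 q.2) with hσ
    have hσm : ∀ J, MeasurePreserving (σ J) (P.prod P) (P.prod P) :=
      fun J => measurePreserving_swap_piecewise Q J
    have hcard : ((I.powerset.card : ℕ) : ℝ≥0∞) * (P.prod P) E2
        = ∫⁻ q, ((I.powerset.filter fun J => σ J q ∈ E2).card : ℝ≥0∞) ∂(P.prod P) := by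
      have : ∀ q, ((I.powerset.filter fun J => σ J q ∈ E2).card : ℝ≥0∞)
          = ∑ J ∈ I.powerset, (σ J ⁻¹' E2).indicator 1 q := by
        intro q
        rw [Finset.card_filter]
        push_cast
        exact Finset.sum_congr rfl fun J _ => by simp [Set.indicator_apply]
      simp_rw [this]
      rw [lintegral_finsetSum _ fun J _ =>
        measurable_one.indicator ((hσm J).measurable hE2)]
      have h2 : ∀ J ∈ I.powerset, ∫⁻ q, (σ J ⁻¹' E2).indicator 1 q ∂(P.prod P) = (P.prod P) E2 := by
        intro J _
        rw [lintegral_indicator_one ((hσm J).measurable hE2),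
          (hσm J).measure_preimage hE2.nullMeasurableSet]
      rw [Finset.sum_congr rfl h2]; simp
    have hptw : ∀ q, ((I.powerset.filter fun J => σ J q ∈ E2).card : ℝ≥0∞)
        ≤ ENNReal.ofReal (2 ^ I.card * (2 * m * Real.exp (-(t ^ 2 / (128 * V))))) := by
      intro q
      rw [← ENNReal.ofReal_natCast]
      apply ENNReal.ofReal_le_ofReal
      refine card_swap_deviation_le I (f := f q.1) (A := A) q.1 q.2 hV ht (hnet q.1 q.1 q.2) _
        (Finset.filter_subset _ _) fun J hJ => ?_
      obtain ⟨hJI, hA', hV1, hV2, ht2⟩ := Finset.mem_filter.mp hJ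
      have hoff : f (J.piecewise q.2 q.1) = f q.1 := hI _ _ fun i hi => by
        have : i ∉ J := fun h => hi (Finset.mem_powerset.mp hJI h)
        simp [this]
      simp only [σ, hoff] at hA' hV1 hV2 ht2
      set θ := p (J.piecewise q.2 q.1)
      refine ⟨θ, hA', ?_, ?_⟩
      -- A swap only exchanges the two entries of a pair, so the sum of squares over both samples is
      -- invariant.
      · calc _ = ∑ i ∈ I, f q.1 θ (J.piecewise q.2 q.1 i) ^ 2
              + ∑ i ∈ I, f q.1 θ (J.piecewise q.1 q.2 i) ^ 2 := by
              rw [← Finset.sum_add_distrib]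
              refine Finset.sum_congr rfl fun i _ => ?_
              by_cases hi : i ∈ J <;> simp [hi, add_comm]
          _ ≤ 2 * V := by linarith
      · convert ht2 using 3 with i hi
        by_cases hi : i ∈ J <;> simp [hi]
    have hle : ((I.powerset.card : ℕ) : ℝ≥0∞) * (P.prod P) E2
        ≤ ENNReal.ofReal (2 ^ I.card * (2 * m * Real.exp (-(t ^ 2 / (128 * V))))) := by
      rw [hcard]
      refine (lintegral_mono hptw).trans ?_
      simp
    rw [ENNReal.ofReal_mul (by positivity), Finset.card_powerset] at hle
    have h2 : ENNReal.ofReal (2 ^ I.card) = ((2 ^ I.card : ℕ) : ℝ≥0∞) := by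
      rw [← ENNReal.ofReal_natCast]; push_cast; rfl
    rw [h2] at hle
    exact (ENNReal.mul_le_mul_iff_right (by positivity) (ENNReal.natCast_ne_top _)).mp hle
  calc P E ≤ 2 * ENNReal.ofReal (2 * m * Real.exp (-(t ^ 2 / (128 * V)))) :=
        hdouble.trans (by gcongr)
    _ = _ := by
        rw [← ENNReal.ofReal_ofNat 2, ← ENNReal.ofReal_mul (by norm_num)]
        congr 1; ring

end Symmetrization

/-! ### Doubly-robust scores in the population -/

/-- The full record of one participant. -/
abbrev Rec (𝒳 𝓑 : Type*) := 𝒳 × (𝓑 × 𝓑) × Bool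

section Records

variable {𝒳 𝓑 : Type*}

/-- The potential submission in arm `w`. -/
def Rec.pot (w : Bool) (r : Rec 𝒳 𝓑) : 𝓑 := if w then r.2.1.1 else r.2.1.2

/-- The observed submission. -/
def Rec.obs (r : Rec 𝒳 𝓑) : 𝓑 := Rec.pot r.2.2 r

/-- The inverse propensity weight of a record under the rule `π`. -/
def recWeight (π e : 𝒳 → ℝ) (r : Rec 𝒳 𝓑) : ℝ := ∑ w, armProb π w r.1 * ipw w r.2.2 (e r.1)

/-- The doubly-robust score of a record with response `val` under the rule `π`. -/
def recScore (π e : 𝒳 → ℝ) (μ : Bool → 𝒳 → ℝ) (val : ℝ) (r : Rec 𝒳 𝓑) : ℝ :=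
  ∑ w, armProb π w r.1 * drScore w r.2.2 (e r.1) (μ w r.1) val

/-- The regression enters only the intercept of the score. Hence moving the response from p₀ to the
estimated cutoffs costs a weighted increment that involves no estimated regression. -/
lemma recScore_sub_recScore (π e : 𝒳 → ℝ) (μ : Bool → 𝒳 → ℝ) (a b : ℝ) (r : Rec 𝒳 𝓑) :
    recScore π e μ a r - recScore π e μ b r = recWeight π e r * (a - b) := by
  simp only [recScore, recWeight, drScore, smul_eq_mul, Fintype.sum_bool]; ring

lemma recWeight_eq (π e : 𝒳 → ℝ) (r : Rec 𝒳 𝓑) :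
    recWeight π e r = armProb π r.2.2 r.1 / (if r.2.2 then e r.1 else 1 - e r.1) := by
  rcases r with ⟨x, b, W⟩
  cases W <;> simp [recWeight, ipw, div_eq_mul_inv]

lemma armProb_mem {π : 𝒳 → ℝ} (hπ : ∀ x, π x ∈ Set.Icc (0 : ℝ) 1) (w : Bool) (x : 𝒳) :
    armProb π w x ∈ Set.Icc (0 : ℝ) 1 := by
  have := hπ x
  cases w <;> simp only [armProb, Set.mem_Icc] at * <;> simp <;> constructor <;> linarith

lemma armPropensity_mem {κ a : ℝ} (ha : a ∈ Set.Icc κ (1 - κ)) (w : Bool) :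
    (if w then a else 1 - a) ∈ Set.Icc κ (1 - κ) := by
  cases w <;> simp only [Set.mem_Icc] at * <;> simp <;> constructor <;> linarith

lemma recWeight_mem {π e : 𝒳 → ℝ} (hπ : ∀ x, π x ∈ Set.Icc (0 : ℝ) 1) {κ : ℝ} (hκ : 0 < κ)
    (he : ∀ x, e x ∈ Set.Icc κ (1 - κ)) (r : Rec 𝒳 𝓑) :
    recWeight π e r ∈ Set.Icc 0 κ⁻¹ := by
  have h1 := armProb_mem hπ r.2.2 r.1
  have h2 := armPropensity_mem (he r.1) r.2.2
  rw [recWeight_eq]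
  have h3 : 0 < (if r.2.2 then e r.1 else 1 - e r.1) := lt_of_lt_of_le hκ h2.1
  refine ⟨div_nonneg h1.1 h3.le, ?_⟩
  rw [div_le_iff₀ h3]
  calc _ ≤ 1 := h1.2
    _ = κ⁻¹ * κ := by field_simp
    _ ≤ _ := by gcongr; exact h2.1

lemma abs_ipw_sub_ipw_le {κ a b : ℝ} (hκ : 0 < κ) (ha : a ∈ Set.Icc κ (1 - κ))
    (hb : b ∈ Set.Icc κ (1 - κ)) (w W : Bool) : |ipw w W a - ipw w W b| ≤ |a - b| / κ ^ 2 := by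
  unfold ipw
  have h1 := armPropensity_mem ha w
  have h2 := armPropensity_mem hb w
  have h3 : |(if w then b else 1 - b) - (if w then a else 1 - a)| = |a - b| := by
    cases w
    · simp
    · simp [abs_sub_comm]
  by_cases hW : W = w
  · simp only [if_pos hW]
    set x := if w then a else 1 - a
    set y := if w then b else 1 - b
    have hx : 0 < x := lt_of_lt_of_le hκ h1.1
    have hy : 0 < y := lt_of_lt_of_le hκ h2.1
    rw [div_sub_div _ _ hx.ne' hy.ne', abs_div, one_mul, mul_one, h3, abs_of_pos (mul_pos hx hy)]
    gcongr
    rw [sq]; exact mul_le_mul h1.1 h2.1 hκ.le hx.le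
  · simp only [if_neg hW, sub_zero, abs_zero]; positivity

lemma abs_ipw_le {κ a : ℝ} (hκ : 0 < κ) (ha : a ∈ Set.Icc κ (1 - κ)) (w W : Bool) :
    |ipw w W a| ≤ κ⁻¹ := by
  unfold ipw
  have h1 := armPropensity_mem ha w
  by_cases hW : W = w
  · simp only [if_pos hW]
    set x := if w then a else 1 - a
    have hx : 0 < x := lt_of_lt_of_le hκ h1.1
    rw [abs_of_pos (by positivity), one_div]
    exact inv_anti₀ hκ h1.1
  · simp only [if_neg hW, abs_zero]; positivity

/-- A change of regression is multiplied by one minus the weight, a change of propensity score by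
the residual, and overlap bounds both factors. Absolute values destroy the product structure of the
bias, so this bound serves only for second moments. -/
lemma abs_recScore_sub_le {π e e' : 𝒳 → ℝ} (hπ : ∀ x, π x ∈ Set.Icc (0 : ℝ) 1) {κ K : ℝ}
    (hκ : 0 < κ) {μ μ' : Bool → 𝒳 → ℝ} {val : ℝ} {r : Rec 𝒳 𝓑}
    (he : e r.1 ∈ Set.Icc κ (1 - κ)) (he' : e' r.1 ∈ Set.Icc κ (1 - κ))
    (hμ' : ∀ w, |μ' w r.1| ≤ K) (hval : |val| ≤ K) :
    |recScore π e μ val r - recScore π e' μ' val r|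
      ≤ ∑ w : Bool, ((1 + κ⁻¹) * |μ w r.1 - μ' w r.1| + 2 * K / κ ^ 2 * |e r.1 - e' r.1|) := by
  unfold recScore
  rw [← Finset.sum_sub_distrib]
  refine (Finset.abs_sum_le_sum_abs _ _).trans (Finset.sum_le_sum fun w _ => ?_)
  have h1 := armProb_mem hπ w r.1
  rw [← mul_sub, abs_mul, abs_of_nonneg h1.1]
  have h2 : drScore w r.2.2 (e r.1) (μ w r.1) val - drScore w r.2.2 (e' r.1) (μ' w r.1) val
      = (1 - ipw w r.2.2 (e r.1)) * (μ w r.1 - μ' w r.1)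
        + (ipw w r.2.2 (e r.1) - ipw w r.2.2 (e' r.1)) * (val - μ' w r.1) := by
    simp only [drScore, smul_eq_mul]; ring
  have h3 : |1 - ipw w r.2.2 (e r.1)| ≤ 1 + κ⁻¹ :=
    (abs_sub _ _).trans (by rw [abs_one]; gcongr; exact abs_ipw_le hκ he _ _)
  have h4 : |val - μ' w r.1| ≤ 2 * K :=
    (abs_sub _ _).trans (by linarith [hμ' w])
  have h5 := abs_ipw_sub_ipw_le hκ he he' w r.2.2
  have hmain : |drScore w r.2.2 (e r.1) (μ w r.1) val - drScore w r.2.2 (e' r.1) (μ' w r.1) val|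
      ≤ (1 + κ⁻¹) * |μ w r.1 - μ' w r.1| + 2 * K / κ ^ 2 * |e r.1 - e' r.1| := by
    rw [h2]
    refine (abs_add_le _ _).trans ?_
    rw [abs_mul, abs_mul]
    refine add_le_add (by gcongr) ?_
    calc _ ≤ |e r.1 - e' r.1| / κ ^ 2 * (2 * K) := by gcongr
      _ = _ := by ring
  calc _ ≤ 1 * |drScore w r.2.2 (e r.1) (μ w r.1) val
        - drScore w r.2.2 (e' r.1) (μ' w r.1) val| := by gcongr; exact h1.2
    _ ≤ _ := by rw [one_mul]; exact hmain

variable [MeasurableSpace 𝒳] [MeasurableSpace 𝓑]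

lemma measurable_pot (w : Bool) : Measurable (Rec.pot w : Rec 𝒳 𝓑 → 𝓑) := by
  cases w
  · exact (measurable_snd.comp measurable_fst).comp measurable_snd
  · exact (measurable_fst.comp measurable_fst).comp measurable_snd

lemma measurable_obs : Measurable (Rec.obs : Rec 𝒳 𝓑 → 𝓑) := by
  have : (Rec.obs : Rec 𝒳 𝓑 → 𝓑) = fun r => if r.2.2 = true then r.2.1.1 else r.2.1.2 := by
    funext r; rcases r with ⟨x, b, W⟩; cases W <;> rfl
  rw [this]
  exact Measurable.ite ((measurable_snd.comp measurable_snd) (measurableSet_singleton true))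
    (by fun_prop) (by fun_prop)

lemma measurable_armProb {π : 𝒳 → ℝ} (hπ : Measurable π) (w : Bool) :
    Measurable (armProb π w) := by
  cases w
  · exact measurable_const.sub hπ
  · exact hπ

lemma measurable_ipw {α : Type*} [MeasurableSpace α] (w : Bool) {W : α → Bool} {e : α → ℝ}
    (hW : Measurable W) (he : Measurable e) : Measurable fun a => ipw w (W a) (e a) := by
  unfold ipw
  refine Measurable.ite (hW (measurableSet_singleton w)) ?_ measurable_const
  cases w
  · exact measurable_const.div (measurable_const.sub he)
  · exact measurable_const.div he

lemma measurable_drScore {α : Type*} [MeasurableSpace α] (w : Bool) {W : α → Bool} {e m v : α → ℝ}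
    (hW : Measurable W) (he : Measurable e) (hm : Measurable m) (hv : Measurable v) :
    Measurable fun a => drScore w (W a) (e a) (m a) (v a) := by
  unfold drScore
  simp only [smul_eq_mul]
  exact hm.add ((measurable_ipw w hW he).mul (hv.sub hm))

end Records

/-! ### Moments of weighted increments and of score errors for one scalar response -/

/-- The scalar response `v b p`, the population law `Q` of the records, the propensity score `e`,
and versions `μ` of the conditional means satisfy the regularity conditions at the cutoffs `p₀`. -/
structure RegularResponse {𝒳 𝓑 : Type*} [MeasurableSpace 𝒳] [MeasurableSpace 𝓑] {J : ℕ}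
    (Q : Measure (Rec 𝒳 𝓑)) (S : Set (Vec J)) (p₀ : Vec J) (e : 𝒳 → ℝ) (v : 𝓑 → Vec J → ℝ)
    (μ : Bool → 𝒳 → Vec J → ℝ) (κ K L C h : ℝ) : Prop where
  κ_pos : 0 < κ
  K_nonneg : 0 ≤ K
  L_nonneg : 0 ≤ L
  C_nonneg : 0 ≤ C
  h_nonneg : 0 ≤ h
  measurableSet_S : MeasurableSet S
  mem_S : p₀ ∈ S
  measurable_v : Measurable fun q : 𝓑 × Vec J => v q.1 q.2
  bounded : ∀ b, ∀ p ∈ S, |v b p| ≤ K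
  measurable_e : Measurable e
  overlap : ∀ x, e x ∈ Set.Icc κ (1 - κ)
  ident : ∀ (w : Bool) (F : 𝒳 × (𝓑 × 𝓑) → ℝ), Measurable F →
    ∫ r : Rec 𝒳 𝓑, (if r.2.2 = w then F (r.1, r.2.1) else 0) ∂Q
      = ∫ r : Rec 𝒳 𝓑, F (r.1, r.2.1) * (if w then e r.1 else 1 - e r.1) ∂Q
  measurable_mu : ∀ w, ∀ p ∈ S, Measurable fun x => μ w x p
  mu_eq : ∀ w, ∀ p ∈ S, ∀ g : 𝒳 → ℝ, Measurable g → (∃ c, ∀ x, |g x| ≤ c) →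
    ∫ r : Rec 𝒳 𝓑, g r.1 * v (r.pot w) p ∂Q = ∫ r : Rec 𝒳 𝓑, g r.1 * μ w r.1 p ∂Q
  mu_bounded : ∀ w, ∀ p ∈ S, ∀ᵐ r : Rec 𝒳 𝓑 ∂Q, |μ w r.1 p| ≤ K
  mu_lipschitz : ∀ w, ∀ p ∈ S, ∀ᵐ r : Rec 𝒳 𝓑 ∂Q, |μ w r.1 p - μ w r.1 p₀| ≤ L * ‖p - p₀‖
  l2_continuous : ∀ w, ∀ p ∈ S,
    ∫ r : Rec 𝒳 𝓑, (v (r.pot w) p - v (r.pot w) p₀) ^ 2 ∂Q ≤ L * ‖p - p₀‖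
  covering : PolynomialCovering ((fun p b => v b p) '' S) C h

/-- The Cauchy–Schwarz inequality. -/
lemma integral_abs_mul_le {α : Type*} [MeasurableSpace α] {Q : Measure α} {f g : α → ℝ} {a b : ℝ}
    (hf : MemLp f 2 Q) (hg : MemLp g 2 Q) (ha : 0 ≤ a) (hb : 0 ≤ b)
    (hfa : ∫ x, f x ^ 2 ∂Q ≤ a ^ 2) (hgb : ∫ x, g x ^ 2 ∂Q ≤ b ^ 2) :
    ∫ x, |f x| * |g x| ∂Q ≤ a * b := by
  have h := integral_mul_le_Lp_mul_Lq_of_nonneg (μ := Q) (f := fun x => |f x|) (g := fun x => |g x|)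
    Real.HolderConjugate.two_two (Eventually.of_forall fun x => abs_nonneg _)
    (Eventually.of_forall fun x => abs_nonneg _) (by simpa using hf.norm) (by simpa using hg.norm)
  refine h.trans ?_
  simp only [Real.rpow_two, sq_abs, ← Real.sqrt_eq_rpow]
  gcongr
  · exact Real.sqrt_le_iff.mpr ⟨ha, hfa⟩
  · exact Real.sqrt_le_iff.mpr ⟨hb, hgb⟩

namespace RegularResponse

variable {𝒳 𝓑 : Type*} [MeasurableSpace 𝒳] [MeasurableSpace 𝓑] {J : ℕ}
  {Q : Measure (Rec 𝒳 𝓑)} {S : Set (Vec J)} {p₀ : Vec J} {e : 𝒳 → ℝ}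
  {v : 𝓑 → Vec J → ℝ} {μ : Bool → 𝒳 → Vec J → ℝ} {κ K L C h : ℝ}
  (H : RegularResponse Q S p₀ e v μ κ K L C h) {π : 𝒳 → ℝ} (hπ : IsRule π)

/-- The mean response under the rule `π` at the cutoffs `p`. -/
def meanResp (Q : Measure (Rec 𝒳 𝓑)) (v : 𝓑 → Vec J → ℝ) (π : 𝒳 → ℝ) (p : Vec J) : ℝ :=
  ∫ r, ∑ w, armProb π w r.1 * v (r.pot w) p ∂Q

include H

lemma measurable_v_at (p : Vec J) : Measurable fun b => v b p :=
  H.measurable_v.comp (measurable_id.prodMk measurable_const)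

variable [IsProbabilityMeasure Q]

lemma integrable_bdd_mul_v {g : 𝒳 → ℝ} (hg : Measurable g) {c : ℝ} (hc : ∀ x, |g x| ≤ c) (w : Bool)
    {p : Vec J} (hp : p ∈ S) : Integrable (fun r : Rec 𝒳 𝓑 => g r.1 * v (r.pot w) p) Q := by
  refine Integrable.of_bound (C := c * K) ?_ (Eventually.of_forall fun r => ?_)
  · exact ((hg.comp measurable_fst).mul
      ((H.measurable_v_at p).comp (measurable_pot w))).aestronglyMeasurable
  · rw [Real.norm_eq_abs, abs_mul]
    exact mul_le_mul (hc _) (H.bounded _ p hp) (abs_nonneg _) ((abs_nonneg _).trans (hc r.1))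

lemma integrable_bdd_mul_mu {g : 𝒳 → ℝ} (hg : Measurable g) {c : ℝ} (hc : ∀ x, |g x| ≤ c) (w : Bool)
    {p : Vec J} (hp : p ∈ S) : Integrable (fun r : Rec 𝒳 𝓑 => g r.1 * μ w r.1 p) Q := by
  refine Integrable.of_bound (C := c * K) ?_ ((H.mu_bounded w p hp).mono fun r hr => ?_)
  · exact ((hg.comp measurable_fst).mul
      ((H.measurable_mu w p hp).comp measurable_fst)).aestronglyMeasurable
  · rw [Real.norm_eq_abs, abs_mul]
    exact mul_le_mul (hc _) hr (abs_nonneg _) ((abs_nonneg _).trans (hc r.1))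

include hπ

lemma meanResp_eq {p : Vec J} (hp : p ∈ S) :
    meanResp Q v π p = ∑ w, ∫ r : Rec 𝒳 𝓑, armProb π w r.1 * μ w r.1 p ∂Q := by
  have hb : ∀ w x, |armProb π w x| ≤ 1 := fun w x => by
    have := armProb_mem hπ.2 w x; rw [abs_of_nonneg this.1]; exact this.2
  unfold meanResp
  rw [integral_finsetSum _ fun w _ =>
    H.integrable_bdd_mul_v (measurable_armProb hπ.1 w) (hb w) w hp]
  exact Finset.sum_congr rfl fun w _ =>
    H.mu_eq w p hp _ (measurable_armProb hπ.1 w) ⟨1, hb w⟩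

omit H hπ [IsProbabilityMeasure Q] in
lemma ratio_bound {a b : ℝ} (hκ : 0 < κ) (ha : a ∈ Set.Icc κ (1 - κ)) (w : Bool) :
    |(if w then b else 1 - b) / (if w then a else 1 - a) - 1| ≤ κ⁻¹ * |a - b| := by
  have h1 := armPropensity_mem ha w
  have h3 : |(if w then b else 1 - b) - (if w then a else 1 - a)| = |a - b| := by
    cases w
    · simp
    · simp [abs_sub_comm]
  set x := if w then a else 1 - a
  have hx : 0 < x := lt_of_lt_of_le hκ h1.1
  rw [div_sub_one hx.ne', abs_div, h3, abs_of_pos hx, div_eq_mul_inv, mul_comm]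
  gcongr
  exact h1.1

omit [IsProbabilityMeasure Q] in
/-- The ratio of propensity weights, multiplied by a treatment probability. -/
lemma armProb_ratio_facts {e' : 𝒳 → ℝ} (he'm : Measurable e') (he' : ∀ x, e' x ∈ Set.Icc κ (1 - κ))
    (w : Bool) :
    Measurable (fun x => armProb π w x * ((if w then e x else 1 - e x) /
      (if w then e' x else 1 - e' x))) ∧
    ∀ x, |armProb π w x * ((if w then e x else 1 - e x) /
      (if w then e' x else 1 - e' x))| ≤ κ⁻¹ := by
  have hif : ∀ {g : 𝒳 → ℝ}, Measurable g → Measurable fun x => if w then g x else 1 - g x := by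
    intro g hg; cases w <;> simp <;> fun_prop
  refine ⟨(measurable_armProb hπ.1 w).mul ((hif H.measurable_e).div (hif he'm)), fun x => ?_⟩
  have h1 := armProb_mem hπ.2 w x
  have h2 := armPropensity_mem (he' x) w
  have h3 := armPropensity_mem (H.overlap x) w
  have hκ := H.κ_pos
  have h4 : 0 < (if w then e' x else 1 - e' x) := lt_of_lt_of_le hκ h2.1
  have h5 : 0 < (if w then e x else 1 - e x) := lt_of_lt_of_le hκ h3.1
  rw [abs_of_nonneg (mul_nonneg h1.1 (by positivity))]
  calc _ ≤ 1 * (1 / κ) := by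
        refine mul_le_mul h1.2 ?_ (by positivity) (by norm_num)
        exact div_le_div₀ (by norm_num) (by linarith [h3.2]) hκ h2.1
    _ = _ := by simp

/-- Inverse propensity weighting: the weighted mean of a response increment. -/
lemma integral_recWeight_mul {e' : 𝒳 → ℝ} (he'm : Measurable e')
    (he' : ∀ x, e' x ∈ Set.Icc κ (1 - κ)) {p : Vec J} (hp : p ∈ S) :
    ∫ r, recWeight π e' r * (v r.obs p - v r.obs p₀) ∂Q
      = ∑ w, ∫ r : Rec 𝒳 𝓑, armProb π w r.1 * ((if w then e r.1 else 1 - e r.1) /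
          (if w then e' r.1 else 1 - e' r.1)) * (μ w r.1 p - μ w r.1 p₀) ∂Q := by
  have hif : ∀ (w : Bool) {g : 𝒳 → ℝ}, Measurable g →
      Measurable fun x => if w then g x else 1 - g x := by
    intro w g hg; cases w <;> simp <;> fun_prop
  -- On the event of arm w the observed submission is the potential one, so the integrand is the arm
  -- indicator times a function of covariates and potential submissions, as `H.ident` requires.
  set F : Bool → 𝒳 × (𝓑 × 𝓑) → ℝ := fun w q =>
    armProb π w q.1 / (if w then e' q.1 else 1 - e' q.1)
      * (v (if w then q.2.1 else q.2.2) p - v (if w then q.2.1 else q.2.2) p₀) with hF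
  have hFm : ∀ w, Measurable (F w) := by
    intro w
    have hb : Measurable fun q : 𝒳 × (𝓑 × 𝓑) => if w then q.2.1 else q.2.2 := by
      cases w <;> simp <;> fun_prop
    exact (((measurable_armProb hπ.1 w).comp measurable_fst).div
      ((hif w he'm).comp measurable_fst)).mul
      (((H.measurable_v_at p).comp hb).sub ((H.measurable_v_at p₀).comp hb))
  have hκ := H.κ_pos
  have hFb : ∀ w q, |F w q| ≤ κ⁻¹ * (2 * K) := by
    intro w q
    have h1 := armProb_mem hπ.2 w q.1
    have h2 := armPropensity_mem (he' q.1) w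
    have h4 : 0 < (if w then e' q.1 else 1 - e' q.1) := lt_of_lt_of_le hκ h2.1
    rw [hF, abs_mul]
    refine mul_le_mul ?_ ?_ (abs_nonneg _) (by positivity)
    · rw [abs_of_nonneg (div_nonneg h1.1 h4.le), ← one_div]
      exact div_le_div₀ (by norm_num) h1.2 hκ h2.1
    · have b1 := H.bounded (if w then q.2.1 else q.2.2) p hp
      have b2 := H.bounded (if w then q.2.1 else q.2.2) p₀ H.mem_S
      exact (abs_sub _ _).trans (by linarith)
  have hsplit : ∀ r : Rec 𝒳 𝓑, recWeight π e' r * (v r.obs p - v r.obs p₀)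
      = ∑ w, if r.2.2 = w then F w (r.1, r.2.1) else 0 := by
    intro r
    rw [recWeight_eq, Finset.sum_ite_eq Finset.univ r.2.2]
    simp [hF, Rec.obs, Rec.pot]
  simp_rw [hsplit]
  rw [integral_finsetSum]
  · refine Finset.sum_congr rfl fun w _ => ?_
    rw [H.ident w (F w) (hFm w)]
    obtain ⟨hgm, hgb⟩ := H.armProb_ratio_facts hπ he'm he' w
    have e1 := H.mu_eq w p hp _ hgm ⟨_, hgb⟩
    have e2 := H.mu_eq w p₀ H.mem_S _ hgm ⟨_, hgb⟩
    simp_rw [mul_sub]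
    rw [integral_sub (H.integrable_bdd_mul_mu hgm hgb w hp)
      (H.integrable_bdd_mul_mu hgm hgb w H.mem_S), ← e1, ← e2,
      ← integral_sub (H.integrable_bdd_mul_v hgm hgb w hp)
      (H.integrable_bdd_mul_v hgm hgb w H.mem_S)]
    refine integral_congr_ae (Eventually.of_forall fun r => ?_)
    simp only [hF, Rec.pot]
    ring
  · intro w _
    refine Integrable.of_bound (C := κ⁻¹ * (2 * K)) ?_ (Eventually.of_forall fun r => ?_)
    · refine (Measurable.ite ((measurable_snd.comp measurable_snd) (measurableSet_singleton w))
        ((hFm w).comp (by fun_prop)) measurable_const).aestronglyMeasurable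
    · split_ifs
      · exact hFb _ _
      · have := H.K_nonneg; simp; positivity

/-- The bias of the inverse propensity weighted response increment. -/
lemma abs_integral_recWeight_mul_sub_le {e' : 𝒳 → ℝ} (he'm : Measurable e')
    (he' : ∀ x, e' x ∈ Set.Icc κ (1 - κ)) {ρ : ℝ} (hρ : 0 ≤ ρ)
    (hL2 : ∫ r : Rec 𝒳 𝓑, (e' r.1 - e r.1) ^ 2 ∂Q ≤ ρ ^ 2) {p : Vec J} (hp : p ∈ S) :
    |∫ r, recWeight π e' r * (v r.obs p - v r.obs p₀) ∂Q
      - (meanResp Q v π p - meanResp Q v π p₀)| ≤ 2 * κ⁻¹ * L * ρ * ‖p - p₀‖ := by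
  have hκ := H.κ_pos
  have hL := H.L_nonneg
  have hb : ∀ w x, |armProb π w x| ≤ 1 := fun w x => by
    have := armProb_mem hπ.2 w x; rw [abs_of_nonneg this.1]; exact this.2
  have hmeme : MemLp (fun r : Rec 𝒳 𝓑 => e' r.1 - e r.1) 2 Q := by
    refine MemLp.of_bound ((he'm.sub H.measurable_e).comp measurable_fst).aestronglyMeasurable 2
      (Eventually.of_forall fun r => ?_)
    rw [Real.norm_eq_abs, abs_le]
    have h1 := he' r.1; have h2 := H.overlap r.1
    constructor <;> linarith [h1.1, h1.2, h2.1, h2.2]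
  -- The increments of μ are bounded by L ‖p - p₀‖ for almost every covariate, so only the L¹ error
  -- of the propensity score matters.
  have hL1 : ∫ r : Rec 𝒳 𝓑, |e' r.1 - e r.1| ∂Q ≤ ρ := by
    have := integral_abs_mul_le (Q := Q) hmeme (g := fun _ => (1 : ℝ)) (memLp_const 1) hρ
      zero_le_one hL2 (by simp)
    simpa using this
  rw [H.integral_recWeight_mul hπ he'm he' hp, H.meanResp_eq hπ hp, H.meanResp_eq hπ H.mem_S,
    ← Finset.sum_sub_distrib, ← Finset.sum_sub_distrib]
  have hterm : ∀ w : Bool, |∫ r : Rec 𝒳 𝓑, armProb π w r.1 * ((if w then e r.1 else 1 - e r.1) /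
          (if w then e' r.1 else 1 - e' r.1)) * (μ w r.1 p - μ w r.1 p₀) ∂Q
        - (∫ r : Rec 𝒳 𝓑, armProb π w r.1 * μ w r.1 p ∂Q
          - ∫ r : Rec 𝒳 𝓑, armProb π w r.1 * μ w r.1 p₀ ∂Q)| ≤ κ⁻¹ * L * ρ * ‖p - p₀‖ := by
    intro w
    obtain ⟨hgm, hgb⟩ := H.armProb_ratio_facts hπ he'm he' w
    have i1 := H.integrable_bdd_mul_mu hgm hgb w hp
    have i2 := H.integrable_bdd_mul_mu hgm hgb w H.mem_S
    have i3 := H.integrable_bdd_mul_mu (measurable_armProb hπ.1 w) (hb w) w hp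
    have i4 := H.integrable_bdd_mul_mu (measurable_armProb hπ.1 w) (hb w) w H.mem_S
    simp_rw [mul_sub]
    rw [integral_sub i1 i2, ← integral_sub i1 i2, ← integral_sub i3 i4]
    erw [← integral_sub (i1.sub i2) (i3.sub i4)]
    rw [← Real.norm_eq_abs]
    calc _ ≤ ∫ r : Rec 𝒳 𝓑, κ⁻¹ * (L * ‖p - p₀‖) * |e' r.1 - e r.1| ∂Q := by
          refine norm_integral_le_of_norm_le ?_ ?_
          · exact ((hmeme.integrable (by norm_num)).abs).const_mul _
          · filter_upwards [H.mu_lipschitz w p hp] with r hr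
            have h1 := ratio_bound (b := e r.1) hκ (he' r.1) w
            set q := (if w then e r.1 else 1 - e r.1) / (if w then e' r.1 else 1 - e' r.1)
            simp only [Pi.sub_apply]
            rw [show armProb π w r.1 * q * μ w r.1 p - armProb π w r.1 * q * μ w r.1 p₀
              - (armProb π w r.1 * μ w r.1 p - armProb π w r.1 * μ w r.1 p₀)
              = armProb π w r.1 * ((q - 1) * (μ w r.1 p - μ w r.1 p₀)) by ring,
              Real.norm_eq_abs, abs_mul, abs_mul]
            calc _ ≤ 1 * (κ⁻¹ * |e' r.1 - e r.1| * (L * ‖p - p₀‖)) := by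
                  gcongr
                  exact hb w r.1
              _ = _ := by ring
      _ = κ⁻¹ * (L * ‖p - p₀‖) * ∫ r : Rec 𝒳 𝓑, |e' r.1 - e r.1| ∂Q := integral_const_mul _ _
      _ ≤ κ⁻¹ * (L * ‖p - p₀‖) * ρ := by gcongr
      _ = _ := by ring
  calc _ ≤ ∑ w : Bool, κ⁻¹ * L * ρ * ‖p - p₀‖ :=
        (Finset.abs_sum_le_sum_abs _ _).trans (Finset.sum_le_sum fun w _ => hterm w)
    _ = _ := by simp; ring

/-- The second moment of the inverse propensity weighted response increment. -/
lemma integral_sq_recWeight_mul_le {e' : 𝒳 → ℝ} (he' : ∀ x, e' x ∈ Set.Icc κ (1 - κ))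
    {p : Vec J} (hp : p ∈ S) :
    ∫ r, (recWeight π e' r * (v r.obs p - v r.obs p₀)) ^ 2 ∂Q
      ≤ κ⁻¹ ^ 2 * (2 * L * ‖p - p₀‖) := by
  have hint : ∀ w, Integrable
      (fun r : Rec 𝒳 𝓑 => (v (r.pot w) p - v (r.pot w) p₀) ^ 2) Q := by
    intro w
    have hm : Measurable fun r : Rec 𝒳 𝓑 => v (r.pot w) p - v (r.pot w) p₀ :=
      ((H.measurable_v_at p).comp (measurable_pot w)).sub
        ((H.measurable_v_at p₀).comp (measurable_pot w))
    refine Integrable.of_bound (C := (2 * K) ^ 2) (hm.pow_const 2).aestronglyMeasurable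
      (Eventually.of_forall fun r => ?_)
    rw [Real.norm_eq_abs, abs_pow]
    gcongr
    have b1 := H.bounded (r.pot w) p hp
    have b2 := H.bounded (r.pot w) p₀ H.mem_S
    exact (abs_sub _ _).trans (by linarith)
  calc _ ≤ ∫ r : Rec 𝒳 𝓑, κ⁻¹ ^ 2 * ∑ w, (v (r.pot w) p - v (r.pot w) p₀) ^ 2 ∂Q := by
        refine integral_mono_of_nonneg (Eventually.of_forall fun r => sq_nonneg _)
          ((integrable_finsetSum _ fun w _ => hint w).const_mul _)
          (Eventually.of_forall fun r => ?_)
        have h1 := recWeight_mem hπ.2 H.κ_pos he' r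
        simp only [mul_pow]
        refine mul_le_mul (pow_le_pow_left₀ h1.1 h1.2 2) ?_ (sq_nonneg _) (sq_nonneg _)
        -- The observed increment is one of the two potential increments.
        exact Finset.single_le_sum (f := fun w => (v (r.pot w) p - v (r.pot w) p₀) ^ 2)
          (fun w _ => sq_nonneg _) (Finset.mem_univ r.2.2)
    _ = κ⁻¹ ^ 2 * ∑ w : Bool, ∫ r : Rec 𝒳 𝓑, (v (r.pot w) p - v (r.pot w) p₀) ^ 2 ∂Q := by
        rw [integral_const_mul, integral_finsetSum _ fun w _ => hint w]
    _ ≤ κ⁻¹ ^ 2 * ∑ w : Bool, L * ‖p - p₀‖ := by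
        gcongr with w
        exact H.l2_continuous w p hp
    _ = _ := by rw [Fintype.sum_bool]; ring

end RegularResponse

lemma measurable_recScore {𝒳 𝓑 α : Type*} [MeasurableSpace 𝒳] [MeasurableSpace 𝓑]
    [MeasurableSpace α] {π : 𝒳 → ℝ} (hπ : Measurable π) {e : α → 𝒳 → ℝ} {μ : α → Bool → 𝒳 → ℝ}
    {val : α → ℝ} {r : α → Rec 𝒳 𝓑} (he : Measurable fun a => e a (r a).1)
    (hμ : ∀ w, Measurable fun a => μ a w (r a).1) (hval : Measurable val) (hr : Measurable r) :
    Measurable fun a => recScore π (e a) (μ a) (val a) (r a) := by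
  unfold recScore
  refine Finset.measurable_sum _ fun w _ => ?_
  exact ((measurable_armProb hπ w).comp (measurable_fst.comp hr)).mul
    (measurable_drScore w ((measurable_snd.comp measurable_snd).comp hr) he (hμ w) hval)

namespace RegularResponse

variable {𝒳 𝓑 : Type*} [MeasurableSpace 𝒳] [MeasurableSpace 𝓑] {J : ℕ}
  {Q : Measure (Rec 𝒳 𝓑)} {S : Set (Vec J)} {p₀ : Vec J} {e : 𝒳 → ℝ}
  {v : 𝓑 → Vec J → ℝ} {μ : Bool → 𝒳 → Vec J → ℝ} {κ K L C h : ℝ}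
  (H : RegularResponse Q S p₀ e v μ κ K L C h) {π : 𝒳 → ℝ} (hπ : IsRule π)

include H

/-- Inverse propensity weighting with an estimated propensity score. -/
lemma integral_ipw_mul (hπ : IsRule π) {e' : 𝒳 → ℝ} (he'm : Measurable e') (w : Bool)
    {φ : 𝒳 × (𝓑 × 𝓑) → ℝ} (hφ : Measurable φ) :
    ∫ r : Rec 𝒳 𝓑, armProb π w r.1 * ipw w r.2.2 (e' r.1) * φ (r.1, r.2.1) ∂Q
      = ∫ r : Rec 𝒳 𝓑, armProb π w r.1 * ((if w then e r.1 else 1 - e r.1) /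
          (if w then e' r.1 else 1 - e' r.1)) * φ (r.1, r.2.1) ∂Q := by
  have hif : Measurable fun x => if w then e' x else 1 - e' x := by
    cases w <;> simp <;> fun_prop
  have hF : Measurable fun q : 𝒳 × (𝓑 × 𝓑) =>
      armProb π w q.1 / (if w then e' q.1 else 1 - e' q.1) * φ q :=
    (((measurable_armProb hπ.1 w).comp measurable_fst).div (hif.comp measurable_fst)).mul hφ
  have := H.ident w _ hF
  calc _ = _ := integral_congr_ae (Eventually.of_forall fun r => ?_)
    _ = _ := this
    _ = _ := integral_congr_ae (Eventually.of_forall fun r => ?_)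
  · simp only [ipw]
    by_cases hW : r.2.2 = w
    · simp only [if_pos hW]; ring
    · simp only [if_neg hW]; ring
  · simp only; ring

include hπ

lemma integrable_armProb_ipw_mul {e' : 𝒳 → ℝ} (he'm : Measurable e')
    (he' : ∀ x, e' x ∈ Set.Icc κ (1 - κ)) (w : Bool) {f : Rec 𝒳 𝓑 → ℝ} (hf : Integrable f Q) :
    Integrable (fun r => armProb π w r.1 * ipw w r.2.2 (e' r.1) * f r) Q := by
  refine hf.bdd_mul (c := 1 * κ⁻¹) ?_ (Eventually.of_forall fun r => ?_)
  · exact (((measurable_armProb hπ.1 w).comp measurable_fst).mul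
      (measurable_ipw w (measurable_snd.comp measurable_snd)
        (he'm.comp measurable_fst))).aestronglyMeasurable
  · have h1 := armProb_mem hπ.2 w r.1
    rw [Real.norm_eq_abs, abs_mul, abs_of_nonneg h1.1]
    exact mul_le_mul h1.2 (abs_ipw_le H.κ_pos (he' _) _ _) (abs_nonneg _) zero_le_one

variable [IsProbabilityMeasure Q]

/-- The residual has mean zero given the covariates, and the treatment is independent of it given
the covariates. This works for any bounded-away propensity score e', so estimating the propensity
score alone creates no bias when the regression is exact. -/
lemma integral_ipw_residual {e' : 𝒳 → ℝ} (he'm : Measurable e')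
    (he' : ∀ x, e' x ∈ Set.Icc κ (1 - κ)) (w : Bool) :
    ∫ r : Rec 𝒳 𝓑, armProb π w r.1 * ipw w r.2.2 (e' r.1)
      * (v (r.pot w) p₀ - μ w r.1 p₀) ∂Q = 0 := by
  have hφ : Measurable fun q : 𝒳 × (𝓑 × 𝓑) =>
      v (if w then q.2.1 else q.2.2) p₀ - μ w q.1 p₀ := by
    have hb : Measurable fun q : 𝒳 × (𝓑 × 𝓑) => if w then q.2.1 else q.2.2 := by
      cases w <;> simp <;> fun_prop
    exact ((H.measurable_v_at p₀).comp hb).sub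
      ((H.measurable_mu w p₀ H.mem_S).comp measurable_fst)
  obtain ⟨hgm, hgb⟩ := H.armProb_ratio_facts hπ he'm he' w
  have h1 := H.integral_ipw_mul hπ he'm w hφ
  refine Eq.trans h1 ?_
  change ∫ r : Rec 𝒳 𝓑, armProb π w r.1 * ((if w then e r.1 else 1 - e r.1) /
    (if w then e' r.1 else 1 - e' r.1)) * (v (r.pot w) p₀ - μ w r.1 p₀) ∂Q = 0
  simp_rw [mul_sub]
  rw [integral_sub (H.integrable_bdd_mul_v hgm hgb w H.mem_S)
    (H.integrable_bdd_mul_mu hgm hgb w H.mem_S), sub_eq_zero]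
  exact H.mu_eq w p₀ H.mem_S _ hgm ⟨_, hgb⟩

omit hπ in
lemma integrable_residual (w : Bool) :
    Integrable (fun r : Rec 𝒳 𝓑 => v (r.pot w) p₀ - μ w r.1 p₀) Q := by
  have h1 := H.integrable_bdd_mul_v (g := fun _ => 1) measurable_const (c := 1) (by simp) w H.mem_S
  have h2 := H.integrable_bdd_mul_mu (g := fun _ => 1) measurable_const (c := 1) (by simp) w
    H.mem_S
  simp only [one_mul] at h1 h2
  exact h1.sub h2

omit H [MeasurableSpace 𝒳] [MeasurableSpace 𝓑] hπ [IsProbabilityMeasure Q] in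
lemma ipw_mul_obs (w : Bool) (a : ℝ) (p : Vec J) (r : Rec 𝒳 𝓑) :
    ipw w r.2.2 a * v r.obs p = ipw w r.2.2 a * v (r.pot w) p := by
  unfold ipw Rec.obs
  by_cases hW : r.2.2 = w
  · rw [hW]
  · simp [hW]

/-- The doubly-robust score with the true nuisance functions is unbiased. -/
lemma integral_recScore :
    ∫ r, recScore π e (fun w x => μ w x p₀) (v r.obs p₀) r ∂Q = meanResp Q v π p₀ := by
  have hb : ∀ w x, |armProb π w x| ≤ 1 := fun w x => by
    have := armProb_mem hπ.2 w x; rw [abs_of_nonneg this.1]; exact this.2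
  have hpt : ∀ r : Rec 𝒳 𝓑, recScore π e (fun w x => μ w x p₀) (v r.obs p₀) r
      = ∑ w, (armProb π w r.1 * μ w r.1 p₀
        + armProb π w r.1 * ipw w r.2.2 (e r.1) * (v (r.pot w) p₀ - μ w r.1 p₀)) := by
    intro r
    refine Finset.sum_congr rfl fun w _ => ?_
    have := ipw_mul_obs (v := v) w (e r.1) p₀ r
    simp only [drScore, smul_eq_mul]
    linear_combination armProb π w r.1 * this
  simp_rw [hpt]
  have i1 := fun w => H.integrable_bdd_mul_mu (measurable_armProb hπ.1 w) (hb w) w H.mem_S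
  have i2 := fun w => H.integrable_armProb_ipw_mul hπ H.measurable_e H.overlap w
    (H.integrable_residual w)
  have i3 : ∀ w, Integrable (fun r : Rec 𝒳 𝓑 => armProb π w r.1 * μ w r.1 p₀
      + armProb π w r.1 * ipw w r.2.2 (e r.1) * (v (r.pot w) p₀ - μ w r.1 p₀)) Q :=
    fun w => (i1 w).add (i2 w)
  rw [integral_finsetSum _ fun w _ => i3 w, H.meanResp_eq hπ H.mem_S]
  refine Finset.sum_congr rfl fun w _ => ?_
  rw [integral_add (i1 w) (i2 w), H.integral_ipw_residual hπ H.measurable_e H.overlap w, add_zero]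

omit [IsProbabilityMeasure Q] in
/-- The doubly-robust score with the true nuisance functions is almost surely bounded. -/
lemma ae_abs_recScore_le :
    ∀ᵐ r ∂Q, |recScore π e (fun w x => μ w x p₀) (v r.obs p₀) r| ≤ 2 * (K + κ⁻¹ * (2 * K)) := by
  have hκ := H.κ_pos
  filter_upwards [ae_all_iff.mpr fun w => H.mu_bounded w p₀ H.mem_S] with r hr
  unfold recScore
  calc _ ≤ ∑ w : Bool, (K + κ⁻¹ * (2 * K)) := by
        refine (Finset.abs_sum_le_sum_abs _ _).trans (Finset.sum_le_sum fun w _ => ?_)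
        have h1 := armProb_mem hπ.2 w r.1
        rw [abs_mul, abs_of_nonneg h1.1]
        calc _ ≤ 1 * |drScore w r.2.2 (e r.1) (μ w r.1 p₀) (v r.obs p₀)| := by
              gcongr; exact h1.2
          _ ≤ |μ w r.1 p₀| + |ipw w r.2.2 (e r.1)| * |v r.obs p₀ - μ w r.1 p₀| := by
              rw [one_mul, ← abs_mul]; exact abs_add_le _ _
          _ ≤ _ := by
              have h2 := H.bounded r.obs p₀ H.mem_S
              have h3 : |v r.obs p₀ - μ w r.1 p₀| ≤ 2 * K :=
                (abs_sub _ _).trans (by linarith [hr w])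
              gcongr
              · exact hr w
              · exact abs_ipw_le hκ (H.overlap _) _ _
    _ = _ := by rw [Fintype.sum_bool]; ring

omit [IsProbabilityMeasure Q] in
lemma measurable_trueScore :
    Measurable fun r => recScore π e (fun w x => μ w x p₀) (v r.obs p₀) r :=
  measurable_recScore hπ.1 (H.measurable_e.comp measurable_fst)
    (fun w => (H.measurable_mu w p₀ H.mem_S).comp measurable_fst)
    ((H.measurable_v_at p₀).comp measurable_obs) measurable_id

lemma memLp_trueScore :
    MemLp (fun r => recScore π e (fun w x => μ w x p₀) (v r.obs p₀) r) 2 Q :=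
  MemLp.of_bound (H.measurable_trueScore hπ).aestronglyMeasurable _ (H.ae_abs_recScore_le hπ)

/-- The error of the doubly-robust score with estimated nuisance functions has a small mean (a
product of the two estimation errors) and a small second moment. -/
lemma recScore_error {e' : 𝒳 → ℝ} (he'm : Measurable e')
    (he' : ∀ x, e' x ∈ Set.Icc κ (1 - κ)) {ρ ρ' : ℝ} (hρ : 0 ≤ ρ) (hρ' : 0 ≤ ρ')
    (hL2 : ∫ r : Rec 𝒳 𝓑, (e' r.1 - e r.1) ^ 2 ∂Q ≤ ρ ^ 2) {m : Bool → 𝒳 → ℝ}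
    (hm : ∀ w, Measurable (m w))
    (hmL : ∀ w, MemLp (fun r : Rec 𝒳 𝓑 => m w r.1 - μ w r.1 p₀) 2 Q)
    (hmρ : ∀ w, ∫ r : Rec 𝒳 𝓑, (m w r.1 - μ w r.1 p₀) ^ 2 ∂Q ≤ ρ' ^ 2) :
    MemLp (fun r => recScore π e' m (v r.obs p₀) r
      - recScore π e (fun w x => μ w x p₀) (v r.obs p₀) r) 2 Q ∧
    |∫ r, (recScore π e' m (v r.obs p₀) r
      - recScore π e (fun w x => μ w x p₀) (v r.obs p₀) r) ∂Q| ≤ 2 * κ⁻¹ * (ρ * ρ') ∧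
    ∫ r, (recScore π e' m (v r.obs p₀) r
      - recScore π e (fun w x => μ w x p₀) (v r.obs p₀) r) ^ 2 ∂Q
      ≤ 8 * (1 + κ⁻¹) ^ 2 * ρ' ^ 2 + 8 * (2 * K / κ ^ 2) ^ 2 * ρ ^ 2 := by
  have hκ := H.κ_pos
  have hK := H.K_nonneg
  have hb : ∀ w x, |armProb π w x| ≤ 1 := fun w x => by
    have := armProb_mem hπ.2 w x; rw [abs_of_nonneg this.1]; exact this.2
  have hmeme : MemLp (fun r : Rec 𝒳 𝓑 => e' r.1 - e r.1) 2 Q := by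
    refine MemLp.of_bound ((he'm.sub H.measurable_e).comp measurable_fst).aestronglyMeasurable 2
      (Eventually.of_forall fun r => ?_)
    rw [Real.norm_eq_abs, abs_le]
    have h1 := he' r.1; have h2 := H.overlap r.1
    constructor <;> linarith [h1.1, h1.2, h2.1, h2.2]
  set D : Rec 𝒳 𝓑 → ℝ := fun r => recScore π e' m (v r.obs p₀) r
      - recScore π e (fun w x => μ w x p₀) (v r.obs p₀) r with hD
  have hDm : Measurable D :=
    (measurable_recScore hπ.1 (he'm.comp measurable_fst) (fun w => (hm w).comp measurable_fst)
      ((H.measurable_v_at p₀).comp measurable_obs) measurable_id).sub (H.measurable_trueScore hπ)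
  -- The square of a four-term sum is at most 4 times the sum of squares; the regression error
  -- occurs once per arm, the propensity error twice with the same value, hence the constants 4 and
  -- 8.
  set G : Rec 𝒳 𝓑 → ℝ := fun r => ∑ w : Bool, 4 * (1 + κ⁻¹) ^ 2 * (m w r.1 - μ w r.1 p₀) ^ 2
    + 8 * (2 * K / κ ^ 2) ^ 2 * (e' r.1 - e r.1) ^ 2 with hG
  have hGint1 : Integrable
      (fun r : Rec 𝒳 𝓑 => ∑ w : Bool, 4 * (1 + κ⁻¹) ^ 2 * (m w r.1 - μ w r.1 p₀) ^ 2) Q :=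
    integrable_finsetSum _ fun w _ => (hmL w).integrable_sq.const_mul _
  have hGint2 : Integrable
      (fun r : Rec 𝒳 𝓑 => 8 * (2 * K / κ ^ 2) ^ 2 * (e' r.1 - e r.1) ^ 2) Q :=
    hmeme.integrable_sq.const_mul _
  have hGint : Integrable G Q := hGint1.add hGint2
  have hDG : ∀ᵐ r ∂Q, D r ^ 2 ≤ G r := by
    filter_upwards [ae_all_iff.mpr fun w => H.mu_bounded w p₀ H.mem_S] with r hr
    have h1 := abs_recScore_sub_le (π := π) (e := e') (e' := e) (K := K) hπ.2 hκ (μ := m)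
      (μ' := fun w x => μ w x p₀) (val := v r.obs p₀) (he' r.1) (H.overlap r.1) hr
      (H.bounded _ _ H.mem_S)
    rw [Fintype.sum_bool] at h1
    have h2 : D r ^ 2 ≤ ((1 + κ⁻¹) * |m true r.1 - μ true r.1 p₀|
        + 2 * K / κ ^ 2 * |e' r.1 - e r.1| + ((1 + κ⁻¹) * |m false r.1 - μ false r.1 p₀|
        + 2 * K / κ ^ 2 * |e' r.1 - e r.1|)) ^ 2 := by
      rw [← sq_abs]; gcongr
    refine h2.trans ?_
    simp only [hG, Fintype.sum_bool]
    rw [← sq_abs (m true r.1 - μ true r.1 p₀), ← sq_abs (m false r.1 - μ false r.1 p₀),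
      ← sq_abs (e' r.1 - e r.1)]
    set a := (1 + κ⁻¹)
    set b := 2 * K / κ ^ 2
    set x := |m true r.1 - μ true r.1 p₀|
    set y := |m false r.1 - μ false r.1 p₀|
    set z := |e' r.1 - e r.1|
    nlinarith [sq_nonneg (a * x - a * y), sq_nonneg (a * x - b * z), sq_nonneg (a * y - b * z)]
  refine ⟨?_, ?_, ?_⟩
  · rw [memLp_two_iff_integrable_sq hDm.aestronglyMeasurable]
    refine hGint.mono' (hDm.pow_const 2).aestronglyMeasurable ?_
    filter_upwards [hDG] with r hr
    rwa [Real.norm_eq_abs, abs_of_nonneg (sq_nonneg _)]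
  -- The last two terms are weighted residuals, whose means vanish for either propensity score. What
  -- remains has mean (1 - e/e')(m - μ) given the covariates, a product of the two estimation
  -- errors.
  · have hpt : ∀ r : Rec 𝒳 𝓑, D r = ∑ w, ((armProb π w r.1 * (m w r.1 - μ w r.1 p₀)
        - armProb π w r.1 * ipw w r.2.2 (e' r.1) * (m w r.1 - μ w r.1 p₀))
        + (armProb π w r.1 * ipw w r.2.2 (e' r.1) * (v (r.pot w) p₀ - μ w r.1 p₀)
        - armProb π w r.1 * ipw w r.2.2 (e r.1) * (v (r.pot w) p₀ - μ w r.1 p₀))) := by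
      intro r
      simp only [hD, recScore]
      rw [← Finset.sum_sub_distrib]
      refine Finset.sum_congr rfl fun w _ => ?_
      have h1 := ipw_mul_obs (v := v) w (e r.1) p₀ r
      have h2 := ipw_mul_obs (v := v) w (e' r.1) p₀ r
      simp only [drScore, smul_eq_mul]
      linear_combination armProb π w r.1 * h2 - armProb π w r.1 * h1
    have j0 := fun w => (hmL w).integrable (q := 2) (by norm_num)
    have j1 : ∀ w, Integrable (fun r : Rec 𝒳 𝓑 => armProb π w r.1 * (m w r.1 - μ w r.1 p₀)) Q :=
      fun w => (j0 w).bdd_mul (c := 1)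
        ((measurable_armProb hπ.1 w).comp measurable_fst).aestronglyMeasurable
        (Eventually.of_forall fun r => hb w r.1)
    have j2 := fun w => H.integrable_armProb_ipw_mul hπ he'm he' w (j0 w)
    have j3 := fun w => H.integrable_armProb_ipw_mul hπ he'm he' w (H.integrable_residual w)
    have j4 := fun w => H.integrable_armProb_ipw_mul hπ H.measurable_e H.overlap w
      (H.integrable_residual w)
    have hint : ∫ r, D r ∂Q = ∑ w, ∫ r : Rec 𝒳 𝓑, (armProb π w r.1 * (m w r.1 - μ w r.1 p₀)
        - armProb π w r.1 * ((if w then e r.1 else 1 - e r.1) /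
          (if w then e' r.1 else 1 - e' r.1)) * (m w r.1 - μ w r.1 p₀)) ∂Q := by
      simp_rw [hpt]
      have j5 : ∀ w, Integrable (fun r : Rec 𝒳 𝓑 => (armProb π w r.1 * (m w r.1 - μ w r.1 p₀)
          - armProb π w r.1 * ipw w r.2.2 (e' r.1) * (m w r.1 - μ w r.1 p₀))
          + (armProb π w r.1 * ipw w r.2.2 (e' r.1) * (v (r.pot w) p₀ - μ w r.1 p₀)
          - armProb π w r.1 * ipw w r.2.2 (e r.1) * (v (r.pot w) p₀ - μ w r.1 p₀))) Q :=
        fun w => ((j1 w).sub (j2 w)).add ((j3 w).sub (j4 w))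
      rw [integral_finsetSum _ fun w _ => j5 w]
      refine Finset.sum_congr rfl fun w _ => ?_
      have hφ : Measurable fun q : 𝒳 × (𝓑 × 𝓑) => m w q.1 - μ w q.1 p₀ :=
        ((hm w).sub (H.measurable_mu w p₀ H.mem_S)).comp measurable_fst
      have k2 : Integrable (fun r : Rec 𝒳 𝓑 => armProb π w r.1 *
          ((if w then e r.1 else 1 - e r.1) / (if w then e' r.1 else 1 - e' r.1))
          * (m w r.1 - μ w r.1 p₀)) Q := by
        obtain ⟨hgm, hgb⟩ := H.armProb_ratio_facts hπ he'm he' w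
        exact (j0 w).bdd_mul (c := κ⁻¹) (hgm.comp measurable_fst).aestronglyMeasurable
          (Eventually.of_forall fun r => hgb r.1)
      have hadd := integral_add ((j1 w).sub (j2 w)) ((j3 w).sub (j4 w))
      simp only [Pi.sub_apply] at hadd
      rw [hadd, integral_sub (j1 w) (j2 w), integral_sub (j3 w) (j4 w),
        H.integral_ipw_residual hπ he'm he' w,
        H.integral_ipw_residual hπ H.measurable_e H.overlap w, integral_sub (j1 w) k2,
        H.integral_ipw_mul hπ he'm w hφ]
      ring
    rw [hint]
    calc _ ≤ ∑ w : Bool, κ⁻¹ * (ρ * ρ') := by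
          refine (Finset.abs_sum_le_sum_abs _ _).trans (Finset.sum_le_sum fun w _ => ?_)
          rw [← Real.norm_eq_abs]
          calc _ ≤ ∫ r : Rec 𝒳 𝓑, κ⁻¹ * (|e' r.1 - e r.1| * |m w r.1 - μ w r.1 p₀|) ∂Q := by
                refine norm_integral_le_of_norm_le ?_ (Eventually.of_forall fun r => ?_)
                · exact ((hmeme.norm.integrable_mul (hmL w).norm)).const_mul _
                · have h1 := ratio_bound (b := e r.1) hκ (he' r.1) w
                  set q := (if w then e r.1 else 1 - e r.1) / (if w then e' r.1 else 1 - e' r.1)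
                  rw [show armProb π w r.1 * (m w r.1 - μ w r.1 p₀)
                    - armProb π w r.1 * q * (m w r.1 - μ w r.1 p₀)
                    = -(armProb π w r.1 * ((q - 1) * (m w r.1 - μ w r.1 p₀))) by ring,
                    norm_neg, Real.norm_eq_abs, abs_mul, abs_mul]
                  calc _ ≤ 1 * (κ⁻¹ * |e' r.1 - e r.1| * |m w r.1 - μ w r.1 p₀|) := by
                        gcongr
                        exact hb w r.1
                    _ = _ := by ring
            _ = κ⁻¹ * ∫ r : Rec 𝒳 𝓑, |e' r.1 - e r.1| * |m w r.1 - μ w r.1 p₀| ∂Q :=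
                integral_const_mul _ _
            _ ≤ _ := by
                gcongr
                exact integral_abs_mul_le hmeme (hmL w) hρ hρ' hL2 (hmρ w)
      _ = _ := by rw [Fintype.sum_bool]; ring
  · calc ∫ r, D r ^ 2 ∂Q ≤ ∫ r, G r ∂Q :=
          integral_mono_of_nonneg (Eventually.of_forall fun r => sq_nonneg _) hGint hDG
      _ = ∑ w : Bool, 4 * (1 + κ⁻¹) ^ 2 * ∫ r : Rec 𝒳 𝓑, (m w r.1 - μ w r.1 p₀) ^ 2 ∂Q
          + 8 * (2 * K / κ ^ 2) ^ 2 * ∫ r : Rec 𝒳 𝓑, (e' r.1 - e r.1) ^ 2 ∂Q := by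
          simp only [hG]
          rw [integral_add hGint1 hGint2,
            integral_finsetSum _ fun w _ => (hmL w).integrable_sq.const_mul _, integral_const_mul]
          simp_rw [integral_const_mul]
      _ ≤ ∑ w : Bool, 4 * (1 + κ⁻¹) ^ 2 * ρ' ^ 2 + 8 * (2 * K / κ ^ 2) ^ 2 * ρ ^ 2 := by
          gcongr with w
          exact hmρ w
      _ = _ := by rw [Fintype.sum_bool]; ring

end RegularResponse

/-! ### Deviation bounds at data-dependent cutoffs -/

lemma measurable_recWeight {𝒳 𝓑 α : Type*} [MeasurableSpace 𝒳] [MeasurableSpace 𝓑]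
    [MeasurableSpace α] {π : 𝒳 → ℝ} (hπ : Measurable π) {e : α → 𝒳 → ℝ} {r : α → Rec 𝒳 𝓑}
    (he : Measurable fun a => e a (r a).1) (hr : Measurable r) :
    Measurable fun a => recWeight π (e a) (r a) := by
  unfold recWeight
  refine Finset.measurable_sum _ fun w _ => ?_
  exact ((measurable_armProb hπ w).comp (measurable_fst.comp hr)).mul
    (measurable_ipw w ((measurable_snd.comp measurable_snd).comp hr) he)

lemma prod_apply_le_of_section_le {α β : Type*} [MeasurableSpace α] [MeasurableSpace β]
    {ζ : Measure α} [IsProbabilityMeasure ζ] {ν : Measure β} [SFinite ν] {E : Set (α × β)}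
    (hE : MeasurableSet E) {b : ℝ≥0∞} (h : ∀ z, ν (Prod.mk z ⁻¹' E) ≤ b) : ζ.prod ν E ≤ b := by
  rw [Measure.prod_apply hE]
  exact (lintegral_mono h).trans (by simp)

/-- The shape of the union bounds below: the net has polynomial size, and the sign inequality
supplies a stretched exponential. -/
lemma tendsto_polynomial_mul_exp_neg {C h a c : ℝ} (hC : 0 ≤ C) (hh : 0 ≤ h) (ha : 0 < a)
    (hc : 0 < c) :
    Tendsto (fun n : ℕ => 4 * (1 + C * ((n : ℝ) + 2) ^ h) * Real.exp (-(c * (n : ℝ) ^ a)))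
      atTop (𝓝 0) := by
  have hx : Tendsto (fun n : ℕ => (n : ℝ) ^ a) atTop atTop :=
    (tendsto_rpow_atTop ha).comp tendsto_natCast_atTop_atTop
  have h1 := (tendsto_rpow_mul_exp_neg_mul_atTop_nhds_zero 0 c hc).comp hx
  have h2 := (tendsto_rpow_mul_exp_neg_mul_atTop_nhds_zero (h / a) c hc).comp hx
  have h3 := (h1.const_mul 4).add (h2.const_mul (4 * C * 3 ^ h))
  simp only [mul_zero, add_zero] at h3
  refine squeeze_zero' (Eventually.of_forall fun n => by positivity) ?_ h3
  filter_upwards [eventually_ge_atTop 1] with n hn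
  have hn' : (1 : ℝ) ≤ n := by exact_mod_cast hn
  simp only [Function.comp_apply, Real.rpow_zero, one_mul]
  rw [← Real.rpow_mul (by positivity), mul_div_cancel₀ _ ha.ne', neg_mul]
  have h4 : ((n : ℝ) + 2) ^ h ≤ 3 ^ h * (n : ℝ) ^ h := by
    rw [← Real.mul_rpow (by norm_num) (by positivity)]
    gcongr; linarith
  calc _ ≤ 4 * (1 + C * (3 ^ h * (n : ℝ) ^ h)) * Real.exp (-(c * (n : ℝ) ^ a)) := by gcongr
    _ = _ := by ring

namespace RegularResponse

variable {𝒳 𝓑 : Type*} [MeasurableSpace 𝒳] [MeasurableSpace 𝓑] {J : ℕ}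
  {Q : Measure (Rec 𝒳 𝓑)} {S : Set (Vec J)} {p₀ : Vec J} {e : 𝒳 → ℝ}
  {v : 𝓑 → Vec J → ℝ} {μ : Bool → 𝒳 → Vec J → ℝ} {κ K L C h : ℝ}
  (H : RegularResponse Q S p₀ e v μ κ K L C h)

include H

/-- Functions that are Lipschitz in the response inherit its nets. Over the 2n points of sample and
ghost sample, radius 1/(n + 2) makes the summed distance of responses at most 4, so the functions
differ by at most 4D ≤ t/4. The 2 keeps the radius below 1 for every n. -/
lemma exists_net {n : ℕ} (I : Finset (Fin n)) {f : Vec J → Rec 𝒳 𝓑 → ℝ} {D t : ℝ}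
    (hD : 0 ≤ D) (hDt : 16 * D ≤ t) {A : Set (Vec J)} (hA : A ⊆ S)
    (hf : ∀ r, ∀ θ ∈ A, ∀ θ' ∈ A, |f θ r - f θ' r| ≤ D * |v r.obs θ - v r.obs θ'|)
    (x x' : Fin n → Rec 𝒳 𝓑) :
    ∃ F : Finset (Vec J), ↑F ⊆ A ∧ (F.card : ℝ) ≤ 1 + C * ((n : ℝ) + 2) ^ h ∧
      ∀ θ ∈ A, ∃ θ' ∈ F, ∑ i ∈ I, (|f θ (x i) - f θ' (x i)|
        + |f θ (x' i) - f θ' (x' i)|) ≤ t / 4 := by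
  have hn : (0 : ℝ) ≤ n := Nat.cast_nonneg n
  obtain ⟨F, hFA, hFc, hF⟩ := exists_net_of_polynomialCovering H.C_nonneg H.covering
    (Sum.elim (fun i => (x i).obs) fun i => (x' i).obs) (ε := 1 / ((n : ℝ) + 2)) (by positivity)
    (by rw [div_lt_one (by positivity)]; linarith) hA
  rw [one_div_one_div] at hFc
  refine ⟨F, hFA, hFc, fun θ hθ => ?_⟩
  obtain ⟨θ', hθ', hsum⟩ := hF θ hθ
  refine ⟨θ', hθ', ?_⟩
  simp only [Fintype.sum_sum_type, Sum.elim_inl, Sum.elim_inr, Fintype.card_sum,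
    Fintype.card_fin] at hsum
  calc _ ≤ ∑ i ∈ I, D * (|v (x i).obs θ - v (x i).obs θ'|
        + |v (x' i).obs θ - v (x' i).obs θ'|) := by
        refine Finset.sum_le_sum fun i _ => ?_
        rw [mul_add]
        exact add_le_add (hf _ θ hθ θ' (hFA hθ')) (hf _ θ hθ θ' (hFA hθ'))
    _ ≤ ∑ i, D * (|v (x i).obs θ - v (x i).obs θ'| + |v (x' i).obs θ - v (x' i).obs θ'|) :=
        Finset.sum_le_sum_of_subset_of_nonneg (Finset.subset_univ _) fun i _ _ => by positivity
    _ = D * (∑ i, |v (x i).obs θ - v (x i).obs θ'| + ∑ i, |v (x' i).obs θ - v (x' i).obs θ'|) := by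
        rw [← Finset.mul_sum, Finset.sum_add_distrib]
    _ ≤ D * (((n + n : ℕ) : ℝ) * (2 * (1 / ((n : ℝ) + 2)))) := by gcongr
    _ ≤ D * 4 := by
        gcongr
        push_cast
        rw [← mul_assoc, mul_one_div, div_le_iff₀ (by positivity)]
        linarith
    _ ≤ t / 4 := by linarith

variable [IsProbabilityMeasure Q]

/-- Uniform deviation bound for bounded functions that are Lipschitz in the response, at a
data-dependent parameter. -/
lemma pi_deviation_le {n : ℕ} (hn : 0 < n) (I : Finset (Fin n))
    {f : (Fin n → Rec 𝒳 𝓑) → Vec J → Rec 𝒳 𝓑 → ℝ}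
    (hfm : Measurable fun q : (Fin n → Rec 𝒳 𝓑) × Vec J × Rec 𝒳 𝓑 => f q.1 q.2.1 q.2.2)
    (hI : IndepOfCoords I f) {p : (Fin n → Rec 𝒳 𝓑) → Vec J} (hp : Measurable p)
    {A : Set (Vec J)} (hAm : MeasurableSet A) (hA : A ⊆ S) {M D t : ℝ} (hM : 0 < M) (hD : 0 ≤ D)
    (hfM : ∀ u, ∀ θ ∈ A, ∀ r, |f u θ r| ≤ M)
    (hf : ∀ u r, ∀ θ ∈ A, ∀ θ' ∈ A, |f u θ r - f u θ' r| ≤ D * |v r.obs θ - v r.obs θ'|)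
    (ht : 0 < t) (hDt : 16 * D ≤ t) (hMt : 16 * (n * M ^ 2) ≤ t ^ 2) :
    (Measure.pi fun _ : Fin n => Q) {u | p u ∈ A ∧
        t < |∑ i ∈ I, (f u (p u) (u i) - ∫ r, f u (p u) r ∂Q)|}
      ≤ ENNReal.ofReal (4 * (1 + C * ((n : ℝ) + 2) ^ h)
          * Real.exp (-(t ^ 2 / (512 * (n * M ^ 2))))) := by
  have hn' : (0 : ℝ) < n := by exact_mod_cast hn
  have hIn : (I.card : ℝ) ≤ n := by exact_mod_cast (card_finset_fin_le I)
  have hC := H.C_nonneg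
  have hsq : ∀ u, ∀ θ ∈ A, ∀ r, f u θ r ^ 2 ≤ M ^ 2 := fun u θ hθ r => by
    rw [← sq_abs]; gcongr; exact hfM u θ hθ r
  have hmeas : ∀ u θ, Measurable (f u θ) := fun u θ =>
    hfm.comp (measurable_const.prodMk (measurable_const.prodMk measurable_id))
  -- Functions bounded by M have empirical second moment at most n M² ≤ V, so the restriction on it
  -- is void; the factor 4 meets the Markov condition.
  have key := pi_symmetrization Q I hfm hI hp hAm (V := 4 * (n * M ^ 2)) (t := t)
    (m := 1 + C * ((n : ℝ) + 2) ^ h) (s2 := M ^ 2) (by positivity) ht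
    (fun u θ hθ => MemLp.of_bound (hmeas u θ).aestronglyMeasurable M
      (Eventually.of_forall fun r => hfM u θ hθ r))
    (fun u θ hθ => by
      calc _ ≤ ∫ _, M ^ 2 ∂Q := integral_mono_of_nonneg (Eventually.of_forall fun r => sq_nonneg _)
            (integrable_const _) (Eventually.of_forall fun r => hsq u θ hθ r)
        _ = _ := by simp)
    (by
      rw [div_le_iff₀ (by positivity)]
      have : (I.card : ℝ) * M ^ 2 ≤ n * M ^ 2 := by gcongr
      nlinarith)
    (by
      rw [div_le_iff₀ (by positivity)]
      have : (I.card : ℝ) * M ^ 2 ≤ n * M ^ 2 := by gcongr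
      linarith)
    (fun u x x' A' hA' => H.exists_net I hD hDt (hA'.trans hA)
      (fun r θ hθ θ' hθ' => hf u r θ (hA' hθ) θ' (hA' hθ')) x x')
  refine (measure_mono ?_).trans (key.trans (le_of_eq ?_))
  · rintro u ⟨h1, h2⟩
    refine ⟨h1, ?_, h2⟩
    calc _ ≤ ∑ i ∈ I, M ^ 2 := Finset.sum_le_sum fun i _ => hsq u _ h1 _
      _ = I.card * M ^ 2 := by simp
      _ ≤ n * M ^ 2 := by gcongr
      _ ≤ _ := by nlinarith [mul_pos hn' (pow_pos hM 2)]
  · congr 4; ring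

/-- Deviation bound at a data-dependent parameter for the weighted response increment, using its
small second moment near `p₀`. -/
lemma pi_local_deviation_le {π : 𝒳 → ℝ} (hπ : IsRule π) {n : ℕ} (hn : 0 < n) (I : Finset (Fin n))
    {eh : (Fin n → Rec 𝒳 𝓑) → 𝒳 → ℝ}
    (hem : Measurable fun q : (Fin n → Rec 𝒳 𝓑) × 𝒳 => eh q.1 q.2)
    (hI : IndepOfCoords I eh) (heκ : ∀ u x, eh u x ∈ Set.Icc κ (1 - κ))
    {p : (Fin n → Rec 𝒳 𝓑) → Vec J} (hp : Measurable p) {M δ t t₁ V : ℝ}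
    (hM : M = 2 * κ⁻¹ * (K + 1)) (hδ : 0 ≤ δ) (ht : 0 < t) (ht₁ : 0 < t₁)
    (hMt : 16 * κ⁻¹ ≤ t) (hMt₁ : 32 * (M * κ⁻¹) ≤ t₁) (hMt₂ : 16 * (n * (M ^ 2) ^ 2) ≤ t₁ ^ 2)
    (hV : 4 * (n * (κ⁻¹ ^ 2 * (2 * L * δ)) + t₁) ≤ V)
    (hVt : 16 * (n * (κ⁻¹ ^ 2 * (2 * L * δ))) ≤ t ^ 2) :
    (Measure.pi fun _ : Fin n => Q) {u | (p u ∈ S ∧ ‖p u - p₀‖ ≤ δ) ∧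
        t < |∑ i ∈ I, (recWeight π (eh u) (u i) * (v (u i).obs (p u) - v (u i).obs p₀)
          - ∫ r, recWeight π (eh u) r * (v r.obs (p u) - v r.obs p₀) ∂Q)|}
      ≤ ENNReal.ofReal (4 * (1 + C * ((n : ℝ) + 2) ^ h)
          * Real.exp (-(t₁ ^ 2 / (512 * (n * (M ^ 2) ^ 2)))))
        + ENNReal.ofReal (4 * (1 + C * ((n : ℝ) + 2) ^ h)
          * Real.exp (-(t ^ 2 / (128 * V)))) := by
  have hκ := H.κ_pos
  have hK := H.K_nonneg
  have hC := H.C_nonneg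
  have hL := H.L_nonneg
  -- K + 1 in place of K keeps M positive even if K = 0.
  have hM0 : 0 < M := by rw [hM]; positivity
  have hIn : (I.card : ℝ) ≤ n := by exact_mod_cast (card_finset_fin_le I)
  set A : Set (Vec J) := {θ | θ ∈ S ∧ ‖θ - p₀‖ ≤ δ} with hAdef
  have hAm : MeasurableSet A := H.measurableSet_S.inter
    (measurableSet_le (measurable_id.sub_const p₀).norm measurable_const)
  have hA : A ⊆ S := fun θ hθ => hθ.1
  set f : (Fin n → Rec 𝒳 𝓑) → Vec J → Rec 𝒳 𝓑 → ℝ :=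
    fun u θ r => recWeight π (eh u) r * (v r.obs θ - v r.obs p₀) with hf
  have hfm : Measurable fun q : (Fin n → Rec 𝒳 𝓑) × Vec J × Rec 𝒳 𝓑 => f q.1 q.2.1 q.2.2 := by
    have hobs : Measurable fun q : (Fin n → Rec 𝒳 𝓑) × Vec J × Rec 𝒳 𝓑 => q.2.2.obs :=
      measurable_obs.comp (measurable_snd.comp measurable_snd)
    refine (measurable_recWeight (e := fun q : (Fin n → Rec 𝒳 𝓑) × Vec J × Rec 𝒳 𝓑 => eh q.1)
      hπ.1 ?_ (measurable_snd.comp measurable_snd)).mul (Measurable.sub ?_ ?_)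
    · exact hem.comp (measurable_fst.prodMk
        (measurable_fst.comp (measurable_snd.comp measurable_snd)))
    · exact H.measurable_v.comp (hobs.prodMk (measurable_fst.comp measurable_snd))
    · exact H.measurable_v.comp (hobs.prodMk measurable_const)
  have hfI : IndepOfCoords I f := fun u u' huu => by simp only [hf, hI u u' huu]
  have hw : ∀ u (r : Rec 𝒳 𝓑), |recWeight π (eh u) r| ≤ κ⁻¹ := fun u r => by
    have := recWeight_mem hπ.2 hκ (heκ u) r
    rw [abs_of_nonneg this.1]; exact this.2
  have hfM : ∀ u, ∀ θ ∈ A, ∀ r, |f u θ r| ≤ M := by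
    intro u θ hθ r
    have h1 := H.bounded r.obs θ hθ.1
    have h2 := H.bounded r.obs p₀ H.mem_S
    have h3 : |v r.obs θ - v r.obs p₀| ≤ 2 * (K + 1) := (abs_sub _ _).trans (by linarith)
    rw [hf, abs_mul, hM]
    calc _ ≤ κ⁻¹ * (2 * (K + 1)) := by gcongr; exact hw u r
      _ = _ := by ring
  have hfD : ∀ u r, ∀ θ ∈ A, ∀ θ' ∈ A, |f u θ r - f u θ' r| ≤ κ⁻¹ * |v r.obs θ - v r.obs θ'| := by
    intro u r θ _ θ' _
    rw [hf]
    simp only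
    rw [← mul_sub, sub_sub_sub_cancel_right, abs_mul]
    gcongr; exact hw u r
  have hfs : ∀ u, ∀ θ ∈ A, ∫ r, f u θ r ^ 2 ∂Q ≤ κ⁻¹ ^ 2 * (2 * L * δ) := by
    intro u θ hθ
    have hem' : Measurable (eh u) := hem.comp (measurable_const.prodMk measurable_id)
    refine (H.integral_sq_recWeight_mul_le hπ (heκ u) hθ.1).trans ?_
    gcongr; exact hθ.2
  have hmeas : ∀ u θ, Measurable (f u θ) := fun u θ =>
    hfm.comp (measurable_const.prodMk (measurable_const.prodMk measurable_id))
  -- The empirical second moment at the random parameter is controlled by the cruder inequality,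
  -- applied to the squares: they are bounded by M² and Lipschitz in the response with constant 2 M
  -- κ⁻¹.
  have h2 := H.pi_deviation_le hn I (f := fun u θ r => f u θ r ^ 2) (hfm.pow_const 2)
    (fun u u' huu => by simp only [hfI u u' huu]) hp hAm hA (M := M ^ 2) (D := 2 * M * κ⁻¹) (t := t₁)
    (by positivity) (by positivity)
    (fun u θ hθ r => by rw [abs_pow]; gcongr; exact hfM u θ hθ r)
    (fun u r θ hθ θ' hθ' => by
      rw [sq_sub_sq, abs_mul, mul_assoc]
      refine mul_le_mul ?_ (hfD u r θ hθ θ' hθ') (abs_nonneg _) (by positivity)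
      exact (abs_add_le _ _).trans (by linarith [hfM u θ hθ r, hfM u θ' hθ' r]))
    ht₁ (by linarith) hMt₂
  have hns : 0 ≤ (n : ℝ) * (κ⁻¹ ^ 2 * (2 * L * δ)) := by positivity
  have hV0 : 0 < V := by linarith
  have hcs : (I.card : ℝ) * (κ⁻¹ ^ 2 * (2 * L * δ)) ≤ n * (κ⁻¹ ^ 2 * (2 * L * δ)) := by gcongr
  have h1 := pi_symmetrization Q I hfm hfI hp hAm (V := V) (t := t)
    (m := 1 + C * ((n : ℝ) + 2) ^ h) (s2 := κ⁻¹ ^ 2 * (2 * L * δ)) hV0 ht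
    (fun u θ hθ => MemLp.of_bound (hmeas u θ).aestronglyMeasurable M
      (Eventually.of_forall fun r => hfM u θ hθ r)) hfs
    (by rw [div_le_iff₀ (by positivity)]; linarith)
    (by rw [div_le_iff₀ (by positivity)]; linarith)
    (fun u x x' A' hA' => H.exists_net I (by positivity) hMt (hA'.trans hA)
      (fun r θ hθ θ' hθ' => hfD u r θ (hA' hθ) θ' (hA' hθ')) x x')
  refine le_trans (measure_mono ?_) ((measure_union_le _ _).trans (add_le_add h2 h1))
  rintro u ⟨huA, hut⟩
  -- If the squares do not deviate by more than t₁, the empirical second moment is at most n times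
  -- the variance bound plus t₁, hence at most V, and the variance-sensitive inequality applies.
  by_cases hc : t₁ < |∑ i ∈ I, (f u (p u) (u i) ^ 2 - ∫ r, f u (p u) r ^ 2 ∂Q)|
  · exact Or.inl ⟨huA, hc⟩
  · refine Or.inr ⟨huA, ?_, hut⟩
    rw [not_lt] at hc
    have h3 := (abs_le.mp hc).2
    rw [Finset.sum_sub_distrib, Finset.sum_const, nsmul_eq_mul] at h3
    have h4 : (I.card : ℝ) * ∫ r, f u (p u) r ^ 2 ∂Q ≤ n * (κ⁻¹ ^ 2 * (2 * L * δ)) :=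
      mul_le_mul hIn (hfs u _ huA) (integral_nonneg fun r => sq_nonneg _) (by positivity)
    linarith

end RegularResponse

/-! ### Limits of cross-fitted sums under the joint law of seed and sample -/

/-- `I n z` is a test sample that depends on the random seed `z` only, and `eh n z u` is a propensity
score, bounded away from zero and one, that is fitted outside of the test sample. -/
structure IsCrossFit {Z 𝒳 𝓑 : Type*} [MeasurableSpace Z] [MeasurableSpace 𝒳] [MeasurableSpace 𝓑]
    (I : (n : ℕ) → Z → Finset (Fin n)) (eh : (n : ℕ) → Z → (Fin n → Rec 𝒳 𝓑) → 𝒳 → ℝ) (κ : ℝ) :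
    Prop where
  measurableSet_mem : ∀ n i, MeasurableSet {z | i ∈ I n z}
  measurable_eh : ∀ n, Measurable fun q : (Z × (Fin n → Rec 𝒳 𝓑)) × 𝒳 => eh n q.1.1 q.1.2 q.2
  indep : ∀ n z, IndepOfCoords (I n z) (eh n z)
  mem : ∀ n z u x, eh n z u x ∈ Set.Icc κ (1 - κ)

lemma measurable_sum_testSample {Z R : Type*} [MeasurableSpace Z] [MeasurableSpace R] {n : ℕ}
    {I : Z → Finset (Fin n)} (hI : ∀ i, MeasurableSet {z | i ∈ I z})
    {g : Z × (Fin n → R) → Fin n → ℝ} (hg : ∀ i, Measurable fun q => g q i) :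
    Measurable fun q : Z × (Fin n → R) => ∑ i ∈ I q.1, g q i := by
  have : ∀ q : Z × (Fin n → R), ∑ i ∈ I q.1, g q i = ∑ i, if i ∈ I q.1 then g q i else 0 := by
    intro q; simp
  simp_rw [this]
  exact Finset.measurable_sum _ fun i _ =>
    Measurable.ite (measurable_fst (hI i)) (hg i) measurable_const

namespace RegularResponse

variable {Z 𝒳 𝓑 : Type*} [MeasurableSpace Z] [MeasurableSpace 𝒳] [MeasurableSpace 𝓑] {J : ℕ}
  {Q : Measure (Rec 𝒳 𝓑)} {S : Set (Vec J)} {p₀ : Vec J} {e : 𝒳 → ℝ}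
  {v : 𝓑 → Vec J → ℝ} {μ : Bool → 𝒳 → Vec J → ℝ} {κ K L C h : ℝ}

/-- The centered sum over the test sample `I` of the weighted response increments between the
cutoffs `p₀` and `p`. -/
def centeredIncrement (Q : Measure (Rec 𝒳 𝓑)) (π : 𝒳 → ℝ) (v : 𝓑 → Vec J → ℝ) (p₀ : Vec J)
    {n : ℕ} (I : Finset (Fin n)) (e' : 𝒳 → ℝ) (u : Fin n → Rec 𝒳 𝓑) (p : Vec J) : ℝ :=
  ∑ i ∈ I, (recWeight π e' (u i) * (v (u i).obs p - v (u i).obs p₀)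
          - ∫ r, recWeight π e' r * (v r.obs p - v r.obs p₀) ∂Q)

variable (H : RegularResponse Q S p₀ e v μ κ K L C h) [IsProbabilityMeasure Q]
  {ζ : Measure Z} [IsProbabilityMeasure ζ] {I : (n : ℕ) → Z → Finset (Fin n)}
  {eh : (n : ℕ) → Z → (Fin n → Rec 𝒳 𝓑) → 𝒳 → ℝ}

include H

/-- Within n^(-β) of p₀ the summed variance is of order n^(1 - β), so a fluctuation of order n^τ has
probability about exp(-n^(2τ - (1 - β))) times the polynomial net size. The condition 9/16 ≤ 1 - β
lets the allowance n^(9/16) for the empirical second moment be absorbed by the variance; the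
condition on τ keeps the exponent at least n^(1/8), up to constants. -/
lemma tendsto_centeredIncrement (hE : IsCrossFit I eh κ) {π : 𝒳 → ℝ} (hπ : IsRule π)
    {p : (n : ℕ) → Z × (Fin n → Rec 𝒳 𝓑) → Vec J} (hp : ∀ n, Measurable (p n)) {c₁ c₂ τ β : ℝ}
    (hc₁ : 0 < c₁) (hc₂ : 0 ≤ c₂) (hβ : 9 / 16 ≤ 1 - β) (hτ : 1 / 8 ≤ 2 * τ - (1 - β)) :
    Tendsto (fun n : ℕ => (ζ.prod (Measure.pi fun _ : Fin n => Q))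
      {q | (p n q ∈ S ∧ ‖p n q - p₀‖ ≤ c₂ * (n : ℝ) ^ (-β)) ∧
        c₁ * (n : ℝ) ^ τ < |centeredIncrement Q π v p₀ (I n q.1) (eh n q.1 q.2) q.2 (p n q)|})
      atTop (𝓝 0) := by
  have hκ := H.κ_pos
  have hK := H.K_nonneg
  have hC := H.C_nonneg
  have hL := H.L_nonneg
  have hh := H.h_nonneg
  set M := 2 * κ⁻¹ * (K + 1) with hM
  have hM0 : 0 < M := by positivity
  set c₃ := κ⁻¹ ^ 2 * (2 * L * c₂) with hc₃
  have hc₃0 : 0 ≤ c₃ := by positivity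
  set a₁ := 1 / (512 * (M ^ 2) ^ 2) with ha₁
  set a₂ := c₁ ^ 2 / (512 * (c₃ + 1)) with ha₂
  have hlim := (tendsto_polynomial_mul_exp_neg hC hh (a := 1 / 8) (c := a₁) (by norm_num)
    (by positivity)).add (tendsto_polynomial_mul_exp_neg hC hh (a := 1 / 8) (c := a₂) (by norm_num)
    (by positivity))
  rw [add_zero] at hlim
  have hlim' := ENNReal.tendsto_ofReal hlim
  rw [ENNReal.ofReal_zero] at hlim'
  have hpow : ∀ {a : ℝ}, 0 < a → ∀ b : ℝ, ∀ᶠ n : ℕ in atTop, b ≤ (n : ℝ) ^ a := fun ha b =>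
    ((tendsto_rpow_atTop ha).comp tendsto_natCast_atTop_atTop).eventually_ge_atTop b
  refine tendsto_of_tendsto_of_tendsto_of_le_of_le' tendsto_const_nhds hlim'
    (Eventually.of_forall fun _ => zero_le) ?_
  filter_upwards [eventually_ge_atTop 1, hpow (a := τ) (by linarith) (16 * κ⁻¹ / c₁),
    hpow (a := 9 / 16) (by norm_num) (32 * (M * κ⁻¹)),
    hpow (a := 1 / 8) (by norm_num) (16 * (M ^ 2) ^ 2),
    hpow (a := 1 / 8) (by norm_num) (16 * c₃ / c₁ ^ 2)] with n hn g1 g2 g3 g4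
  have hn0 : (0 : ℝ) < n := by exact_mod_cast hn
  have hn1 : (1 : ℝ) ≤ n := by exact_mod_cast hn
  have ht₁sq : ((n : ℝ) ^ (9 / 16 : ℝ)) ^ 2 = n * (n : ℝ) ^ (1 / 8 : ℝ) := by
    rw [← Real.rpow_natCast, ← Real.rpow_mul hn0.le]
    nth_rewrite 2 [← Real.rpow_one (n : ℝ)]
    rw [← Real.rpow_add hn0]; norm_num
  have htsq : (c₁ * (n : ℝ) ^ τ) ^ 2
      = c₁ ^ 2 * ((n : ℝ) ^ (1 - β) * (n : ℝ) ^ (2 * τ - (1 - β))) := by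
    rw [mul_pow, ← Real.rpow_natCast ((n : ℝ) ^ τ), ← Real.rpow_mul hn0.le, ← Real.rpow_add hn0]
    congr 2; push_cast; ring
  have hge : (n : ℝ) ^ (1 / 8 : ℝ) ≤ (n : ℝ) ^ (2 * τ - (1 - β)) :=
    Real.rpow_le_rpow_of_exponent_le hn1 hτ
  have hns : (n : ℝ) * (κ⁻¹ ^ 2 * (2 * L * (c₂ * (n : ℝ) ^ (-β)))) = c₃ * (n : ℝ) ^ (1 - β) := by
    rw [sub_eq_add_neg, Real.rpow_add hn0, Real.rpow_one, hc₃]; ring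
  have hV9 : (n : ℝ) ^ (9 / 16 : ℝ) ≤ (n : ℝ) ^ (1 - β) :=
    Real.rpow_le_rpow_of_exponent_le hn1 hβ
  have hpos1 : 0 < (n : ℝ) ^ (1 - β) := by positivity
  have hI : Measurable fun q : Z × (Fin n → Rec 𝒳 𝓑) =>
      |centeredIncrement Q π v p₀ (I n q.1) (eh n q.1 q.2) q.2 (p n q)| := by
    refine (measurable_sum_testSample (hE.measurableSet_mem n) fun i => ?_).abs
    have hui : Measurable fun q : Z × (Fin n → Rec 𝒳 𝓑) => q.2 i :=
      (measurable_pi_apply i).comp measurable_snd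
    refine Measurable.sub (Measurable.mul ?_ (Measurable.sub ?_ ?_)) ?_
    · exact measurable_recWeight (e := fun q : Z × (Fin n → Rec 𝒳 𝓑) => eh n q.1 q.2) hπ.1
        ((hE.measurable_eh n).comp (measurable_id.prodMk (measurable_fst.comp hui))) hui
    · exact H.measurable_v.comp ((measurable_obs.comp hui).prodMk (hp n))
    · exact H.measurable_v.comp ((measurable_obs.comp hui).prodMk measurable_const)
    · have : Measurable fun q : (Z × (Fin n → Rec 𝒳 𝓑)) × Rec 𝒳 𝓑 =>
          recWeight π (eh n q.1.1 q.1.2) q.2 * (v q.2.obs (p n q.1) - v q.2.obs p₀) := by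
        refine Measurable.mul ?_ (Measurable.sub ?_ ?_)
        · exact measurable_recWeight
            (e := fun q : (Z × (Fin n → Rec 𝒳 𝓑)) × Rec 𝒳 𝓑 => eh n q.1.1 q.1.2) hπ.1
            ((hE.measurable_eh n).comp (measurable_fst.prodMk (measurable_fst.comp measurable_snd)))
            measurable_snd
        · exact H.measurable_v.comp ((measurable_obs.comp measurable_snd).prodMk
            ((hp n).comp measurable_fst))
        · exact H.measurable_v.comp ((measurable_obs.comp measurable_snd).prodMk measurable_const)
      exact (this.stronglyMeasurable.integral_prod_right).measurable
  have hset : MeasurableSet {q : Z × (Fin n → Rec 𝒳 𝓑) |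
      (p n q ∈ S ∧ ‖p n q - p₀‖ ≤ c₂ * (n : ℝ) ^ (-β)) ∧
        c₁ * (n : ℝ) ^ τ < |centeredIncrement Q π v p₀ (I n q.1) (eh n q.1 q.2) q.2 (p n q)|} :=
    ((hp n H.measurableSet_S).inter
      (measurableSet_le ((hp n).sub_const p₀).norm measurable_const)).inter
      (measurableSet_lt measurable_const hI)
  -- With the seed fixed, the fold is a fixed set and the bound for i.i.d. records holds uniformly
  -- in z.
  refine prod_apply_le_of_section_le hset fun z => ?_
  -- Here n times the variance bound equals c₃ n^(1 - β), and t₁ = n^(9/16) ≤ n^(1 - β), which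
  -- explains V. For the squares, t₁²/n = n^(1/8).
  have hb := H.pi_local_deviation_le hπ (n := n) (by omega) (I n z) (eh := eh n z)
    ((hE.measurable_eh n).comp ((measurable_const.prodMk measurable_fst).prodMk measurable_snd))
    (hE.indep n z) (hE.mem n z) (p := fun u => p n (z, u))
    ((hp n).comp (measurable_const.prodMk measurable_id)) (M := M) (δ := c₂ * (n : ℝ) ^ (-β))
    (t := c₁ * (n : ℝ) ^ τ) (t₁ := (n : ℝ) ^ (9 / 16 : ℝ)) (V := 4 * (c₃ + 1) * (n : ℝ) ^ (1 - β)) hM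
    (by positivity) (by positivity) (by positivity)
    (by rw [div_le_iff₀ hc₁] at g1; linarith) g2
    (by rw [ht₁sq]; nlinarith)
    (by rw [hns]; nlinarith)
    (by
      rw [hns, htsq]
      rw [div_le_iff₀ (by positivity)] at g4
      have : 16 * c₃ ≤ c₁ ^ 2 * (n : ℝ) ^ (2 * τ - (1 - β)) :=
        g4.trans (by rw [mul_comm]; gcongr)
      nlinarith)
  refine hb.trans ?_
  rw [← ENNReal.ofReal_add (by positivity) (by positivity)]
  apply ENNReal.ofReal_le_ofReal
  have e1 : (n : ℝ) ^ (9 / 16 : ℝ) = (n : ℝ) ^ (9 / 16 : ℝ) := rfl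
  gcongr
  · rw [ht₁sq, ha₁]
    apply le_of_eq; field_simp
  · rw [htsq, ha₂]
    calc _ ≤ c₁ ^ 2 / (512 * (c₃ + 1)) * (n : ℝ) ^ (2 * τ - (1 - β)) := by gcongr
      _ = _ := by field_simp; ring

/-- The nuisance estimates `e'` and `m` have `L²` errors at most `ρ` and `ρ'`. -/
def IsGoodFit (Q : Measure (Rec 𝒳 𝓑)) (e : 𝒳 → ℝ) (μ : Bool → 𝒳 → Vec J → ℝ) (p₀ : Vec J)
    (ρ ρ' : ℝ) (e' : 𝒳 → ℝ) (m : Bool → 𝒳 → ℝ) : Prop :=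
  ∫⁻ r : Rec 𝒳 𝓑, ENNReal.ofReal ((e' r.1 - e r.1) ^ 2) ∂Q ≤ ENNReal.ofReal (ρ ^ 2) ∧
  ∀ w, ∫⁻ r : Rec 𝒳 𝓑, ENNReal.ofReal ((m w r.1 - μ w r.1 p₀) ^ 2) ∂Q ≤ ENNReal.ofReal (ρ' ^ 2)

-- Good fits are stated with integrals in [0, ∞], so that square integrability is part of the
-- condition: a Bochner integral would be zero by default for a square that is not integrable.
omit H [IsProbabilityMeasure Q] in
lemma memLp_of_lintegral_sq_le {f : Rec 𝒳 𝓑 → ℝ} (hf : Measurable f) {a : ℝ}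
    (h : ∫⁻ r, ENNReal.ofReal (f r ^ 2) ∂Q ≤ ENNReal.ofReal (a ^ 2)) :
    MemLp f 2 Q ∧ ∫ r, f r ^ 2 ∂Q ≤ a ^ 2 := by
  have hm : AEStronglyMeasurable (fun r => f r ^ 2) Q := (hf.pow_const 2).aestronglyMeasurable
  constructor
  · rw [memLp_two_iff_integrable_sq hf.aestronglyMeasurable]
    refine ⟨hm, ?_⟩
    rw [hasFiniteIntegral_iff_ofReal (Eventually.of_forall fun r => sq_nonneg _)]
    exact h.trans_lt ENNReal.ofReal_lt_top
  · rw [integral_eq_lintegral_of_nonneg_ae (Eventually.of_forall fun r => sq_nonneg _) hm]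
    exact ENNReal.toReal_le_of_le_ofReal (sq_nonneg _) h

lemma measurableSet_isGoodFit {n : ℕ} {eh : Z → (Fin n → Rec 𝒳 𝓑) → 𝒳 → ℝ}
    {mh : Z → (Fin n → Rec 𝒳 𝓑) → Bool → 𝒳 → ℝ}
    (he : Measurable fun q : (Z × (Fin n → Rec 𝒳 𝓑)) × 𝒳 => eh q.1.1 q.1.2 q.2)
    (hm : ∀ w, Measurable fun q : (Z × (Fin n → Rec 𝒳 𝓑)) × 𝒳 => mh q.1.1 q.1.2 w q.2)
    (ρ ρ' : ℝ) : MeasurableSet {q : Z × (Fin n → Rec 𝒳 𝓑) |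
      IsGoodFit Q e μ p₀ ρ ρ' (eh q.1 q.2) (mh q.1 q.2)} := by
  have h1 : Measurable fun q : Z × (Fin n → Rec 𝒳 𝓑) =>
      ∫⁻ r : Rec 𝒳 𝓑, ENNReal.ofReal ((eh q.1 q.2 r.1 - e r.1) ^ 2) ∂Q := by
    have : Measurable fun q : (Z × (Fin n → Rec 𝒳 𝓑)) × Rec 𝒳 𝓑 =>
        ENNReal.ofReal ((eh q.1.1 q.1.2 q.2.1 - e q.2.1) ^ 2) :=
      ((((he).comp (measurable_fst.prodMk
        (measurable_fst.comp measurable_snd))).sub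
        (H.measurable_e.comp (measurable_fst.comp measurable_snd))).pow_const 2).ennreal_ofReal
    exact this.lintegral_prod_right'
  have h2 : ∀ w, Measurable fun q : Z × (Fin n → Rec 𝒳 𝓑) =>
      ∫⁻ r : Rec 𝒳 𝓑, ENNReal.ofReal ((mh q.1 q.2 w r.1 - μ w r.1 p₀) ^ 2) ∂Q := by
    intro w
    have : Measurable fun q : (Z × (Fin n → Rec 𝒳 𝓑)) × Rec 𝒳 𝓑 =>
        ENNReal.ofReal ((mh q.1.1 q.1.2 w q.2.1 - μ w q.2.1 p₀) ^ 2) :=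
      ((((hm w).comp (measurable_fst.prodMk (measurable_fst.comp measurable_snd))).sub
        ((H.measurable_mu w p₀ H.mem_S).comp
          (measurable_fst.comp measurable_snd))).pow_const 2).ennreal_ofReal
    exact this.lintegral_prod_right'
  have : {q : Z × (Fin n → Rec 𝒳 𝓑) | IsGoodFit Q e μ p₀ ρ ρ' (eh q.1 q.2) (mh q.1 q.2)} = {q | ∫⁻ r : Rec 𝒳 𝓑, ENNReal.ofReal ((eh q.1 q.2 r.1 - e r.1) ^ 2) ∂Q
      ≤ ENNReal.ofReal (ρ ^ 2)} ∩ ⋂ w, {q | ∫⁻ r : Rec 𝒳 𝓑,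
        ENNReal.ofReal ((mh q.1 q.2 w r.1 - μ w r.1 p₀) ^ 2) ∂Q
        ≤ ENNReal.ofReal (ρ' ^ 2)} := by
    ext q; simp [IsGoodFit]
  rw [this]
  exact (measurableSet_le h1 measurable_const).inter
    (MeasurableSet.iInter fun w => measurableSet_le (h2 w) measurable_const)

-- Given the seed and the training folds, the terms are i.i.d. with mean at most 2κ⁻¹ρρ' and second
-- moment at most `s n`, which tends to zero. The means add up to at most 2κ⁻¹nρρ' = o(√n). The
-- centered sum has variance at most n · `s n`, so Chebyshev at ε√n/2 leaves `s n` / (ε/2)².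
set_option maxHeartbeats 400000 in
lemma tendsto_crossfit_score (hE : IsCrossFit I eh κ) {π : 𝒳 → ℝ} (hπ : IsRule π)
    {mh : (n : ℕ) → Z → (Fin n → Rec 𝒳 𝓑) → Bool → 𝒳 → ℝ}
    (hm : ∀ n w, Measurable fun q : (Z × (Fin n → Rec 𝒳 𝓑)) × 𝒳 => mh n q.1.1 q.1.2 w q.2)
    (hmI : ∀ n z, IndepOfCoords (I n z) (mh n z)) {ρ ρ' : ℕ → ℝ} (hρ : ∀ n, 0 ≤ ρ n)
    (hρ' : ∀ n, 0 ≤ ρ' n) (hρ0 : Tendsto ρ atTop (𝓝 0)) (hρ'0 : Tendsto ρ' atTop (𝓝 0))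
    (hprod : Tendsto (fun n : ℕ => √(n : ℝ) * (ρ n * ρ' n)) atTop (𝓝 0)) {ε : ℝ} (hε : 0 < ε) :
    Tendsto (fun n : ℕ => (ζ.prod (Measure.pi fun _ : Fin n => Q))
      {q | IsGoodFit Q e μ p₀ (ρ n) (ρ' n) (eh n q.1 q.2) (mh n q.1 q.2) ∧
        ε * √(n : ℝ) < |∑ i ∈ I n q.1,
          (recScore π (eh n q.1 q.2) (mh n q.1 q.2) (v (q.2 i).obs p₀) (q.2 i)
            - recScore π e (fun w x => μ w x p₀) (v (q.2 i).obs p₀) (q.2 i))|})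
      atTop (𝓝 0) := by
  have hκ := H.κ_pos
  have hK := H.K_nonneg
  set s : ℕ → ℝ := fun n =>
    8 * (1 + κ⁻¹) ^ 2 * ρ' n ^ 2 + 8 * (2 * K / κ ^ 2) ^ 2 * ρ n ^ 2 with hs
  have hs0 : Tendsto (fun n => s n / (ε / 2) ^ 2) atTop (𝓝 0) := by
    have := ((hρ'0.pow 2).const_mul (8 * (1 + κ⁻¹) ^ 2)).add
      ((hρ0.pow 2).const_mul (8 * (2 * K / κ ^ 2) ^ 2))
    simpa using this.div_const ((ε / 2) ^ 2)
  have hlim := ENNReal.tendsto_ofReal hs0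
  rw [ENNReal.ofReal_zero] at hlim
  have hbias : ∀ᶠ n : ℕ in atTop, 2 * κ⁻¹ * (√(n : ℝ) * (ρ n * ρ' n)) < ε / 2 := by
    have := hprod.const_mul (2 * κ⁻¹)
    rw [mul_zero] at this
    exact this.eventually_lt_const (half_pos hε)
  refine tendsto_of_tendsto_of_tendsto_of_le_of_le' tendsto_const_nhds hlim
    (Eventually.of_forall fun _ => zero_le) ?_
  filter_upwards [eventually_ge_atTop 1, hbias] with n hn hbn
  have hn0 : (0 : ℝ) < n := by exact_mod_cast hn
  set G : Set (Z × (Fin n → Rec 𝒳 𝓑)) :=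
    {q | IsGoodFit Q e μ p₀ (ρ n) (ρ' n) (eh n q.1 q.2) (mh n q.1 q.2)} with hG
  have hGm : MeasurableSet G := H.measurableSet_isGoodFit (hE.measurable_eh n) (hm n) _ _
  set D : Z × (Fin n → Rec 𝒳 𝓑) → Rec 𝒳 𝓑 → ℝ := fun q r =>
    recScore π (eh n q.1 q.2) (mh n q.1 q.2) (v r.obs p₀) r
      - recScore π e (fun w x => μ w x p₀) (v r.obs p₀) r with hD
  have hDm : Measurable fun q : (Z × (Fin n → Rec 𝒳 𝓑)) × Rec 𝒳 𝓑 => D q.1 q.2 := by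
    refine Measurable.sub ?_ ((H.measurable_trueScore hπ).comp measurable_snd)
    exact measurable_recScore (e := fun q : (Z × (Fin n → Rec 𝒳 𝓑)) × Rec 𝒳 𝓑 => eh n q.1.1 q.1.2)
      (μ := fun q : (Z × (Fin n → Rec 𝒳 𝓑)) × Rec 𝒳 𝓑 => mh n q.1.1 q.1.2) hπ.1
      ((hE.measurable_eh n).comp (measurable_fst.prodMk (measurable_fst.comp measurable_snd)))
      (fun w => (hm n w).comp (measurable_fst.prodMk (measurable_fst.comp measurable_snd)))
      ((H.measurable_v_at p₀).comp (measurable_obs.comp measurable_snd)) measurable_snd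
  have hset : MeasurableSet {q : Z × (Fin n → Rec 𝒳 𝓑) | q ∈ G ∧
      ε * √(n : ℝ) < |∑ i ∈ I n q.1, D q (q.2 i)|} := by
    have : Measurable fun q : Z × (Fin n → Rec 𝒳 𝓑) => |∑ i ∈ I n q.1, D q (q.2 i)| :=
      (measurable_sum_testSample (hE.measurableSet_mem n) fun i =>
        hDm.comp (measurable_id.prodMk ((measurable_pi_apply i).comp measurable_snd))).abs
    exact hGm.inter (measurableSet_lt measurable_const this)
  refine prod_apply_le_of_section_le hset fun z => ?_
  have hez : ∀ u, Measurable (eh n z u) := fun u =>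
    (hE.measurable_eh n).comp ((measurable_const (a := (z, u))).prodMk measurable_id)
  have hmz : ∀ u w, Measurable (mh n z u w) := fun u w =>
    (hm n w).comp ((measurable_const (a := (z, u))).prodMk measurable_id)
  have hfacts : ∀ u, (z, u) ∈ G → MemLp (D (z, u)) 2 Q ∧
      |∫ r, D (z, u) r ∂Q| ≤ 2 * κ⁻¹ * (ρ n * ρ' n) ∧ ∫ r, D (z, u) r ^ 2 ∂Q ≤ s n := by
    intro u hu
    have hes := memLp_of_lintegral_sq_le (((hez u).sub H.measurable_e).comp measurable_fst) hu.1
    have hms := fun w => memLp_of_lintegral_sq_le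
      (((hmz u w).sub (H.measurable_mu w p₀ H.mem_S)).comp measurable_fst) (hu.2 w)
    exact H.recScore_error hπ (hez u) (hE.mem n z u) (hρ n) (hρ' n) hes.2 (hmz u)
      (fun w => (hms w).1) (fun w => (hms w).2)
  have hcheb := pi_crossfit_chebyshev Q (I n z) (h := fun u => D (z, u))
    (hDm.comp ((measurable_const.prodMk measurable_fst).prodMk measurable_snd))
    (fun u u' huu => by simp only [hD, hE.indep n z u u' huu, hmI n z u u' huu])
    (G := {u | (z, u) ∈ G}) (hGm.preimage (measurable_const.prodMk measurable_id))
    (fun u u' huu => by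
      simp only [hG, Set.mem_ofPred_eq, hE.indep n z u u' huu, hmI n z u u' huu])
    (s := s n) (t := ε / 2 * √(n : ℝ)) (fun u hu => (hfacts u hu).1)
    (fun u hu => (hfacts u hu).2.2) (by positivity)
  refine (measure_mono ?_).trans (hcheb.trans ?_)
  · rintro u ⟨hu, hlt⟩
    refine ⟨hu, ?_⟩
    have hmean := (hfacts u hu).2.1
    change |∫ r, D (z, u) r ∂Q| ≤ _ at hmean
    change ε * √(n : ℝ) < |∑ i ∈ I n z, D (z, u) (u i)| at hlt
    have hcard : ((I n z).card : ℝ) ≤ n := by exact_mod_cast (card_finset_fin_le _)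
    have h1 : |(∑ i ∈ I n z, D (z, u) (u i)) - ∑ i ∈ I n z, (D (z, u) (u i) - ∫ r, D (z, u) r ∂Q)|
        ≤ ε / 2 * √(n : ℝ) := by
      rw [← Finset.sum_sub_distrib]
      simp only [sub_sub_cancel, Finset.sum_const, nsmul_eq_mul]
      rw [abs_mul, abs_of_nonneg (Nat.cast_nonneg _)]
      calc _ ≤ (n : ℝ) * (2 * κ⁻¹ * (ρ n * ρ' n)) := by gcongr
        _ = 2 * κ⁻¹ * (√(n : ℝ) * (ρ n * ρ' n)) * √(n : ℝ) := by
            nth_rewrite 1 [← Real.mul_self_sqrt hn0.le]; ring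
        _ ≤ ε / 2 * √(n : ℝ) := by gcongr
    have h2 := abs_sub_abs_le_abs_sub (∑ i ∈ I n z, D (z, u) (u i))
      (∑ i ∈ I n z, (D (z, u) (u i) - ∫ r, D (z, u) r ∂Q))
    linarith
  · apply ENNReal.ofReal_le_ofReal
    have hcard : ((I n z).card : ℝ) ≤ n := by exact_mod_cast (card_finset_fin_le _)
    have hsn : 0 ≤ s n := by positivity
    rw [mul_pow, Real.sq_sqrt hn0.le]
    calc _ ≤ n * s n / ((ε / 2) ^ 2 * n) := by gcongr
      _ = _ := by field_simp

end RegularResponse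

/-! ### Identification -/

namespace Model

variable {Ω 𝒳 𝓑 : Type*} [MeasurableSpace Ω] [MeasurableSpace 𝒳] [MeasurableSpace 𝓑] {J : ℕ}
  (M : Model Ω 𝒳 𝓑 J)

lemma measurable_participant (i : ℕ) : Measurable (M.participant i) :=
  (M.measurable_X i).prodMk (((M.measurable_B true i).prodMk (M.measurable_B false i)).prodMk
    (M.measurable_W i))

/-- The law of the full record of one participant. -/
def lawRec : Measure (Rec 𝒳 𝓑) := M.P.map (M.participant 0)

lemma isProbabilityMeasure_lawRec : IsProbabilityMeasure M.lawRec :=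
  have := M.isProb
  Measure.isProbabilityMeasure_map (M.measurable_participant 0).aemeasurable

lemma pot_participant (w : Bool) (i : ℕ) (ω : Ω) :
    Rec.pot w (M.participant i ω) = M.B w i ω := by
  cases w <;> rfl

lemma obs_participant (i : ℕ) (ω : Ω) : Rec.obs (M.participant i ω) = M.obsB i ω :=
  M.pot_participant _ _ _

lemma integral_lawRec {f : Rec 𝒳 𝓑 → ℝ} (hf : Measurable f) :
    ∫ r, f r ∂M.lawRec = ∫ ω, f (M.participant 0 ω) ∂M.P :=
  integral_map (M.measurable_participant 0).aemeasurable hf.aestronglyMeasurable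

lemma map_fst_lawRec : M.lawRec.map Prod.fst = M.lawX :=
  Measure.map_map measurable_fst (M.measurable_participant 0)

/-- The σ-algebra generated by the covariates of one participant. -/
abbrev sigmaX : MeasurableSpace Ω := MeasurableSpace.comap (M.X 0) inferInstance

lemma sigmaX_le : M.sigmaX ≤ ‹MeasurableSpace Ω› := (M.measurable_X 0).comap_le

/-- Given the covariates, treatment is independent of the potential submissions, with probability
given by the propensity score. -/
lemma integral_indicator_arm {η : Nuisance 𝒳 J} (hη : M.IsTrueNuisance η)
    (hId : M.Identification η) (w : Bool) {F : 𝒳 × (𝓑 × 𝓑) → ℝ} (hF : Measurable F) :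
    ∫ r : Rec 𝒳 𝓑, (if r.2.2 = w then F (r.1, r.2.1) else 0) ∂M.lawRec
      = ∫ r : Rec 𝒳 𝓑, F (r.1, r.2.1) * (if w then η.e r.1 else 1 - η.e r.1) ∂M.lawRec := by
  have := M.isProb
  set U : Ω → 𝓑 × 𝓑 := fun ω => (M.B true 0 ω, M.B false 0 ω) with hU
  have hUm : Measurable U := (M.measurable_B true 0).prodMk (M.measurable_B false 0)
  set V : Ω → 𝒳 × (𝓑 × 𝓑) := fun ω => (M.X 0 ω, U ω) with hV
  have hVm : Measurable V := (M.measurable_X 0).prodMk hUm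
  set ew : 𝒳 → ℝ := fun x => if w then η.e x else 1 - η.e x with hew
  have hewm : Measurable ew := by
    have := hη.measurable_e
    cases w
    · exact measurable_const.sub this
    · exact this
  have hew0 : ∀ x, 0 ≤ ew x := fun x => by
    have := hId.overlap x
    cases w <;> simp only [hew] <;> simp <;> linarith [this.1, this.2]
  have hew1 : ∀ x, |ew x| ≤ 1 := fun x => by
    rw [abs_of_nonneg (hew0 x)]
    have := hId.overlap x
    cases w <;> simp only [hew] <;> simp <;> linarith [this.1, this.2]
  have hmle := M.sigmaX_le
  have hone : ∀ {s : Set Ω}, MeasurableSet s → Integrable (s.indicator fun _ => (1 : ℝ)) M.P :=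
    fun hs => (integrable_const 1).indicator hs
  have hWm : ∀ w', MeasurableSet (M.W 0 ⁻¹' {w'}) := fun w' =>
    M.measurable_W 0 (measurableSet_singleton w')
  have hcond : M.P[(M.W 0 ⁻¹' {w}).indicator (fun _ => (1 : ℝ)) | M.sigmaX]
      =ᵐ[M.P] fun ω => ew (M.X 0 ω) := by
    cases w
    · have h1 : (M.W 0 ⁻¹' {false}).indicator (fun _ => (1 : ℝ))
          = (fun _ => (1 : ℝ)) - (M.W 0 ⁻¹' {true}).indicator (fun _ => (1 : ℝ)) := by
        funext ω
        by_cases h : M.W 0 ω = true <;> simp [h]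
      rw [h1]
      have h2 := condExp_sub (μ := M.P) (integrable_const (1 : ℝ)) (hone (hWm true)) M.sigmaX
      rw [condExp_const hmle] at h2
      refine h2.trans ?_
      filter_upwards [hη.e_eq] with ω hω
      simp only [Pi.sub_apply, hew, ← hω]; simp
    · filter_upwards [hη.e_eq] with ω hω
      simp only [hew, ← hω, if_true]
  set ν₁ : Measure (𝒳 × (𝓑 × 𝓑)) := (M.P.restrict (M.W 0 ⁻¹' {w})).map V with hν₁
  set ν₂ : Measure (𝒳 × (𝓑 × 𝓑)) :=
    (M.P.withDensity fun ω => ENNReal.ofReal (ew (M.X 0 ω))).map V with hν₂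
  -- Unconfoundedness concerns events of submissions, conditionally on X, and so only yields
  -- rectangles s × t. Equality of the two measures extends the identity to every measurable F.
  have hν : ν₁ = ν₂ := by
    have : IsFiniteMeasure ν₁ := by rw [hν₁]; infer_instance
    refine Measure.ext_prod fun {s t} hs ht => ?_
    have hst : MeasurableSet (s ×ˢ t) := hs.prod ht
    have hsX : MeasurableSet (M.X 0 ⁻¹' s) := M.measurable_X 0 hs
    have htU : MeasurableSet (U ⁻¹' t) := hUm ht
    have hpre : V ⁻¹' (s ×ˢ t) = M.X 0 ⁻¹' s ∩ U ⁻¹' t := by ext ω; simp [hV]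
    rw [hν₁, hν₂, Measure.map_apply hVm hst, Measure.map_apply hVm hst, hpre,
      Measure.restrict_apply (hsX.inter htU), withDensity_apply _ (hsX.inter htU)]
    have hewi : Integrable (fun ω => ew (M.X 0 ω)) M.P :=
      Integrable.of_bound (hewm.comp (M.measurable_X 0)).aestronglyMeasurable 1
        (Eventually.of_forall fun ω => hew1 _)
    have hreal : M.P.real (M.X 0 ⁻¹' s ∩ U ⁻¹' t ∩ M.W 0 ⁻¹' {w})
        = ∫ ω in M.X 0 ⁻¹' s ∩ U ⁻¹' t, ew (M.X 0 ω) ∂M.P := by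
      have hsm : MeasurableSet[M.sigmaX] (M.X 0 ⁻¹' s) := ⟨s, hs, rfl⟩
      have hmul : Integrable ((fun ω => ew (M.X 0 ω)) * (U ⁻¹' t).indicator fun _ => (1 : ℝ))
          M.P := by
        refine (hone htU).bdd_mul (c := 1) (hewm.comp (M.measurable_X 0)).aestronglyMeasurable
          (Eventually.of_forall fun ω => hew1 _)
      have hewms : AEStronglyMeasurable[M.sigmaX] (fun ω => ew (M.X 0 ω)) M.P :=
        (hewm.comp (comap_measurable (M.X 0))).aestronglyMeasurable
      have hpull := condExp_mul_of_aestronglyMeasurable_left (m := M.sigmaX) hewms hmul (hone htU)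
      have hci := hId.unconfounded t {w} ht (measurableSet_singleton w)
      calc M.P.real (M.X 0 ⁻¹' s ∩ U ⁻¹' t ∩ M.W 0 ⁻¹' {w})
          = ∫ ω in M.X 0 ⁻¹' s, (U ⁻¹' t ∩ M.W 0 ⁻¹' {w}).indicator (fun _ => (1 : ℝ)) ω ∂M.P := by
            rw [setIntegral_indicator (htU.inter (hWm w)), Set.inter_assoc]; simp
        _ = ∫ ω in M.X 0 ⁻¹' s,
              (M.P[(U ⁻¹' t ∩ M.W 0 ⁻¹' {w}).indicator (fun _ => (1 : ℝ)) | M.sigmaX]) ω ∂M.P :=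
            (setIntegral_condExp hmle (hone (htU.inter (hWm w))) hsm).symm
        _ = ∫ ω in M.X 0 ⁻¹' s,
              (M.P[(fun ω => ew (M.X 0 ω)) * (U ⁻¹' t).indicator fun _ => (1 : ℝ) | M.sigmaX]) ω
                ∂M.P := by
            refine setIntegral_congr_ae hsX ?_
            filter_upwards [hci, hcond, hpull] with ω h1 h2 h3 _
            rw [h1, h2, h3, Pi.mul_apply, mul_comm]
        _ = ∫ ω in M.X 0 ⁻¹' s, ((fun ω => ew (M.X 0 ω)) *
              (U ⁻¹' t).indicator fun _ => (1 : ℝ)) ω ∂M.P := setIntegral_condExp hmle hmul hsm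
        _ = ∫ ω in M.X 0 ⁻¹' s, (U ⁻¹' t).indicator (fun ω => ew (M.X 0 ω)) ω ∂M.P := by
            refine integral_congr_ae (Eventually.of_forall fun ω => ?_)
            by_cases h : ω ∈ U ⁻¹' t <;> simp [h]
        _ = _ := by rw [setIntegral_indicator htU]
    rw [← ofReal_integral_eq_lintegral_ofReal hewi.integrableOn
      (Eventually.of_forall fun ω => hew0 _), ← hreal, ofReal_measureReal]
  have hL : ∫ r : Rec 𝒳 𝓑, (if r.2.2 = w then F (r.1, r.2.1) else 0) ∂M.lawRec = ∫ q, F q ∂ν₁ := by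
    rw [M.integral_lawRec, hν₁, integral_map hVm.aemeasurable hF.aestronglyMeasurable,
      ← integral_indicator (hWm w)]
    · refine integral_congr_ae (Eventually.of_forall fun ω => ?_)
      by_cases h : M.W 0 ω = w <;> simp [participant, h, hV, hU]
    · exact Measurable.ite ((measurable_snd.comp measurable_snd) (measurableSet_singleton w))
        (hF.comp (by fun_prop)) measurable_const
  have hR : ∫ r : Rec 𝒳 𝓑, F (r.1, r.2.1) * ew r.1 ∂M.lawRec = ∫ q, F q ∂ν₂ := by
    rw [M.integral_lawRec, hν₂, integral_map hVm.aemeasurable hF.aestronglyMeasurable,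
      integral_withDensity_eq_integral_toReal_smul]
    · refine integral_congr_ae (Eventually.of_forall fun ω => ?_)
      simp only [ENNReal.toReal_ofReal (hew0 _), smul_eq_mul, participant, hV, hU]
      ring
    · exact (hewm.comp (M.measurable_X 0)).ennreal_ofReal
    · exact Eventually.of_forall fun ω => ENNReal.ofReal_lt_top
    · exact (hF.comp (by fun_prop)).mul (hewm.comp measurable_fst)
  rw [hL, hν, ← hR]

/-- The defining property of versions of the conditional means. -/
lemma integral_mul_condMean {v : 𝓑 → ℝ} (hv : Measurable v) {K : ℝ} (hK : ∀ b, |v b| ≤ K) {w : Bool}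
    {μ : 𝒳 → ℝ} (hμm : Measurable μ) (hμ : (fun ω => μ (M.X 0 ω)) =ᵐ[M.P]
      M.P[fun ω => v (M.B w 0 ω) | MeasurableSpace.comap (M.X 0) inferInstance])
    {g : 𝒳 → ℝ} (hg : Measurable g) {c : ℝ} (hc : ∀ x, |g x| ≤ c) :
    ∫ r : Rec 𝒳 𝓑, g r.1 * v (r.pot w) ∂M.lawRec = ∫ r : Rec 𝒳 𝓑, g r.1 * μ r.1 ∂M.lawRec := by
  have := M.isProb
  have h1 : Measurable fun r : Rec 𝒳 𝓑 => g r.1 * v (r.pot w) :=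
    (hg.comp measurable_fst).mul (hv.comp (measurable_pot w))
  have h2 : Measurable fun r : Rec 𝒳 𝓑 => g r.1 * μ r.1 :=
    (hg.comp measurable_fst).mul (hμm.comp measurable_fst)
  rw [M.integral_lawRec h1, M.integral_lawRec h2]
  simp_rw [pot_participant]
  have hmle := M.sigmaX_le
  have hvi : Integrable (fun ω => v (M.B w 0 ω)) M.P :=
    Integrable.of_bound (hv.comp (M.measurable_B w 0)).aestronglyMeasurable K
      (Eventually.of_forall fun ω => hK _)
  have hgi : Integrable ((fun ω => g (M.X 0 ω)) * fun ω => v (M.B w 0 ω)) M.P :=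
    hvi.bdd_mul (c := c) (hg.comp (M.measurable_X 0)).aestronglyMeasurable
      (Eventually.of_forall fun ω => hc _)
  have hgm : AEStronglyMeasurable[M.sigmaX] (fun ω => g (M.X 0 ω)) M.P :=
    (hg.comp (comap_measurable (M.X 0))).aestronglyMeasurable
  have hpull := condExp_mul_of_aestronglyMeasurable_left (m := M.sigmaX) hgm hgi hvi
  calc _ = ∫ ω, (M.P[(fun ω => g (M.X 0 ω)) * fun ω => v (M.B w 0 ω) | M.sigmaX]) ω ∂M.P :=
        (integral_condExp hmle).symm
    _ = _ := by
        refine integral_congr_ae ?_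
        filter_upwards [hpull, hμ] with ω h1 h2
        rw [h1, Pi.mul_apply, ← h2]
        rfl

lemma ae_abs_condMean_le {v : 𝓑 → ℝ} {K : ℝ} (hK : ∀ b, |v b| ≤ K)
    {w : Bool} {μ : 𝒳 → ℝ} (hμm : Measurable μ) (hμ : (fun ω => μ (M.X 0 ω)) =ᵐ[M.P]
      M.P[fun ω => v (M.B w 0 ω) | MeasurableSpace.comap (M.X 0) inferInstance]) :
    ∀ᵐ r : Rec 𝒳 𝓑 ∂M.lawRec, |μ r.1| ≤ K := by
  have h := ae_bdd_abs_condExp_of_ae_bdd_abs (R := K)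
    (m := MeasurableSpace.comap (M.X 0) inferInstance) (μ := M.P)
    (f := fun ω => v (M.B w 0 ω)) (Eventually.of_forall fun ω => hK _)
  refine (ae_map_iff (M.measurable_participant 0).aemeasurable
    (measurableSet_le (hμm.comp measurable_fst).abs measurable_const)).mpr ?_
  filter_upwards [h, hμ] with ω h1 h2
  change |μ (M.X 0 ω)| ≤ K
  rw [h2]; exact h1

/-- The regularity conditions for a scalar response, from the conditions on the market. -/
lemma regularResponse {η : Nuisance 𝒳 J} (hη : M.IsTrueNuisance η)
    (hId : M.Identification η) {κ : ℝ} (hκ : 0 < κ) {e : 𝒳 → ℝ} (hem : Measurable e)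
    (heκ : ∀ x, e x ∈ Set.Icc κ (1 - κ)) (hee : ∀ᵐ r ∂M.lawRec, e r.1 = η.e r.1)
    (hS : MeasurableSet M.S) {p₀ : Vec J} {c₁ : ℝ} (hc₁ : 0 < c₁) (hball : Metric.ball p₀ c₁ ⊆ M.S)
    {v : 𝓑 → Vec J → ℝ} {μ : Bool → 𝒳 → Vec J → ℝ} (hv : Measurable fun q : 𝓑 × Vec J => v q.1 q.2)
    {K L C h c' : ℝ} (hK0 : 0 ≤ K) (hL0 : 0 ≤ L) (hC0 : 0 ≤ C) (hh0 : 0 ≤ h) (hc' : 0 ≤ c')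
    (hK : ∀ b, ∀ p ∈ M.S, |v b p| ≤ K) (hμm : ∀ w, ∀ p ∈ M.S, Measurable fun x => μ w x p)
    (hμ : ∀ w, ∀ p ∈ M.S, (fun ω => μ w (M.X 0 ω) p) =ᵐ[M.P]
      M.P[fun ω => v (M.B w 0 ω) p | MeasurableSpace.comap (M.X 0) inferInstance])
    (hlip : ∀ w x, ∀ p ∈ Metric.ball p₀ c₁, |μ w x p - μ w x p₀| ≤ c' * ‖p - p₀‖)
    (hL : ∀ w, ∀ p ∈ M.S, ∫ ω, (v (M.B w 0 ω) p - v (M.B w 0 ω) p₀) ^ 2 ∂M.P ≤ L * ‖p - p₀‖)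
    (hcov : PolynomialCovering ((fun p b => v b p) '' M.S) C h) :
    RegularResponse M.lawRec M.S p₀ e v μ κ K (L + c' + 2 * K / c₁) C h := by
  have hp₀ : p₀ ∈ M.S := hball (Metric.mem_ball_self hc₁)
  have hvp : ∀ p, Measurable fun b => v b p := fun p =>
    hv.comp (measurable_id.prodMk measurable_const)
  have hq : 0 ≤ 2 * K / c₁ := by positivity
  have hmb : ∀ w, ∀ p ∈ M.S, ∀ᵐ r : Rec 𝒳 𝓑 ∂M.lawRec, |μ w r.1 p| ≤ K := fun w p hp =>
    M.ae_abs_condMean_le (fun b => hK b p hp) (hμm w p hp) (hμ w p hp)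
  refine ⟨hκ, hK0, by positivity, hC0, hh0, hS, hp₀, hv, hK, hem, heκ, ?_, hμm, ?_, hmb, ?_, ?_,
    hcov⟩
  · intro w F hF
    rw [M.integral_indicator_arm hη hId w hF]
    refine integral_congr_ae ?_
    filter_upwards [hee] with r hr
    rw [hr]
  · rintro w p hp g hg ⟨c, hc⟩
    exact M.integral_mul_condMean (hvp p) (fun b => hK b p hp) (hμm w p hp) (hμ w p hp) hg hc
  · intro w p hp
    filter_upwards [hmb w p hp, hmb w p₀ hp₀] with r h1 h2
    -- Smoothness gives the Lipschitz bound in the ball only. Outside it ‖p - p₀‖ ≥ c₁, and the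
    -- crude bound 2K is absorbed by the term 2K/c₁ of the constant.
    by_cases hpb : p ∈ Metric.ball p₀ c₁
    · refine (hlip w r.1 p hpb).trans ?_
      gcongr; linarith
    · rw [Metric.mem_ball, not_lt, dist_eq_norm] at hpb
      calc |μ w r.1 p - μ w r.1 p₀| ≤ 2 * K := (abs_sub _ _).trans (by linarith)
        _ = 2 * K / c₁ * c₁ := by field_simp
        _ ≤ (L + c' + 2 * K / c₁) * ‖p - p₀‖ := by gcongr; linarith
  · intro w p hp
    rw [M.integral_lawRec]
    · simp_rw [pot_participant]
      refine (hL w p hp).trans ?_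
      gcongr; linarith
    · exact (((hvp p).comp (measurable_pot w)).sub ((hvp p₀).comp (measurable_pot w))).pow_const 2

end Model

/-! ### The estimators as functions of the seed and of the sample -/

/-- The size of a training sample is part of its type. A training set is one of finitely many
subsets, so measurability of a fit is checked on each fiber, where the size is constant. -/
lemma measurable_of_countable_fibers {α β γ : Type*} [MeasurableSpace α] [MeasurableSpace β]
    [Countable γ] {g : α → γ} (hg : ∀ c, MeasurableSet {a | g a = c}) {Φ : γ → α → β}
    (hΦ : ∀ c, Measurable (Φ c)) : Measurable fun a => Φ (g a) a := by
  intro s hs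
  have : (fun a => Φ (g a) a) ⁻¹' s = ⋃ c, {a | g a = c} ∩ Φ c ⁻¹' s := by
    ext a; simp
  rw [this]
  exact MeasurableSet.iUnion fun c => (hg c).inter (hΦ c hs)

lemma measurable_subsample {α β : Type*} [MeasurableSpace α] [MeasurableSpace β] {n : ℕ}
    (s : Finset (Fin n)) {f : α → Fin n → β} (hf : ∀ i, Measurable fun a => f a i) :
    Measurable fun a => subsample s (f a) :=
  measurable_pi_lambda _ fun _ => hf _

lemma subsample_congr {β : Type*} {n : ℕ} {s : Finset (Fin n)} {f g : Fin n → β}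
    (h : ∀ i ∈ s, f i = g i) : subsample s f = subsample s g :=
  funext fun _ => h _ (Finset.orderEmbOfFin_mem s rfl _)

namespace Study

variable {Ω 𝒳 𝓑 Z : Type*} [MeasurableSpace Ω] [MeasurableSpace 𝒳] [MeasurableSpace 𝓑]
  [MeasurableSpace Z] {J : ℕ} (T : Study Ω 𝒳 𝓑 Z J)

/-- The records of the first `n` participants. -/
def sample (n : ℕ) (ω : Ω) : Fin n → Rec 𝒳 𝓑 := fun i => T.participant i ω

/-- The indices in fold `k`. -/
def recI (k : Fin 3) (n : ℕ) (z : Z) : Finset (Fin n) := {i | T.fold n z i = k}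

/-- Here and below the estimators are repeated with the seed and the array of records as arguments,
so that cross-fitting becomes a statement about coordinates and the law becomes a product. -/
def recH (n : ℕ) (k : Fin 3) (z : Z) : Finset (Fin n) :=
  {i | T.fold n z i ≠ k ∧ T.inH n z k i = true}

def recG (n : ℕ) (k : Fin 3) (z : Z) : Finset (Fin n) :=
  {i | T.fold n z i ≠ k ∧ T.inH n z k i = false}

def recETilde (n : ℕ) (k : Fin 3) (z : Z) (u : Fin n → Rec 𝒳 𝓑) (x : 𝒳) : ℝ :=
  T.propensity₀ n k _ z (subsample (T.recH n k z) fun i => ((u i).1, (u i).2.2)) x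

def recPTilde (π : 𝒳 → ℝ) (n : ℕ) (k : Fin 3) (z : Z) (u : Fin n → Rec 𝒳 𝓑) : Vec J :=
  T.m (T.recH n k z).card (subsample (T.recH n k z) fun i => (u i).obs)
    (subsample (T.recH n k z) fun i => ∑ w, armProb π w (u i).1 *
      (ipw w (u i).2.2 (T.recETilde n k z u (u i).1) / ((T.recH n k z).card : ℝ))) T.sStar

def recEHat (n : ℕ) (k : Fin 3) (z : Z) (u : Fin n → Rec 𝒳 𝓑) (x : 𝒳) : ℝ :=
  T.propensity n k _ z (subsample (T.recG n k z) fun i => ((u i).1, (u i).2.2)) x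

def recMuY (π : 𝒳 → ℝ) (n : ℕ) (k : Fin 3) (z : Z) (u : Fin n → Rec 𝒳 𝓑) (w : Bool) (x : 𝒳) : ℝ :=
  T.regressY n k _ z (subsample (T.recG n k z)
    fun i => ((u i).1, (u i).2.2, T.y (u i).obs (T.recPTilde π n k z u))) w x

def recMuD (π : 𝒳 → ℝ) (n : ℕ) (k : Fin 3) (z : Z) (u : Fin n → Rec 𝒳 𝓑) (w : Bool) (x : 𝒳) :
    Vec J :=
  T.regressD n k _ z (subsample (T.recG n k z)
    fun i => ((u i).1, (u i).2.2, T.d (u i).obs (T.recPTilde π n k z u))) w x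

def recPHat (π : 𝒳 → ℝ) (n : ℕ) (q : Z × (Fin n → Rec 𝒳 𝓑)) : Vec J :=
  T.m n (fun i => (q.2 i).obs)
    (fun i => ∑ w, armProb π w (q.2 i).1 *
      (ipw w (q.2 i).2.2 (T.recEHat n (T.fold n q.1 i) q.1 q.2 (q.2 i).1) / (n : ℝ)))
    (T.sStar + (n : ℝ)⁻¹ • ∑ i : Fin n, ∑ w,
      ((ipw w (q.2 i).2.2 (T.recEHat n (T.fold n q.1 i) q.1 q.2 (q.2 i).1) - 1)
        * armProb π w (q.2 i).1) • T.recMuD π n (T.fold n q.1 i) q.1 q.2 w (q.2 i).1)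

/-! #### Agreement with the estimators on the sample space -/

lemma eHat_eq (n : ℕ) (k : Fin 3) (ω : Ω) :
    T.eHat n k ω = T.recEHat n k (T.seed ω) (T.sample n ω) := rfl

lemma pTilde_eq (π : 𝒳 → ℝ) (n : ℕ) (k : Fin 3) (ω : Ω) :
    T.pTilde π n k ω = T.recPTilde π n k (T.seed ω) (T.sample n ω) := by
  simp only [recPTilde, sample, Model.obs_participant]; rfl

lemma muYHat_eq (π : 𝒳 → ℝ) (n : ℕ) (k : Fin 3) (ω : Ω) :
    T.muYHat π n k ω = T.recMuY π n k (T.seed ω) (T.sample n ω) := by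
  funext w x
  simp only [recMuY, ← pTilde_eq]
  simp only [sample, Model.obs_participant]; rfl

lemma muDHat_eq (π : 𝒳 → ℝ) (n : ℕ) (k : Fin 3) (ω : Ω) :
    T.muDHat π n k ω = T.recMuD π n k (T.seed ω) (T.sample n ω) := by
  funext w x
  simp only [recMuD, ← pTilde_eq]
  simp only [sample, Model.obs_participant]; rfl

lemma pHat_eq (π : 𝒳 → ℝ) (n : ℕ) (ω : Ω) :
    T.pHat π n ω = T.recPHat π n (T.seed ω, T.sample n ω) := by
  simp only [recPHat, ← muDHat_eq, ← eHat_eq]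
  simp only [sample, Model.obs_participant]; rfl

/-! #### Dependence on the sample outside of the fold -/

lemma fold_of_mem_recH {n : ℕ} {k : Fin 3} {z : Z} {i : Fin n} (h : i ∈ T.recH n k z) :
    i ∉ T.recI k n z := by
  simp only [recH, recI, Finset.mem_filter, Finset.mem_univ, true_and] at *
  exact h.1

lemma fold_of_mem_recG {n : ℕ} {k : Fin 3} {z : Z} {i : Fin n} (h : i ∈ T.recG n k z) :
    i ∉ T.recI k n z := by
  simp only [recG, recI, Finset.mem_filter, Finset.mem_univ, true_and] at *
  exact h.1

lemma indep_recETilde (n : ℕ) (k : Fin 3) (z : Z) :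
    IndepOfCoords (T.recI k n z) (T.recETilde n k z) := by
  intro u u' huu
  funext x
  unfold recETilde
  rw [subsample_congr fun i hi => by rw [huu i (T.fold_of_mem_recH hi)]]

lemma indep_recPTilde (π : 𝒳 → ℝ) (n : ℕ) (k : Fin 3) (z : Z) :
    IndepOfCoords (T.recI k n z) (T.recPTilde π n k z) := by
  intro u u' huu
  unfold recPTilde
  rw [T.indep_recETilde n k z u u' huu,
    subsample_congr fun i hi => show (u i).obs = (u' i).obs by rw [huu i (T.fold_of_mem_recH hi)]]
  congr 1
  exact subsample_congr fun i hi => by rw [huu i (T.fold_of_mem_recH hi)]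

lemma indep_recEHat (n : ℕ) (k : Fin 3) (z : Z) :
    IndepOfCoords (T.recI k n z) (T.recEHat n k z) := by
  intro u u' huu
  funext x
  unfold recEHat
  rw [subsample_congr fun i hi => by rw [huu i (T.fold_of_mem_recG hi)]]

/-- A regression localized at the first-step cutoffs is still a fit from outside the fold, because
these cutoffs do not use the fold either. -/
lemma indep_recMuY (π : 𝒳 → ℝ) (n : ℕ) (k : Fin 3) (z : Z) :
    IndepOfCoords (T.recI k n z) (T.recMuY π n k z) := by
  intro u u' huu
  funext w x
  unfold recMuY
  rw [T.indep_recPTilde π n k z u u' huu,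
    subsample_congr fun i hi => by rw [huu i (T.fold_of_mem_recG hi)]]

lemma indep_recMuD (π : 𝒳 → ℝ) (n : ℕ) (k : Fin 3) (z : Z) :
    IndepOfCoords (T.recI k n z) (T.recMuD π n k z) := by
  intro u u' huu
  funext w x
  unfold recMuD
  rw [T.indep_recPTilde π n k z u u' huu,
    subsample_congr fun i hi => by rw [huu i (T.fold_of_mem_recG hi)]]

/-! #### Measurability -/

lemma measurableSet_fold_eq (n : ℕ) (i : Fin n) (k : Fin 3) :
    MeasurableSet {z | T.fold n z i = k} :=
  ((measurable_pi_apply i).comp (T.measurable_fold n)) (measurableSet_singleton k)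

lemma measurableSet_mem_recI (k : Fin 3) (n : ℕ) (i : Fin n) :
    MeasurableSet {z | i ∈ T.recI k n z} := by
  simpa [recI] using T.measurableSet_fold_eq n i k

lemma measurableSet_split_eq (n : ℕ) (F : (Fin n → Fin 3) → (Fin 3 → Fin n → Bool) →
    Finset (Fin n)) (s : Finset (Fin n)) :
    MeasurableSet {z | F (T.fold n z) (T.inH n z) = s} := by
  have h : Measurable fun z => (T.fold n z, T.inH n z) :=
    (T.measurable_fold n).prodMk (T.measurable_inH n)
  exact h (Set.to_countable {q : (Fin n → Fin 3) × (Fin 3 → Fin n → Bool) |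
    F q.1 q.2 = s}).measurableSet

lemma measurableSet_recH_eq (n : ℕ) (k : Fin 3) (s : Finset (Fin n)) :
    MeasurableSet {z | T.recH n k z = s} :=
  T.measurableSet_split_eq n (fun f g => {i | f i ≠ k ∧ g k i = true}) s

lemma measurableSet_recG_eq (n : ℕ) (k : Fin 3) (s : Finset (Fin n)) :
    MeasurableSet {z | T.recG n k z = s} :=
  T.measurableSet_split_eq n (fun f g => {i | f i ≠ k ∧ g k i = false}) s

variable {α : Type*} [MeasurableSpace α] {n : ℕ} {z : α → Z} {u : α → Fin n → Rec 𝒳 𝓑} {x : α → 𝒳}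

lemma measurable_covariate_arm (hu : Measurable u) (i : Fin n) :
    Measurable fun a => ((u a i).1, (u a i).2.2) :=
  (measurable_fst.prodMk (measurable_snd.comp measurable_snd)).comp
    ((measurable_pi_apply i).comp hu)

lemma measurable_recETilde (k : Fin 3) (hz : Measurable z) (hu : Measurable u)
    (hx : Measurable x) : Measurable fun a => T.recETilde n k (z a) (u a) (x a) :=
  measurable_of_countable_fibers (g := fun a => T.recH n k (z a))
    (Φ := fun s a => T.propensity₀ n k _ (z a)
      (subsample s fun i => ((u a i).1, (u a i).2.2)) (x a))
    (fun s => hz (T.measurableSet_recH_eq n k s))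
    (fun s => (T.measurable_propensity₀ n k s.card).comp (hz.prodMk
      ((measurable_subsample s (measurable_covariate_arm hu)).prodMk hx)))

lemma measurable_recEHat (k : Fin 3) (hz : Measurable z) (hu : Measurable u)
    (hx : Measurable x) : Measurable fun a => T.recEHat n k (z a) (u a) (x a) :=
  measurable_of_countable_fibers (g := fun a => T.recG n k (z a))
    (Φ := fun s a => T.propensity n k _ (z a)
      (subsample s fun i => ((u a i).1, (u a i).2.2)) (x a))
    (fun s => hz (T.measurableSet_recG_eq n k s))
    (fun s => (T.measurable_propensity n k s.card).comp (hz.prodMk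
      ((measurable_subsample s (measurable_covariate_arm hu)).prodMk hx)))

lemma measurable_recPTilde {π : 𝒳 → ℝ} (hπ : Measurable π) (k : Fin 3) (hz : Measurable z)
    (hu : Measurable u) : Measurable fun a => T.recPTilde π n k (z a) (u a) := by
  have hui : ∀ i, Measurable fun a => u a i := fun i => (measurable_pi_apply i).comp hu
  refine measurable_of_countable_fibers (g := fun a => T.recH n k (z a))
    (Φ := fun s a => T.m s.card (subsample s fun i => (u a i).obs)
      (subsample s fun i => ∑ w, armProb π w (u a i).1 *
        (ipw w (u a i).2.2 (T.recETilde n k (z a) (u a) (u a i).1) / (s.card : ℝ))) T.sStar)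
    (fun s => hz (T.measurableSet_recH_eq n k s)) (fun s => ?_)
  have h1 : Measurable fun a => subsample s fun i => (u a i).obs :=
    measurable_subsample s fun i => measurable_obs.comp (hui i)
  have h2 : ∀ i, Measurable fun a => ∑ w, armProb π w (u a i).1 *
      (ipw w (u a i).2.2 (T.recETilde n k (z a) (u a) (u a i).1) / (s.card : ℝ)) := fun i =>
    Finset.measurable_sum _ fun w _ =>
      ((measurable_armProb hπ w).comp (measurable_fst.comp (hui i))).mul
        ((measurable_ipw w ((measurable_snd.comp measurable_snd).comp (hui i))
          (T.measurable_recETilde k hz hu (measurable_fst.comp (hui i)))).div_const _)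
  have h3 : Measurable fun a => subsample s fun i => ∑ w, armProb π w (u a i).1 *
      (ipw w (u a i).2.2 (T.recETilde n k (z a) (u a) (u a i).1) / (s.card : ℝ)) :=
    measurable_subsample s h2
  exact (T.measurable_m s.card).comp (h1.prodMk (h3.prodMk measurable_const))

lemma measurable_recMuY {π : 𝒳 → ℝ} (hπ : Measurable π) (k : Fin 3) (w : Bool) (hz : Measurable z)
    (hu : Measurable u) (hx : Measurable x) :
    Measurable fun a => T.recMuY π n k (z a) (u a) w (x a) := by
  have hui : ∀ i, Measurable fun a => u a i := fun i => (measurable_pi_apply i).comp hu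
  refine measurable_of_countable_fibers (g := fun a => T.recG n k (z a))
    (Φ := fun s a => T.regressY n k _ (z a) (subsample s fun i =>
      ((u a i).1, (u a i).2.2, T.y (u a i).obs (T.recPTilde π n k (z a) (u a)))) w (x a))
    (fun s => hz (T.measurableSet_recG_eq n k s)) (fun s => ?_)
  have h1 : ∀ i, Measurable fun a =>
      ((u a i).1, (u a i).2.2, T.y (u a i).obs (T.recPTilde π n k (z a) (u a))) := fun i =>
    (measurable_fst.comp (hui i)).prodMk (((measurable_snd.comp measurable_snd).comp
      (hui i)).prodMk (T.measurable_y.comp ((measurable_obs.comp (hui i)).prodMk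
        (T.measurable_recPTilde hπ k hz hu))))
  exact (T.measurable_regressY n k s.card w).comp
    (hz.prodMk ((measurable_subsample s h1).prodMk hx))

lemma measurable_recMuD {π : 𝒳 → ℝ} (hπ : Measurable π) (k : Fin 3) (w : Bool) (hz : Measurable z)
    (hu : Measurable u) (hx : Measurable x) :
    Measurable fun a => T.recMuD π n k (z a) (u a) w (x a) := by
  have hui : ∀ i, Measurable fun a => u a i := fun i => (measurable_pi_apply i).comp hu
  refine measurable_of_countable_fibers (g := fun a => T.recG n k (z a))
    (Φ := fun s a => T.regressD n k _ (z a) (subsample s fun i =>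
      ((u a i).1, (u a i).2.2, T.d (u a i).obs (T.recPTilde π n k (z a) (u a)))) w (x a))
    (fun s => hz (T.measurableSet_recG_eq n k s)) (fun s => ?_)
  have h1 : ∀ i, Measurable fun a =>
      ((u a i).1, (u a i).2.2, T.d (u a i).obs (T.recPTilde π n k (z a) (u a))) := fun i =>
    (measurable_fst.comp (hui i)).prodMk (((measurable_snd.comp measurable_snd).comp
      (hui i)).prodMk (T.measurable_d.comp ((measurable_obs.comp (hui i)).prodMk
        (T.measurable_recPTilde hπ k hz hu))))
  exact (T.measurable_regressD n k s.card w).comp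
    (hz.prodMk ((measurable_subsample s h1).prodMk hx))

/-- These cutoffs use the full sample, so no independence from a fold is available; measurability is
all that the maximal inequality asks of them. -/
lemma measurable_recPHat {π : 𝒳 → ℝ} (hπ : Measurable π) (n : ℕ) :
    Measurable (T.recPHat π n) := by
  have hui : ∀ i, Measurable fun q : Z × (Fin n → Rec 𝒳 𝓑) => q.2 i := fun i =>
    (measurable_pi_apply i).comp measurable_snd
  have harm : ∀ i w, Measurable fun q : Z × (Fin n → Rec 𝒳 𝓑) => armProb π w (q.2 i).1 :=
    fun i w => (measurable_armProb hπ w).comp (measurable_fst.comp (hui i))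
  have hfold : ∀ i k, MeasurableSet {q : Z × (Fin n → Rec 𝒳 𝓑) | T.fold n q.1 i = k} :=
    fun i k => measurable_fst (T.measurableSet_fold_eq n i k)
  have hipw : ∀ i w, Measurable fun q : Z × (Fin n → Rec 𝒳 𝓑) =>
      ipw w (q.2 i).2.2 (T.recEHat n (T.fold n q.1 i) q.1 q.2 (q.2 i).1) := fun i w =>
    measurable_ipw w ((measurable_snd.comp measurable_snd).comp (hui i))
      (measurable_of_countable_fibers (g := fun q : Z × (Fin n → Rec 𝒳 𝓑) => T.fold n q.1 i)
        (Φ := fun k q => T.recEHat n k q.1 q.2 (q.2 i).1) (hfold i) fun k =>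
        T.measurable_recEHat k measurable_fst measurable_snd (measurable_fst.comp (hui i)))
  have hmu : ∀ i w, Measurable fun q : Z × (Fin n → Rec 𝒳 𝓑) =>
      T.recMuD π n (T.fold n q.1 i) q.1 q.2 w (q.2 i).1 := fun i w =>
    measurable_of_countable_fibers (g := fun q : Z × (Fin n → Rec 𝒳 𝓑) => T.fold n q.1 i)
      (Φ := fun k q => T.recMuD π n k q.1 q.2 w (q.2 i).1) (hfold i) fun k =>
      T.measurable_recMuD hπ k w measurable_fst measurable_snd (measurable_fst.comp (hui i))
  have h1 : Measurable fun (q : Z × (Fin n → Rec 𝒳 𝓑)) i => (q.2 i).obs :=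
    measurable_pi_lambda _ fun i => measurable_obs.comp (hui i)
  have h2 : Measurable fun (q : Z × (Fin n → Rec 𝒳 𝓑)) i => ∑ w, armProb π w (q.2 i).1 *
      (ipw w (q.2 i).2.2 (T.recEHat n (T.fold n q.1 i) q.1 q.2 (q.2 i).1) / (n : ℝ)) :=
    measurable_pi_lambda _ fun i => Finset.measurable_sum _ fun w _ =>
      (harm i w).mul ((hipw i w).div_const _)
  have h3 : Measurable fun q : Z × (Fin n → Rec 𝒳 𝓑) => ∑ i : Fin n, ∑ w,
      ((ipw w (q.2 i).2.2 (T.recEHat n (T.fold n q.1 i) q.1 q.2 (q.2 i).1) - 1)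
        * armProb π w (q.2 i).1) • T.recMuD π n (T.fold n q.1 i) q.1 q.2 w (q.2 i).1 :=
    Finset.measurable_sum _ fun i _ => Finset.measurable_sum _ fun w _ =>
      (((hipw i w).sub_const 1).mul (harm i w)).smul (hmu i w)
  exact (T.measurable_m n).comp (h1.prodMk (h2.prodMk ((h3.const_smul ((n : ℝ)⁻¹)).const_add T.sStar)))

/-! #### The law of the seed and of the sample -/

lemma measurable_sample (n : ℕ) : Measurable (T.sample n) :=
  measurable_pi_lambda _ fun i => T.measurable_participant i

/-- The seed is independent of the whole sequence of participants. Fixing it fixes the folds and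
leaves the records i.i.d. -/
lemma map_seed_sample {η : Nuisance 𝒳 J} (hId : T.Identification η) (n : ℕ) :
    T.P.map (fun ω => (T.seed ω, T.sample n ω))
      = (T.P.map T.seed).prod (Measure.pi fun _ : Fin n => T.lawRec) := by
  have := T.isProb
  have hind : IndepFun T.seed (T.sample n) T.P :=
    T.seed_indep.comp (φ := id) (ψ := fun (f : ℕ → Rec 𝒳 𝓑) (i : Fin n) => f i) measurable_id
      (measurable_pi_lambda _ fun i => measurable_pi_apply _)
  rw [(indepFun_iff_map_prod_eq_prod_map_map T.measurable_seed.aemeasurable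
    (T.measurable_sample n).aemeasurable).mp hind]
  congr 1
  have h2 : iIndepFun (fun i : Fin n => T.participant i) T.P :=
    hId.indep.precomp Fin.val_injective
  have h3 := (iIndepFun_iff_map_fun_eq_pi_map
    fun i : Fin n => (T.measurable_participant i).aemeasurable).mp h2
  refine h3.trans ?_
  congr 1
  funext i
  exact (hId.identDistrib i).map_eq

end Study

/-! ### Events of probability tending to one -/

/-- The probability of `E n` tends to one. -/
def HighProb {Ω : Type*} [MeasurableSpace Ω] (P : Measure Ω) (E : ℕ → Set Ω) : Prop :=
  Tendsto (fun n => P (E n)ᶜ) atTop (𝓝 0)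

namespace HighProb

variable {Ω : Type*} [MeasurableSpace Ω] {P : Measure Ω} {E F : ℕ → Set Ω}

lemma mono (hE : HighProb P E) (h : ∀ᶠ n in atTop, E n ⊆ F n) : HighProb P F :=
  tendsto_of_tendsto_of_tendsto_of_le_of_le' tendsto_const_nhds hE
    (Eventually.of_forall fun _ => zero_le)
    (h.mono fun _ hn => measure_mono (Set.compl_subset_compl.mpr hn))

lemma inter (hE : HighProb P E) (hF : HighProb P F) : HighProb P fun n => E n ∩ F n := by
  have h := Tendsto.add hE hF
  rw [add_zero] at h
  refine tendsto_of_tendsto_of_tendsto_of_le_of_le tendsto_const_nhds h (fun _ => zero_le)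
    fun n => ?_
  simp only [Set.compl_inter]
  exact measure_union_le _ _

lemma of_ae (h : ∀ n, ∀ᵐ ω ∂P, ω ∈ E n) : HighProb P E := by
  have : (fun n => P (E n)ᶜ) = fun _ => 0 := funext fun n => h n
  unfold HighProb
  rw [this]
  exact tendsto_const_nhds

lemma iInter {ι : Type*} [Fintype ι] {E : ι → ℕ → Set Ω} (h : ∀ k, HighProb P (E k)) :
    HighProb P fun n => ⋂ k, E k n := by
  have hs : Tendsto (fun n => ∑ k, P (E k n)ᶜ) atTop (𝓝 0) := by
    have := tendsto_finsetSum Finset.univ fun k _ => h k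
    simpa using this
  refine tendsto_of_tendsto_of_tendsto_of_le_of_le tendsto_const_nhds hs (fun _ => zero_le)
    fun n => ?_
  simp only [Set.compl_iInter]
  exact measure_iUnion_fintype_le _ _

/-- One sample point in the event is enough to derive an inequality between deterministic
quantities. -/
lemma nonempty [IsProbabilityMeasure P] (h : HighProb P E) : ∀ᶠ n in atTop, (E n).Nonempty := by
  filter_upwards [h.eventually_lt_const (zero_lt_one)] with n hn
  by_contra hE
  rw [Set.not_nonempty_iff_eq_empty] at hE
  simp [hE] at hn

end HighProb

/-! ### Truncated propensity scores -/

/-- The projection onto `[κ, 1 - κ]`. -/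
def clip (κ a : ℝ) : ℝ := max (min a (1 - κ)) κ

lemma measurable_clip (κ : ℝ) : Measurable (clip κ) :=
  (measurable_id.min measurable_const).max measurable_const

lemma clip_mem {κ : ℝ} (hκ : κ ≤ 1 - κ) (a : ℝ) : clip κ a ∈ Set.Icc κ (1 - κ) :=
  ⟨le_max_right _ _, max_le (min_le_right _ _) hκ⟩

lemma clip_eq {κ a : ℝ} (h : a ∈ Set.Icc κ (1 - κ)) : clip κ a = a := by
  rw [clip, min_eq_left h.2, max_eq_left h.1]

lemma abs_clip_sub_clip_le (κ a b : ℝ) : |clip κ a - clip κ b| ≤ |a - b| :=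
  (abs_max_sub_max_le_abs _ _ _).trans (by
    simpa using abs_min_sub_min_le_max a (1 - κ) b (1 - κ))

/-- The projection is the point of the interval nearest to a. -/
lemma abs_sub_clip_le {κ a b : ℝ} (hb : b ∈ Set.Icc κ (1 - κ)) : |a - clip κ a| ≤ |b - a| := by
  obtain ⟨h1, h2⟩ := hb
  unfold clip
  rcases le_total a κ with h | h
  · rw [min_eq_left (by linarith), max_eq_right h, abs_of_nonpos (by linarith),
      abs_of_nonneg (by linarith)]
    linarith
  · rcases le_total a (1 - κ) with h' | h'
    · rw [min_eq_left h', max_eq_left h]; simp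
    · rw [min_eq_right h', max_eq_left (by linarith), abs_of_nonneg (by linarith),
        abs_of_nonpos (by linarith)]
      linarith

namespace Study

variable {Ω 𝒳 𝓑 Z : Type*} [MeasurableSpace Ω] [MeasurableSpace 𝒳] [MeasurableSpace 𝓑]
  [MeasurableSpace Z] {J : ℕ} (T : Study Ω 𝒳 𝓑 Z J)

/-- The estimated propensity scores, truncated to `[κ, 1 - κ]`. -/
def clippedEHat (κ : ℝ) (k : Fin 3) (n : ℕ) (z : Z) (u : Fin n → Rec 𝒳 𝓑) (x : 𝒳) : ℝ :=
  clip κ (T.recEHat n k z u x)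

lemma isCrossFit {κ : ℝ} (hκ : κ ≤ 1 - κ) (k : Fin 3) :
    IsCrossFit (T.recI k) (T.clippedEHat κ k) κ where
  measurableSet_mem := T.measurableSet_mem_recI k
  measurable_eh n := (measurable_clip κ).comp (T.measurable_recEHat k
    (measurable_fst.comp measurable_fst) (measurable_snd.comp measurable_fst) measurable_snd)
  indep n z u u' h := by
    funext x
    simp only [clippedEHat, T.indep_recEHat n k z u u' h]
  mem n z u x := clip_mem hκ _

lemma isProbabilityMeasure_seed : IsProbabilityMeasure (T.P.map T.seed) :=
  have := T.isProb
  Measure.isProbabilityMeasure_map T.measurable_seed.aemeasurable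

lemma measurable_seed_sample (n : ℕ) : Measurable fun ω => (T.seed ω, T.sample n ω) :=
  T.measurable_seed.prodMk (T.measurable_sample n)

/-- Events about the seed and the sample may be studied under the product law. -/
lemma highProb_of_prod {η : Nuisance 𝒳 J} (hId : T.Identification η)
    {E : (n : ℕ) → Set (Z × (Fin n → Rec 𝒳 𝓑))}
    (h : Tendsto (fun n : ℕ => ((T.P.map T.seed).prod (Measure.pi fun _ : Fin n => T.lawRec)) (E n))
      atTop (𝓝 0)) : HighProb T.P fun n => {ω | (T.seed ω, T.sample n ω) ∉ E n} := by
  refine tendsto_of_tendsto_of_tendsto_of_le_of_le tendsto_const_nhds h (fun _ => zero_le)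
    fun n => ?_
  simp only [← T.map_seed_sample hId n]
  have hc : {ω | (T.seed ω, T.sample n ω) ∉ E n}ᶜ = (fun ω => (T.seed ω, T.sample n ω)) ⁻¹' E n := by
    ext ω; simp
  rw [hc]
  -- Only this inequality of outer measures is needed, so E n need not be measurable.
  exact Measure.le_map_apply (T.measurable_seed_sample n).aemeasurable _

/-- At all sample points, the estimated propensity scores are bounded away from zero and one. -/
lemma ae_eHat_mem {η : Nuisance 𝒳 J} (hId : T.Identification η) {κ : ℝ} (n : ℕ)
    (h : ∀ k, ∀ᵐ ω ∂T.P, ∀ᵐ x ∂T.lawX, T.eHat n k ω x ∈ Set.Ioo κ (1 - κ)) :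
    ∀ᵐ ω ∂T.P, ∀ i : Fin n, T.eHat n (T.foldOf n ω i) ω (T.X i ω) ∈ Set.Ioo κ (1 - κ) := by
  have := T.isProb
  have := T.isProbabilityMeasure_lawRec
  have := T.isProbabilityMeasure_seed
  have hk : ∀ k, ∀ᵐ ω ∂T.P, ∀ i ∈ T.recI k n (T.seed ω),
      T.eHat n k ω (T.X i ω) ∈ Set.Ioo κ (1 - κ) := by
    intro k
    set B : Set ((Z × (Fin n → Rec 𝒳 𝓑)) × Rec 𝒳 𝓑) :=
      {q | T.recEHat n k q.1.1 q.1.2 q.2.1 ∉ Set.Ioo κ (1 - κ)} with hB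
    have hBm : MeasurableSet B := by
      have hf : Measurable fun q : (Z × (Fin n → Rec 𝒳 𝓑)) × Rec 𝒳 𝓑 =>
          T.recEHat n k q.1.1 q.1.2 q.2.1 :=
        T.measurable_recEHat k (measurable_fst.comp measurable_fst)
          (measurable_snd.comp measurable_fst) (measurable_fst.comp measurable_snd)
      exact (hf measurableSet_Ioo).compl
    -- A collects the data whose fitted score is within bounds at almost every independent record.
    -- By cross-fitting, a violation at a point of the fold is then a null event.
    set A : Set (Z × (Fin n → Rec 𝒳 𝓑)) := {q | T.lawRec (Prod.mk q ⁻¹' B) = 0} with hA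
    have hAm : MeasurableSet A := measurable_measure_prodMk_left hBm (measurableSet_singleton 0)
    set E : Set (Z × (Fin n → Rec 𝒳 𝓑)) :=
      {q | q ∈ A ∧ ∃ i ∈ T.recI k n q.1, (q, q.2 i) ∈ B} with hE
    have hEm : MeasurableSet E := by
      have : E = A ∩ ⋃ i, {q | i ∈ T.recI k n q.1} ∩ (fun q => (q, q.2 i)) ⁻¹' B := by
        ext q; simp [hE]
      rw [this]
      exact hAm.inter (MeasurableSet.iUnion fun i =>
        (measurable_fst (T.measurableSet_mem_recI k n i)).inter
        ((measurable_id.prodMk ((measurable_pi_apply i).comp measurable_snd)) hBm))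
    have hE0 : ((T.P.map T.seed).prod (Measure.pi fun _ : Fin n => T.lawRec)) E = 0 := by
      refine le_antisymm (prod_apply_le_of_section_le hEm fun z => ?_) zero_le
      refine le_of_eq (pi_crossfit_ae T.lawRec (T.recI k n z)
        (N := {q | ((z, q.1), q.2) ∈ B}) (G := {u | (z, u) ∈ A}) ?_ ?_ ?_ ?_ ?_)
      · exact ((measurable_const.prodMk measurable_fst).prodMk measurable_snd) hBm
      · intro u u' huu
        funext r
        simp only [hB, Set.mem_ofPred_eq, T.indep_recEHat n k z u u' huu]
      · exact (measurable_const.prodMk measurable_id) hAm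
      · intro u u' huu
        simp only [hA, hB, Set.mem_ofPred_eq, Set.preimage_ofPred_eq,
          T.indep_recEHat n k z u u' huu]
      · intro u hu; exact hu
    have hE1 : ∀ᵐ ω ∂T.P, (T.seed ω, T.sample n ω) ∉ E := by
      have h1 : ∀ᵐ q ∂(T.P.map fun ω => (T.seed ω, T.sample n ω)), q ∉ E := by
        rw [T.map_seed_sample hId n]
        exact measure_eq_zero_iff_ae_notMem.mp hE0
      exact ae_of_ae_map (T.measurable_seed_sample n).aemeasurable h1
    filter_upwards [hE1, h k] with ω h1 h2 i hi
    by_contra hcon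
    refine h1 ⟨?_, i, hi, hcon⟩
    have h3 : ∀ᵐ r ∂T.lawRec, T.eHat n k ω r.1 ∈ Set.Ioo κ (1 - κ) := by
      rw [← T.map_fst_lawRec] at h2
      exact ae_of_ae_map measurable_fst.aemeasurable h2
    exact h3
  filter_upwards [ae_all_iff.mpr hk] with ω hω i
  exact hω _ i (Finset.mem_filter.mpr ⟨Finset.mem_univ _, rfl⟩)

end Study

/-! ### Expansion of the summed scores at the estimated cutoffs -/

namespace Study

variable {Ω 𝒳 𝓑 Z : Type*} [MeasurableSpace Ω] [MeasurableSpace 𝒳] [MeasurableSpace 𝓑]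
  [MeasurableSpace Z] {J : ℕ} (T : Study Ω 𝒳 𝓑 Z J)

/-- The estimated doubly-robust scores at the cutoffs `p` minus the true scores at `p₀`, summed over
the sample, for the scalar response `v` with the regressions `mh`. -/
def scoreDiff (π : 𝒳 → ℝ) (e : 𝒳 → ℝ) (v : 𝓑 → Vec J → ℝ) (μ : Bool → 𝒳 → Vec J → ℝ) {n : ℕ}
    (eh : Fin 3 → 𝒳 → ℝ) (mh : Fin 3 → Bool → 𝒳 → ℝ) (fold : Fin n → Fin 3) (p₀ p : Vec J)
    (u : Fin n → Rec 𝒳 𝓑) : ℝ :=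
  ∑ i, (recScore π (eh (fold i)) (mh (fold i)) (v (u i).obs p) (u i)
    - recScore π e (fun w x => μ w x p₀) (v (u i).obs p₀) (u i))

open RegularResponse in
/-- Decomposition of the error of the summed scores into centered increments, conditional biases of
the increments, and errors of the scores at `p₀`. -/
lemma abs_scoreDiff_sub_le {Q : Measure (Rec 𝒳 𝓑)} [IsProbabilityMeasure Q] {S : Set (Vec J)}
    {p₀ : Vec J} {e : 𝒳 → ℝ}
    {v : 𝓑 → Vec J → ℝ} {μ : Bool → 𝒳 → Vec J → ℝ} {κ K L C h : ℝ}
    (H : RegularResponse Q S p₀ e v μ κ K L C h) {π : 𝒳 → ℝ} (hπ : IsRule π) {n : ℕ}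
    {eh : Fin 3 → 𝒳 → ℝ} {mh : Fin 3 → Bool → 𝒳 → ℝ} {fold : Fin n → Fin 3} {p : Vec J}
    {u : Fin n → Rec 𝒳 𝓑} (hp : p ∈ S) (hem : ∀ k, Measurable (eh k))
    (he : ∀ k x, eh k x ∈ Set.Icc κ (1 - κ)) {ρ : ℝ} (hρ : 0 ≤ ρ)
    (hL2 : ∀ k, ∫ r : Rec 𝒳 𝓑, (eh k r.1 - e r.1) ^ 2 ∂Q ≤ ρ ^ 2) {a b : ℝ}
    (ha : ∀ k, |centeredIncrement Q π v p₀ ({i | fold i = k} : Finset (Fin n)) (eh k) u p| ≤ a)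
    (hb : ∀ k, |∑ i ∈ ({i | fold i = k} : Finset (Fin n)),
      (recScore π (eh k) (mh k) (v (u i).obs p₀) (u i)
        - recScore π e (fun w x => μ w x p₀) (v (u i).obs p₀) (u i))| ≤ b) :
    |scoreDiff π e v μ eh mh fold p₀ p u - n * (meanResp Q v π p - meanResp Q v π p₀)|
      ≤ 3 * a + 3 * b + n * (2 * κ⁻¹ * L * ρ * ‖p - p₀‖) := by
  set Δ := meanResp Q v π p - meanResp Q v π p₀ with hΔ
  set f : Fin 3 → ℝ := fun k => ∫ r, recWeight π (eh k) r * (v r.obs p - v r.obs p₀) ∂Q with hf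
  have hbias : ∀ k, |f k - Δ| ≤ 2 * κ⁻¹ * L * ρ * ‖p - p₀‖ := fun k =>
    H.abs_integral_recWeight_mul_sub_le hπ (hem k) (he k) hρ (hL2 k) hp
  set A : Fin 3 → ℝ := fun k =>
    centeredIncrement Q π v p₀ ({i | fold i = k} : Finset (Fin n)) (eh k) u p with hA
  set B : Fin 3 → ℝ := fun k => ∑ i ∈ ({i | fold i = k} : Finset (Fin n)),
      (recScore π (eh k) (mh k) (v (u i).obs p₀) (u i)
        - recScore π e (fun w x => μ w x p₀) (v (u i).obs p₀) (u i)) with hB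
  have key : scoreDiff π e v μ eh mh fold p₀ p u - n * Δ
      = ∑ k, A k + ∑ k, B k + ∑ i : Fin n, (f (fold i) - Δ) := by
    have hn : (n : ℝ) * Δ = ∑ i : Fin n, Δ := by simp
    have hAs : ∑ k, A k = ∑ i : Fin n,
        (recWeight π (eh (fold i)) (u i) * (v (u i).obs p - v (u i).obs p₀) - f (fold i)) := by
      rw [← Finset.sum_fiberwise Finset.univ fold]
      refine Finset.sum_congr rfl fun k _ => Finset.sum_congr rfl fun i hi => ?_
      rw [(Finset.mem_filter.mp hi).2]
    have hBs : ∑ k, B k = ∑ i : Fin n,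
        (recScore π (eh (fold i)) (mh (fold i)) (v (u i).obs p₀) (u i)
          - recScore π e (fun w x => μ w x p₀) (v (u i).obs p₀) (u i)) := by
      rw [← Finset.sum_fiberwise Finset.univ fold]
      refine Finset.sum_congr rfl fun k _ => Finset.sum_congr rfl fun i hi => ?_
      rw [(Finset.mem_filter.mp hi).2]
    rw [hAs, hBs, hn, scoreDiff, ← Finset.sum_add_distrib, ← Finset.sum_add_distrib,
      ← Finset.sum_sub_distrib]
    refine Finset.sum_congr rfl fun i _ => ?_
    have := recScore_sub_recScore π (eh (fold i)) (mh (fold i)) (v (u i).obs p) (v (u i).obs p₀)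
      (u i)
    linear_combination this
  rw [key]
  have h1 : |∑ k, A k| ≤ 3 * a := (Finset.abs_sum_le_sum_abs _ _).trans
    ((Finset.sum_le_sum fun k _ => ha k).trans (by simp))
  have h2 : |∑ k, B k| ≤ 3 * b := (Finset.abs_sum_le_sum_abs _ _).trans
    ((Finset.sum_le_sum fun k _ => hb k).trans (by simp))
  have h3 : |∑ i : Fin n, (f (fold i) - Δ)| ≤ n * (2 * κ⁻¹ * L * ρ * ‖p - p₀‖) :=
    (Finset.abs_sum_le_sum_abs _ _).trans
    ((Finset.sum_le_sum fun i _ => hbias (fold i)).trans (by simp))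
  exact (abs_add_le _ _).trans (add_le_add ((abs_add_le _ _).trans (add_le_add h1 h2)) h3)

variable {e : 𝒳 → ℝ} {v : 𝓑 → Vec J → ℝ} {μ : Bool → 𝒳 → Vec J → ℝ} {κ K L C h : ℝ}
  {p₀ : Vec J}

set_option maxHeartbeats 1000000 in
open RegularResponse in
/-- The summed scores at the estimated cutoffs, up to an error that is controlled by the distance
from the estimated cutoffs to `p₀`. -/
lemma highProb_scoreDiff {η : Nuisance 𝒳 J} (hId : T.Identification η)
    (H : RegularResponse T.lawRec T.S p₀ e v μ κ K L C h) (hκ : κ ≤ 1 - κ)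
    {π : 𝒳 → ℝ} (hπ : IsRule π)
    {mh : Fin 3 → (n : ℕ) → Z → (Fin n → Rec 𝒳 𝓑) → Bool → 𝒳 → ℝ}
    (hm : ∀ k n w, Measurable fun q : (Z × (Fin n → Rec 𝒳 𝓑)) × 𝒳 => mh k n q.1.1 q.1.2 w q.2)
    (hmI : ∀ k n z, IndepOfCoords (T.recI k n z) (mh k n z)) {ρ ρ' : ℕ → ℝ} (hρ : ∀ n, 0 ≤ ρ n)
    (hρ' : ∀ n, 0 ≤ ρ' n) (hρ0 : Tendsto ρ atTop (𝓝 0)) (hρ'0 : Tendsto ρ' atTop (𝓝 0))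
    (hprod : Tendsto (fun n : ℕ => √(n : ℝ) * (ρ n * ρ' n)) atTop (𝓝 0))
    (hfit : ∀ k, HighProb T.P fun n => {ω | IsGoodFit T.lawRec e μ p₀ (ρ n) (ρ' n)
      (T.clippedEHat κ k n (T.seed ω) (T.sample n ω)) (mh k n (T.seed ω) (T.sample n ω))})
    {ε c₁ c₂ τ β : ℝ} (hε : 0 < ε) (hc₁ : 0 < c₁) (hc₂ : 0 ≤ c₂) (hβ : 9 / 16 ≤ 1 - β)
    (hτ : 1 / 8 ≤ 2 * τ - (1 - β)) :
    HighProb T.P fun n => {ω | T.pHat π n ω ∈ T.S → ‖T.pHat π n ω - p₀‖ ≤ c₂ * (n : ℝ) ^ (-β) →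
      |scoreDiff π e v μ (fun k => T.clippedEHat κ k n (T.seed ω) (T.sample n ω))
          (fun k => mh k n (T.seed ω) (T.sample n ω)) (T.foldOf n ω) p₀ (T.pHat π n ω)
          (T.sample n ω)
        - n * (meanResp T.lawRec v π (T.pHat π n ω) - meanResp T.lawRec v π p₀)|
      ≤ 3 * (c₁ * (n : ℝ) ^ τ) + 3 * (ε * √(n : ℝ))
        + n * (2 * κ⁻¹ * L * ρ n * ‖T.pHat π n ω - p₀‖)} := by
  have := T.isProb
  have := T.isProbabilityMeasure_lawRec
  have := T.isProbabilityMeasure_seed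
  have h1 := HighProb.iInter fun k => T.highProb_of_prod hId
    (H.tendsto_centeredIncrement (ζ := T.P.map T.seed) (T.isCrossFit hκ k) hπ
      (T.measurable_recPHat hπ.1) hc₁ hc₂ hβ hτ)
  have h2 := HighProb.iInter fun k => T.highProb_of_prod hId
    (H.tendsto_crossfit_score (ζ := T.P.map T.seed) (T.isCrossFit hκ k) hπ (hm k) (hmI k) hρ hρ'
      hρ0 hρ'0 hprod hε)
  refine ((h1.inter h2).inter (HighProb.iInter hfit)).mono (Eventually.of_forall fun n => ?_)
  rintro ω ⟨⟨ha, hb⟩, hf⟩ hpS hpn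
  simp only [Set.mem_iInter, Set.mem_ofPred_eq, ← pHat_eq, not_and, not_lt] at ha hb hf
  have hem : ∀ k, Measurable (T.clippedEHat κ k n (T.seed ω) (T.sample n ω)) := fun k =>
    ((T.isCrossFit hκ k).measurable_eh n).comp
      ((measurable_const (a := (T.seed ω, T.sample n ω))).prodMk measurable_id)
  refine abs_scoreDiff_sub_le H hπ hpS hem (fun k x => clip_mem hκ _) (hρ n) (fun k => ?_)
    (fun k => ha k ⟨hpS, hpn⟩) (fun k => hb k (hf k))
  exact (memLp_of_lintegral_sq_le (((hem k).sub H.measurable_e).comp measurable_fst) (hf k).1).2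

/-! ### Conditions on the nuisance estimators -/

/-- The additive b pays for re-centring a regression from the first-step cutoffs to p₀, and (|f| +
b)² ≤ 2f² + 2b². No measurability of f is required, since only a constant is split off the integral.
-/
lemma lintegral_sq_lawRec_le {f g : 𝒳 → ℝ} {a b : ℝ} (ha : 0 ≤ a) (hb : 0 ≤ b)
    (hf : eLpNorm f 2 T.lawX ≤ ENNReal.ofReal a) (hg : Measurable g)
    (hgf : ∀ x, |g x| ≤ |f x| + b) :
    ∫⁻ r : Rec 𝒳 𝓑, ENNReal.ofReal (g r.1 ^ 2) ∂T.lawRec ≤ ENNReal.ofReal ((2 * (a + b)) ^ 2) := by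
  have := T.isProb
  have : IsProbabilityMeasure T.lawX :=
    Measure.isProbabilityMeasure_map (T.measurable_X 0).aemeasurable
  have h1 : ∫⁻ r : Rec 𝒳 𝓑, ENNReal.ofReal (g r.1 ^ 2) ∂T.lawRec
      = ∫⁻ x, ENNReal.ofReal (g x ^ 2) ∂T.lawX := by
    rw [← T.map_fst_lawRec, lintegral_map (hg.pow_const 2).ennreal_ofReal measurable_fst]
  have h2 : ∫⁻ x, ENNReal.ofReal (f x ^ 2) ∂T.lawX ≤ ENNReal.ofReal (a ^ 2) := by
    rw [eLpNorm_eq_lintegral_rpow_enorm_toReal (by norm_num) (by norm_num)] at hf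
    have h3 := ENNReal.rpow_le_rpow hf (z := 2) (by norm_num)
    rw [← ENNReal.rpow_mul] at h3
    norm_num at h3
    rw [ENNReal.ofReal_pow ha]
    refine le_trans (le_of_eq (lintegral_congr fun x => ?_)) h3
    rw [← sq_abs, ENNReal.ofReal_pow (abs_nonneg _), Real.enorm_eq_ofReal_abs]
  rw [h1]
  calc _ ≤ ∫⁻ x, (2 * ENNReal.ofReal (f x ^ 2) + ENNReal.ofReal (2 * b ^ 2)) ∂T.lawX := by
        refine lintegral_mono fun x => ?_
        have h2' : (2 : ℝ≥0∞) = ENNReal.ofReal 2 := by simp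
        rw [h2', ← ENNReal.ofReal_mul (by norm_num),
          ← ENNReal.ofReal_add (by positivity) (by positivity)]
        apply ENNReal.ofReal_le_ofReal
        rw [← sq_abs (g x), ← sq_abs (f x)]
        have := hgf x
        have h0 := abs_nonneg (g x)
        nlinarith [sq_nonneg (|f x| - b), abs_nonneg (f x)]
    _ = 2 * ∫⁻ x, ENNReal.ofReal (f x ^ 2) ∂T.lawX + ENNReal.ofReal (2 * b ^ 2) := by
        rw [lintegral_add_right _ measurable_const, lintegral_const_mul' _ _ (by norm_num)]
        simp
    _ ≤ 2 * ENNReal.ofReal (a ^ 2) + ENNReal.ofReal (2 * b ^ 2) := by gcongr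
    _ ≤ _ := by
        have h2' : (2 : ℝ≥0∞) = ENNReal.ofReal 2 := by simp
        rw [h2', ← ENNReal.ofReal_mul (by norm_num),
          ← ENNReal.ofReal_add (by positivity) (by positivity)]
        apply ENNReal.ofReal_le_ofReal
        nlinarith [mul_nonneg ha hb]

/-- If the propensity score is estimated consistently by scores in `(κ, 1 - κ)`, it takes values in
`[κ, 1 - κ]`. -/
lemma ae_propensity_mem {η : Nuisance 𝒳 J} (hem : Measurable η.e) {κ : ℝ} (k : Fin 3)
    (hover : ∀ n, ∀ᵐ ω ∂T.P, ∀ᵐ x ∂T.lawX, T.eHat n k ω x ∈ Set.Ioo κ (1 - κ)) {ρ : ℕ → ℝ}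
    (hρ0 : Tendsto ρ atTop (𝓝 0)) (hfit : HighProb T.P fun n =>
      {ω | eLpNorm (fun x => T.eHat n k ω x - η.e x) 2 T.lawX ≤ ENNReal.ofReal (ρ n)}) :
    κ ≤ 1 - κ ∧ ∀ᵐ x ∂T.lawX, clip κ (η.e x) = η.e x := by
  have := T.isProb
  have : IsProbabilityMeasure T.lawX :=
    Measure.isProbabilityMeasure_map (T.measurable_X 0).aemeasurable
  constructor
  · obtain ⟨ω, hω⟩ := (hover 0).exists
    obtain ⟨x, hx⟩ := hω.exists
    linarith [hx.1, hx.2]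
  -- The distance from the true score to its truncation is at most its distance to any score with
  -- values in the interval. Being deterministic, it is bounded by ρ n as soon as one sample point
  -- has a good fit, and hence vanishes.
  · have hle : ∀ᶠ n in atTop, eLpNorm (fun x => η.e x - clip κ (η.e x)) 2 T.lawX
        ≤ ENNReal.ofReal (ρ n) := by
      filter_upwards [(hfit.inter (HighProb.of_ae hover)).nonempty] with n hn
      obtain ⟨ω, h1, h2⟩ := hn
      refine (eLpNorm_mono_ae ?_).trans h1
      filter_upwards [h2] with x hx
      exact abs_sub_clip_le ⟨hx.1.le, hx.2.le⟩
    have h0 := ENNReal.tendsto_ofReal hρ0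
    rw [ENNReal.ofReal_zero] at h0
    have hz : eLpNorm (fun x => η.e x - clip κ (η.e x)) 2 T.lawX = 0 :=
      le_antisymm (ge_of_tendsto h0 hle) zero_le
    have hm : AEStronglyMeasurable (fun x => η.e x - clip κ (η.e x)) T.lawX :=
      (hem.sub ((measurable_clip κ).comp hem)).aestronglyMeasurable
    filter_upwards [(eLpNorm_eq_zero_iff hm (by norm_num)).mp hz] with x hx
    simp only [Pi.zero_apply] at hx
    linarith

end Study

/-! ### Expansion errors at two scales -/

/-- The errors `D n` at the random cutoffs `p n` are of smaller order than `n ^ (-7 / 16)` up to a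
small multiple of `‖p n - p₀‖`, and of smaller order than `n ^ (-1 / 2)` if `p n` is near `p₀`. -/
structure IsExpansionError {Ω : Type*} [MeasurableSpace Ω] {J : ℕ} (P : Measure Ω) (S : Set (Vec J))
    (p₀ : Vec J) (p : ℕ → Ω → Vec J) (D : ℕ → Ω → ℝ) : Prop where
  rough : ∀ δ : ℝ, 0 < δ → HighProb P fun n =>
    {ω | p n ω ∈ S → |D n ω| ≤ (n : ℝ) ^ (-(7 / 16) : ℝ) + δ * ‖p n ω - p₀‖}
  sharp : ∀ δ : ℝ, 0 < δ → HighProb P fun n =>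
    {ω | p n ω ∈ S → ‖p n ω - p₀‖ ≤ (n : ℝ) ^ (-(3 / 8) : ℝ) →
      √(n : ℝ) * |D n ω| ≤ δ * (1 + √(n : ℝ) * ‖p n ω - p₀‖)}

namespace Study

variable {Ω 𝒳 𝓑 Z : Type*} [MeasurableSpace Ω] [MeasurableSpace 𝒳] [MeasurableSpace 𝓑]
  [MeasurableSpace Z] {J : ℕ} (T : Study Ω 𝒳 𝓑 Z J)

variable {e : 𝒳 → ℝ} {v : 𝓑 → Vec J → ℝ} {μ : Bool → 𝒳 → Vec J → ℝ} {κ K L C h : ℝ}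
  {p₀ : Vec J}

-- One bound is used at two scales. For the rough part β = 0 imposes no localization, since S is
-- bounded, and τ = 9/16 leaves n^(9/16)/n = n^(-7/16). For the sharp part β = 3/8 lowers the
-- variance to n^(5/8), which permits τ = 1/2 with an arbitrarily small constant. As ρ n tends to
-- zero, the bias of the increments is a small multiple of ‖p - p₀‖.
open RegularResponse in
lemma isExpansionError_scoreDiff {η : Nuisance 𝒳 J} (hId : T.Identification η)
    (H : RegularResponse T.lawRec T.S p₀ e v μ κ K L C h) (hκ : κ ≤ 1 - κ)
    {π : 𝒳 → ℝ} (hπ : IsRule π)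
    {mh : Fin 3 → (n : ℕ) → Z → (Fin n → Rec 𝒳 𝓑) → Bool → 𝒳 → ℝ}
    (hm : ∀ k n w, Measurable fun q : (Z × (Fin n → Rec 𝒳 𝓑)) × 𝒳 => mh k n q.1.1 q.1.2 w q.2)
    (hmI : ∀ k n z, IndepOfCoords (T.recI k n z) (mh k n z)) {ρ ρ' : ℕ → ℝ} (hρ : ∀ n, 0 ≤ ρ n)
    (hρ' : ∀ n, 0 ≤ ρ' n) (hρ0 : Tendsto ρ atTop (𝓝 0)) (hρ'0 : Tendsto ρ' atTop (𝓝 0))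
    (hprod : Tendsto (fun n : ℕ => √(n : ℝ) * (ρ n * ρ' n)) atTop (𝓝 0))
    (hfit : ∀ k, HighProb T.P fun n => {ω | IsGoodFit T.lawRec e μ p₀ (ρ n) (ρ' n)
      (T.clippedEHat κ k n (T.seed ω) (T.sample n ω)) (mh k n (T.seed ω) (T.sample n ω))})
    (hS : Bornology.IsBounded T.S) :
    IsExpansionError T.P T.S p₀ (T.pHat π) fun n ω =>
      (n : ℝ)⁻¹ * scoreDiff π e v μ (fun k => T.clippedEHat κ k n (T.seed ω) (T.sample n ω))
          (fun k => mh k n (T.seed ω) (T.sample n ω)) (T.foldOf n ω) p₀ (T.pHat π n ω)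
          (T.sample n ω)
        - (meanResp T.lawRec v π (T.pHat π n ω) - meanResp T.lawRec v π p₀) := by
  have hsmall : ∀ δ : ℝ, 0 < δ → ∀ᶠ n in atTop, 2 * κ⁻¹ * L * ρ n ≤ δ := fun δ hδ => by
    have := hρ0.const_mul (2 * κ⁻¹ * L)
    rw [mul_zero] at this
    exact (this.eventually_lt_const hδ).mono fun _ h => h.le
  have hscale : ∀ {n : ℕ}, (0 : ℝ) < n → ∀ A Δ : ℝ, |(n : ℝ)⁻¹ * A - Δ| = (n : ℝ)⁻¹ * |A - n * Δ| := by
    intro n hn A Δ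
    rw [← abs_of_pos (inv_pos.mpr hn), ← abs_mul, abs_of_pos (inv_pos.mpr hn)]
    congr 1; field_simp
  constructor
  · intro δ hδ
    obtain ⟨R, hR⟩ := hS.exists_norm_le
    -- Since √n ≤ n^(9/16), the two constants 1/6, each taken over three folds, add up to n^(9/16).
    have h0 := T.highProb_scoreDiff hId H hκ hπ hm hmI hρ hρ' hρ0 hρ'0 hprod hfit
      (ε := 1 / 6) (c₁ := 1 / 6) (c₂ := R + ‖p₀‖) (τ := 9 / 16) (β := 0) (by norm_num)
      (by norm_num) (by have := (norm_nonneg _).trans (hR _ H.mem_S); positivity)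
      (by norm_num) (by norm_num)
    refine h0.mono ?_
    filter_upwards [hsmall δ hδ, eventually_ge_atTop 1] with n hn hn1 ω hω hpS
    have hn0 : (0 : ℝ) < n := by exact_mod_cast hn1
    have hn1' : (1 : ℝ) ≤ n := by exact_mod_cast hn1
    have h1 := hω hpS (by
      rw [neg_zero, Real.rpow_zero, mul_one]
      exact (norm_sub_le _ _).trans (by gcongr; exact hR _ hpS))
    have h2 : √(n : ℝ) ≤ (n : ℝ) ^ (9 / 16 : ℝ) := by
      rw [Real.sqrt_eq_rpow]
      exact Real.rpow_le_rpow_of_exponent_le hn1' (by norm_num)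
    have h3 : (n : ℝ)⁻¹ * (n : ℝ) ^ (9 / 16 : ℝ) = (n : ℝ) ^ (-(7 / 16) : ℝ) := by
      rw [← Real.rpow_neg_one, ← Real.rpow_add hn0]; norm_num
    rw [hscale hn0]
    calc _ ≤ (n : ℝ)⁻¹ * ((n : ℝ) ^ (9 / 16 : ℝ) + n * (δ * ‖T.pHat π n ω - p₀‖)) := by
          gcongr
          refine h1.trans (add_le_add (by linarith) ?_)
          gcongr
      _ = _ := by rw [mul_add, h3]; field_simp
  · intro δ hδ
    have h0 := T.highProb_scoreDiff hId H hκ hπ hm hmI hρ hρ' hρ0 hρ'0 hprod hfit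
      (ε := δ / 6) (c₁ := δ / 6) (c₂ := 1) (τ := 1 / 2) (β := 3 / 8) (by positivity)
      (by positivity) (by norm_num) (by norm_num) (by norm_num)
    refine h0.mono ?_
    filter_upwards [hsmall δ hδ, eventually_ge_atTop 1] with n hn hn1 ω hω hpS hpn
    have hn0 : (0 : ℝ) < n := by exact_mod_cast hn1
    have h1 := hω hpS (by rwa [one_mul])
    rw [← Real.sqrt_eq_rpow] at h1
    rw [hscale hn0]
    have hs : 0 < √(n : ℝ) := Real.sqrt_pos.mpr hn0
    have hsq : √(n : ℝ) * √(n : ℝ) = n := Real.mul_self_sqrt hn0.le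
    calc _ ≤ √(n : ℝ) * ((n : ℝ)⁻¹ * (δ * √(n : ℝ) + n * (δ * ‖T.pHat π n ω - p₀‖))) := by
          gcongr
          refine h1.trans (add_le_add (by linarith) ?_)
          gcongr
      _ = δ * ((√(n : ℝ) * √(n : ℝ)) * (n : ℝ)⁻¹) + δ * (√(n : ℝ) * ‖T.pHat π n ω - p₀‖) := by
          field_simp
      _ = _ := by rw [hsq, mul_inv_cancel₀ hn0.ne']; ring

-- Truncation is 1-Lipschitz, so it does not increase the propensity error. The regressions are
-- accurate at the first-step cutoffs; once rhoTheta is below the radius of the ball, Lipschitz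
-- continuity of μ moves their target to `pStar π` at the cost c' rhoTheta. The factors 2 come from
-- `lintegral_sq_lawRec_le`.
open RegularResponse in
lemma highProb_isGoodFit {η : Nuisance 𝒳 J} (hem : Measurable η.e) {pStar : (𝒳 → ℝ) → Vec J}
    {π : 𝒳 → ℝ} {rhoMu rhoE rhoTheta : ℕ → ℝ}
    (h0 : ∀ n, 0 ≤ rhoMu n ∧ 0 ≤ rhoE n ∧ 0 ≤ rhoTheta n)
    (hθ : Tendsto rhoTheta atTop (𝓝 0)) {k : Fin 3}
    (hfit : HighProb T.P fun n => T.goodFit η pStar (rhoMu n) (rhoE n) (rhoTheta n) π n k)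
    (hμm : ∀ w, Measurable fun x => μ w x (pStar π)) {c₁ c' : ℝ} (hc₁ : 0 < c₁) (hc' : 0 ≤ c')
    (hlip : ∀ w x, ∀ p ∈ Metric.ball (pStar π) c₁, |μ w x p - μ w x (pStar π)| ≤ c' * ‖p - pStar π‖)
    {mh : (n : ℕ) → Z → (Fin n → Rec 𝒳 𝓑) → Bool → 𝒳 → ℝ}
    (hm : ∀ n w, Measurable fun q : (Z × (Fin n → Rec 𝒳 𝓑)) × 𝒳 => mh n q.1.1 q.1.2 w q.2)
    (hmh : ∀ n ω w x, |mh n (T.seed ω) (T.sample n ω) w x - μ w x (T.pTilde π n k ω)|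
      ≤ √((T.muYHat π n k ω w x - η.muY w x (T.pTilde π n k ω)) ^ 2 +
          ‖T.muDHat π n k ω w x - η.muD w x (T.pTilde π n k ω)‖ ^ 2)) :
    HighProb T.P fun n => {ω | IsGoodFit T.lawRec (fun x => clip κ (η.e x)) μ (pStar π)
      (2 * rhoE n) (2 * (rhoMu n + c' * rhoTheta n))
      (T.clippedEHat κ k n (T.seed ω) (T.sample n ω)) (mh n (T.seed ω) (T.sample n ω))} := by
  refine hfit.mono ?_
  filter_upwards [hθ.eventually_lt_const hc₁] with n hn ω hω
  obtain ⟨h1, h2, h3⟩ := hω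
  obtain ⟨hM0, hE0, hθ0⟩ := h0 n
  constructor
  · have := T.lintegral_sq_lawRec_le (g := fun x => T.clippedEHat κ k n (T.seed ω) (T.sample n ω) x
      - clip κ (η.e x)) hE0 le_rfl h2 ?_ ?_
    · simpa using this
    · exact ((measurable_clip κ).comp (T.measurable_recEHat k measurable_const measurable_const
        measurable_id)).sub ((measurable_clip κ).comp hem)
    · intro x
      rw [add_zero]
      exact abs_clip_sub_clip_le _ _ _
  · intro w
    refine T.lintegral_sq_lawRec_le (g := fun x => mh n (T.seed ω) (T.sample n ω) w x
      - μ w x (pStar π)) hM0 (by positivity) (h1 w) ?_ ?_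
    · exact ((hm n w).comp ((measurable_const (a := (T.seed ω, T.sample n ω))).prodMk
        measurable_id)).sub (hμm w)
    · intro x
      have h4 := hmh n ω w x
      have h5 := hlip w x (T.pTilde π n k ω) (by
        rw [Metric.mem_ball, dist_eq_norm]; exact h3.trans_lt hn)
      have h6 : c' * ‖T.pTilde π n k ω - pStar π‖ ≤ c' * rhoTheta n := by gcongr
      rw [abs_of_nonneg (Real.sqrt_nonneg _)]
      calc _ ≤ |mh n (T.seed ω) (T.sample n ω) w x - μ w x (T.pTilde π n k ω)|
            + |μ w x (T.pTilde π n k ω) - μ w x (pStar π)| := abs_sub_le _ _ _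
        _ ≤ _ := by linarith

end Study

/-! ### Linearization around the equilibrium -/

lemma euclidean_norm_le_sum_abs {J : ℕ} (x : Vec J) : ‖x‖ ≤ ∑ j, |x j| := by
  rw [EuclideanSpace.norm_eq]
  refine Real.sqrt_le_iff.mpr ⟨Finset.sum_nonneg fun _ _ => abs_nonneg _, ?_⟩
  simp only [Real.norm_eq_abs]
  exact Finset.sum_sq_le_sq_sum_of_nonneg fun _ _ => abs_nonneg _

/-- Near p₀ the injective derivative dominates the remainder. Away from p₀, compactness and
uniqueness of the zero give ‖z‖ a positive minimum, which is divided by a bound on ‖p - p₀‖. As the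
inequality holds on all of S, no separate consistency proof for the estimated cutoffs is needed. -/
lemma exists_mul_norm_sub_le {E F : Type*} [NormedAddCommGroup E] [NormedSpace ℝ E]
    [FiniteDimensional ℝ E] [NormedAddCommGroup F] [NormedSpace ℝ F] {S : Set E} (hS : IsCompact S)
    {z : E → F} (hz : ContinuousOn z S) {z' : E →L[ℝ] F} {p₀ : E} (hz' : HasFDerivAt z z' p₀)
    (hinj : Function.Injective z') (h0 : z p₀ = 0) (hu : ∀ p ∈ S, z p = 0 → p = p₀) :
    ∃ c : ℝ, 0 < c ∧ ∀ p ∈ S, c * ‖p - p₀‖ ≤ ‖z p‖ := by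
  obtain ⟨k, hk, hanti⟩ := z'.toLinearMap.exists_antilipschitzWith
    (LinearMap.ker_eq_bot.mpr hinj)
  have hk' : (0 : ℝ) < k := hk
  have hlow : ∀ x, (k : ℝ)⁻¹ * ‖x‖ ≤ ‖z' x‖ := fun x => by
    have h1 := hanti.le_mul_dist x 0
    simp only [dist_zero_right, map_zero] at h1
    rw [inv_mul_le_iff₀ hk']
    exact h1
  have hnear := hz'.isLittleO.def (c := (k : ℝ)⁻¹ / 2) (by positivity)
  obtain ⟨r, hr, hball⟩ := Metric.eventually_nhds_iff.mp hnear
  have hloc : ∀ p, ‖p - p₀‖ < r → (k : ℝ)⁻¹ / 2 * ‖p - p₀‖ ≤ ‖z p‖ := fun p hp => by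
    have h1 := hball (by rwa [dist_eq_norm])
    rw [h0, sub_zero] at h1
    have h2 := hlow (p - p₀)
    have h3 := norm_sub_norm_le (z' (p - p₀)) (z p)
    rw [norm_sub_rev] at h3
    linarith
  obtain ⟨R, hR⟩ := hS.isBounded.exists_norm_le
  have hK : IsCompact (S \ Metric.ball p₀ r) := hS.diff Metric.isOpen_ball
  rcases (S \ Metric.ball p₀ r).eq_empty_or_nonempty with he | hne
  · refine ⟨(k : ℝ)⁻¹ / 2, by positivity, fun p hp => hloc p ?_⟩
    by_contra hcon
    have : p ∈ S \ Metric.ball p₀ r := ⟨hp, by rwa [Metric.mem_ball, dist_eq_norm]⟩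
    rw [he] at this
    exact this
  · obtain ⟨q, hq, hmin⟩ := hK.exists_isMinOn hne (hz.norm.mono Set.sdiff_subset)
    have hzq : 0 < ‖z q‖ := by
      rw [norm_pos_iff]
      intro hcon
      exact hq.2 (by rw [hu q hq.1 hcon]; exact Metric.mem_ball_self hr)
    have hRp : 0 < R + ‖p₀‖ + 1 := by
      have := (norm_nonneg _).trans (hR q hq.1)
      positivity
    refine ⟨min ((k : ℝ)⁻¹ / 2) (‖z q‖ / (R + ‖p₀‖ + 1)), by positivity, fun p hp => ?_⟩
    by_cases hp' : ‖p - p₀‖ < r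
    · refine le_trans ?_ (hloc p hp')
      gcongr
      exact min_le_left _ _
    · have h1 : ‖z q‖ ≤ ‖z p‖ := hmin ⟨hp, by rwa [Metric.mem_ball, dist_eq_norm]⟩
      refine le_trans ?_ h1
      have h2 : ‖p - p₀‖ ≤ R + ‖p₀‖ + 1 := (norm_sub_le _ _).trans (by linarith [hR p hp])
      calc _ ≤ ‖z q‖ / (R + ‖p₀‖ + 1) * (R + ‖p₀‖ + 1) := by
            gcongr
            exact min_le_right _ _
        _ = ‖z q‖ := by field_simp

/-- The linearization of `y` along `z`. -/
lemma eventually_abs_sub_sub_le {E : Type*} [NormedAddCommGroup E] [NormedSpace ℝ E]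
    [FiniteDimensional ℝ E] {y : E → ℝ} {y' : E →L[ℝ] ℝ} {z : E → E}
    {z' : E →L[ℝ] E} {p₀ : E} (hy : HasFDerivAt y y' p₀) (hz : HasFDerivAt z z' p₀)
    (hinj : Function.Injective z') (h0 : z p₀ = 0) {δ : ℝ} (hδ : 0 < δ) :
    ∀ᶠ p in 𝓝 p₀, |y p - y p₀ - y'.comp z'.inverse (z p)| ≤ δ * ‖p - p₀‖ := by
  -- In finite dimension injectivity gives bijectivity, so `inverse` is a true inverse and not its
  -- default value zero.
  have hinv : z'.inverse.comp z' = ContinuousLinearMap.id ℝ E := by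
    have hbij : Function.Bijective z'.toLinearMap :=
      ⟨hinj, LinearMap.injective_iff_surjective.mp hinj⟩
    set e : E ≃L[ℝ] E := (LinearEquiv.ofBijective z'.toLinearMap hbij).toContinuousLinearEquiv
    have he : (e : E →L[ℝ] E) = z' := by ext x; rfl
    rw [← he, ContinuousLinearMap.inverse_equiv]
    ext x; simp
  -- The map y - y' ∘ z'⁻¹ ∘ z has derivative zero at p₀, which is the whole claim.
  have hφ := hy.sub ((y'.comp z'.inverse).hasFDerivAt.comp p₀ hz)
  have hzero : y' - (y'.comp z'.inverse).comp z' = 0 := by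
    rw [ContinuousLinearMap.comp_assoc, hinv]; ext x; simp
  rw [hzero] at hφ
  filter_upwards [hφ.isLittleO.def hδ] with p hp
  simpa [h0, sub_right_comm] using hp

/-! ### Rates of convergence from approximate market clearing -/

section Rates

variable {J n : ℕ} {g a q : Vec J} {d : Fin J → ℝ} {x ρ M c δ : ℝ}

/-- In the application g is the estimated net demand at the estimated cutoffs, a the average true
score at p₀, q the population net demand at the estimated cutoffs, d the expansion errors, and x the
distance to p₀. -/
lemma norm_sub_le_of_eq_add (h : ∀ j, g j = a j + q j + d j) :
    ‖q + a‖ ≤ ‖g‖ + ∑ j, |d j| := by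
  have h1 : q + a = g - WithLp.toLp 2 d := by
    ext j
    simp only [PiLp.sub_apply, PiLp.add_apply, h j]; ring
  rw [h1]
  exact (norm_sub_le _ _).trans (by gcongr; exact euclidean_norm_le_sum_abs _)

variable (hn : 1 ≤ n) (h : ∀ j, g j = a j + q j + d j) (hc : 0 < c) (hx0 : 0 ≤ x)
  (hcx : c * x ≤ ‖q‖) (hg : ‖g‖ ≤ ρ) (hρ : √(n : ℝ) * ρ ≤ δ) (ha : √(n : ℝ) * ‖a‖ ≤ M)
  (hδ0 : 0 < δ) (hδ1 : δ ≤ 1) (hδc : J * δ ≤ c / 2)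

include h hcx hg in
lemma mul_le_of_eq_add : c * x ≤ ρ + ‖a‖ + ∑ j, |d j| := by
  have h1 := norm_sub_le_of_eq_add h
  have h2 : ‖q‖ ≤ ‖q + a‖ + ‖a‖ := by simpa using norm_sub_le (q + a) a
  linarith

include hn h hc hx0 hcx hg hρ ha hδ1 hδc in
/-- The preliminary rate of convergence. -/
lemma le_rpow_of_eq_add (hM0 : 0 ≤ M) (hd : ∀ j, |d j| ≤ (n : ℝ) ^ (-(7 / 16) : ℝ) + δ * x)
    (hn1 : (1 + M + J) * (2 / c) ≤ (n : ℝ) ^ (1 / 16 : ℝ)) : x ≤ (n : ℝ) ^ (-(3 / 8) : ℝ) := by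
  have hcx' := mul_le_of_eq_add h hcx hg
  have hn0 : (0 : ℝ) < n := by exact_mod_cast hn
  have hn1' : (1 : ℝ) ≤ n := by exact_mod_cast hn
  have hs : 0 < √(n : ℝ) := Real.sqrt_pos.mpr hn0
  have h1 : ∑ j, |d j| ≤ J * ((n : ℝ) ^ (-(7 / 16) : ℝ) + δ * x) :=
    (Finset.sum_le_sum fun j _ => hd j).trans (by simp [mul_add])
  have h2 : ρ + ‖a‖ ≤ (1 + M) * (n : ℝ) ^ (-(7 / 16) : ℝ) := by
    have h3 : √(n : ℝ) * (ρ + ‖a‖) ≤ 1 + M := by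
      rw [mul_add]; linarith
    have h4 : (√(n : ℝ))⁻¹ ≤ (n : ℝ) ^ (-(7 / 16) : ℝ) := by
      rw [Real.sqrt_eq_rpow, ← Real.rpow_neg hn0.le]
      exact Real.rpow_le_rpow_of_exponent_le hn1' (by norm_num)
    calc ρ + ‖a‖ = (√(n : ℝ) * (ρ + ‖a‖)) * (√(n : ℝ))⁻¹ := by field_simp
      _ ≤ (1 + M) * (n : ℝ) ^ (-(7 / 16) : ℝ) := by gcongr
  -- The rate n^(-3/8) gives away a factor n^(1/16), which swallows all constants.
  have h6 : (n : ℝ) ^ (-(7 / 16) : ℝ) * (n : ℝ) ^ (1 / 16 : ℝ) = (n : ℝ) ^ (-(3 / 8) : ℝ) := by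
    rw [← Real.rpow_add hn0]; norm_num
  have h7 : 0 < (n : ℝ) ^ (-(7 / 16) : ℝ) := by positivity
  -- The part of the errors proportional to x is absorbed into half of the lower bound c x.
  have h8 : J * (δ * x) ≤ c / 2 * x := by rw [← mul_assoc]; gcongr
  have h9 : c / 2 * x ≤ (1 + M + J) * (n : ℝ) ^ (-(7 / 16) : ℝ) := by linarith
  rw [← h6]
  calc x = 2 / c * (c / 2 * x) := by field_simp
    _ ≤ 2 / c * ((1 + M + J) * (n : ℝ) ^ (-(7 / 16) : ℝ)) :=
        mul_le_mul_of_nonneg_left h9 (by positivity)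
    _ = (n : ℝ) ^ (-(7 / 16) : ℝ) * ((1 + M + J) * (2 / c)) := by ring
    _ ≤ _ := by gcongr

lemma sqrt_mul_sum_le (hd : ∀ j, √(n : ℝ) * |d j| ≤ δ * (1 + √(n : ℝ) * x)) :
    √(n : ℝ) * ∑ j, |d j| ≤ J * (δ * (1 + √(n : ℝ) * x)) := by
  rw [Finset.mul_sum]
  exact (Finset.sum_le_sum fun j _ => hd j).trans (by simp)

include h hc hx0 hcx hg hρ ha hδ1 hδc in
/-- The root-`n` rate of convergence. -/
lemma sqrt_mul_le_of_eq_add (hd : ∀ j, √(n : ℝ) * |d j| ≤ δ * (1 + √(n : ℝ) * x)) :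
    √(n : ℝ) * x ≤ 2 / c * (M + J + 1) := by
  have hcx' := mul_le_of_eq_add h hcx hg
  have hsum := sqrt_mul_sum_le hd
  have hs : 0 ≤ √(n : ℝ) := Real.sqrt_nonneg _
  have h1 : √(n : ℝ) * (c * x) ≤ √(n : ℝ) * ρ + √(n : ℝ) * ‖a‖ + √(n : ℝ) * ∑ j, |d j| := by
    refine (mul_le_mul_of_nonneg_left hcx' hs).trans (le_of_eq ?_)
    ring
  have h2 : J * δ * (√(n : ℝ) * x) ≤ c / 2 * (√(n : ℝ) * x) := by gcongr
  have h3 : (J : ℝ) * δ ≤ J := by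
    calc (J : ℝ) * δ ≤ J * 1 := by gcongr
      _ = J := mul_one _
  calc √(n : ℝ) * x = 2 / c * (c / 2 * (√(n : ℝ) * x)) := by field_simp
    _ ≤ _ := by gcongr; linarith

-- Writing φ + ν a = (φ - ν q) + ν (q + a) leaves a linearization error and ν (q + a), and q + a = g
-- - d is small: clearing replaces the population change by minus the average score.
include h hg hρ hδ0 in
lemma sqrt_mul_abs_le_of_eq_add {ν : Vec J →L[ℝ] ℝ} {Dy φ B : ℝ} (hB : √(n : ℝ) * x ≤ B)
    (hd : ∀ j, √(n : ℝ) * |d j| ≤ δ * (1 + √(n : ℝ) * x))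
    (hy : √(n : ℝ) * |Dy| ≤ δ * (1 + √(n : ℝ) * x)) (hφ : |φ - ν q| ≤ δ * x) :
    √(n : ℝ) * |Dy + φ + ν a| ≤ δ * ((1 + B) + B + ‖ν‖ * (1 + J * (1 + B))) := by
  have hsum := sqrt_mul_sum_le hd
  have hν : |ν (q + a)| ≤ ‖ν‖ * (ρ + ∑ j, |d j|) := by
    refine (ν.le_opNorm _).trans ?_
    gcongr
    exact (norm_sub_le_of_eq_add h).trans (by gcongr)
  have heq : Dy + φ + ν a = Dy + (φ - ν q) + ν (q + a) := by
    rw [map_add]; ring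
  calc √(n : ℝ) * |Dy + φ + ν a|
      ≤ √(n : ℝ) * (|Dy| + δ * x + ‖ν‖ * (ρ + ∑ j, |d j|)) := by
        rw [heq]
        gcongr
        refine (abs_add_le _ _).trans (add_le_add ((abs_add_le _ _).trans ?_) hν)
        gcongr
    _ = √(n : ℝ) * |Dy| + δ * (√(n : ℝ) * x)
          + ‖ν‖ * (√(n : ℝ) * ρ + √(n : ℝ) * ∑ j, |d j|) := by ring
    _ ≤ δ * (1 + √(n : ℝ) * x) + δ * (√(n : ℝ) * x)
          + ‖ν‖ * (δ + J * (δ * (1 + √(n : ℝ) * x))) := by gcongr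
    _ ≤ δ * (1 + B) + δ * B + ‖ν‖ * (δ + J * (δ * (1 + B))) := by gcongr
    _ = _ := by ring

end Rates

/-- Errors of the estimated scores at estimated cutoffs that approximately clear the market. -/
lemma tendstoInMeasure_of_isExpansionError {Ω : Type*} [MeasurableSpace Ω] {P : Measure Ω} {J : ℕ}
    {S : Set (Vec J)} {p₀ : Vec J} {p : ℕ → Ω → Vec J} {y : Vec J → ℝ} {z : Vec J → Vec J}
    {ν : Vec J →L[ℝ] ℝ} {c : ℝ} (hc : 0 < c) (hlow : ∀ q ∈ S, c * ‖q - p₀‖ ≤ ‖z q‖)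
    (hlin : ∀ δ : ℝ, 0 < δ → ∀ᶠ q in 𝓝 p₀, |y q - y p₀ - ν (z q)| ≤ δ * ‖q - p₀‖)
    {Dy : ℕ → Ω → ℝ} {Dd : Fin J → ℕ → Ω → ℝ} (hDy : IsExpansionError P S p₀ p Dy)
    (hDd : ∀ j, IsExpansionError P S p₀ p (Dd j)) {A G : ℕ → Ω → Vec J} {ρ : ℕ → ℝ}
    (hρ : Tendsto (fun n : ℕ => √(n : ℝ) * ρ n) atTop (𝓝 0))
    (hG : HighProb P fun n => {ω | p n ω ∈ S ∧ ‖G n ω‖ ≤ ρ n})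
    (hA : ∀ a : ℝ≥0∞, 0 < a → ∃ M : ℝ, 0 ≤ M ∧
      ∀ᶠ n : ℕ in atTop, P {ω | M < √(n : ℝ) * ‖A n ω‖} ≤ a)
    (hGA : HighProb P fun n =>
      {ω | p n ω ∈ S → ∀ j, G n ω j = A n ω j + z (p n ω) j + Dd j n ω}) {R : ℕ → Ω → ℝ}
    (hR : HighProb P fun n => {ω | R n ω = Dy n ω + (y (p n ω) - y p₀) + ν (A n ω)}) :
    TendstoInMeasure P (fun (n : ℕ) ω => √(n : ℝ) * R n ω) atTop fun _ => 0 := by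
  rw [tendstoInMeasure_iff_norm]
  intro ε hε
  rw [ENNReal.tendsto_nhds_zero]
  intro a ha
  obtain ⟨M, hM0, hM⟩ := hA (a / 2) (ENNReal.half_pos ha.ne')
  set B := 2 / c * (M + J + 1) with hB
  have hB0 : 0 < B := by positivity
  set N := (1 + B) + B + ‖ν‖ * (1 + J * (1 + B)) with hN
  have hN0 : 0 < N := by positivity
  -- The second entry lets the J expansion errors be absorbed by c ‖p - p₀‖, and the third makes the
  -- final bound at most ε/2. J + 1 avoids dividing by zero.
  set δ := min 1 (min (c / (2 * (J + 1))) (ε / (2 * N))) with hδ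
  have hδ0 : 0 < δ := by positivity
  have hδ1 : δ ≤ 1 := min_le_left _ _
  have hδc : J * δ ≤ c / 2 := by
    have h1 : δ ≤ c / (2 * (J + 1)) := (min_le_right _ _).trans (min_le_left _ _)
    calc (J : ℝ) * δ ≤ (J + 1) * (c / (2 * (J + 1))) := by gcongr; linarith
      _ = c / 2 := by field_simp
  have hδε : δ * N ≤ ε / 2 := by
    have h1 : δ ≤ ε / (2 * N) := (min_le_right _ _).trans (min_le_right _ _)
    calc δ * N ≤ ε / (2 * N) * N := by gcongr
      _ = ε / 2 := by field_simp
  obtain ⟨r, hr, hball⟩ := Metric.eventually_nhds_iff.mp (hlin δ hδ0)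
  have hpow : ∀ᶠ n : ℕ in atTop, (1 + M + J) * (2 / c) ≤ (n : ℝ) ^ (1 / 16 : ℝ) :=
    ((tendsto_rpow_atTop (by norm_num)).comp tendsto_natCast_atTop_atTop).eventually_ge_atTop _
  have hsmall : ∀ᶠ n : ℕ in atTop, (n : ℝ) ^ (-(3 / 8) : ℝ) < r :=
    ((tendsto_rpow_neg_atTop (by norm_num)).comp tendsto_natCast_atTop_atTop).eventually_lt_const hr
  have hev : HighProb P fun n => {ω | √(n : ℝ) * ‖A n ω‖ ≤ M → ‖√(n : ℝ) * R n ω‖ < ε} := by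
    refine ((((hDy.sharp δ hδ0).inter (HighProb.iInter fun j => (hDd j).sharp δ hδ0)).inter
      (HighProb.iInter fun j => (hDd j).rough δ hδ0)).inter (hG.inter (hGA.inter hR))).mono ?_
    filter_upwards [hpow, hsmall, hρ.eventually_lt_const hδ0, eventually_ge_atTop 1] with
      n hn1 hn2 hn3 hn4 ω hω hAM
    obtain ⟨⟨⟨g1, g2⟩, g3⟩, ⟨hpS, g4⟩, g5, g6⟩ := hω
    simp only [Set.mem_iInter, Set.mem_ofPred_eq] at g1 g2 g3 g5 g6 ⊢
    have hs : 0 ≤ √(n : ℝ) := Real.sqrt_nonneg _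
    have hcx := hlow _ hpS
    have hx0 : 0 ≤ ‖p n ω - p₀‖ := norm_nonneg _
    -- The rough errors place the cutoffs in the neighbourhood where the sharp errors become
    -- available.
    have hxn := le_rpow_of_eq_add hn4 (g5 hpS) hc hx0 hcx g4 hn3.le hAM hδ1 hδc hM0
      (fun j => g3 j hpS) hn1
    have hxB := sqrt_mul_le_of_eq_add (g5 hpS) hc hx0 hcx g4 hn3.le hAM hδ1 hδc
      (fun j => g2 j hpS hxn)
    have hlinp := hball (y := p n ω) (by rw [dist_eq_norm]; exact hxn.trans_lt hn2)
    have hfin := sqrt_mul_abs_le_of_eq_add (g5 hpS) g4 hn3.le hδ0 hxB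
      (fun j => g2 j hpS hxn) (g1 hpS hxn) hlinp
    rw [Real.norm_eq_abs, abs_mul, abs_of_nonneg hs, g6]
    linarith
  filter_upwards [hM, hev.eventually_lt_const (ENNReal.half_pos ha.ne')] with n h1 h2
  calc P {ω | ε ≤ ‖√(n : ℝ) * R n ω - 0‖}
      ≤ P ({ω | M < √(n : ℝ) * ‖A n ω‖} ∪
          {ω | √(n : ℝ) * ‖A n ω‖ ≤ M → ‖√(n : ℝ) * R n ω‖ < ε}ᶜ) := by
        refine measure_mono fun ω hω => ?_
        simp only [Set.mem_ofPred_eq, sub_zero, Set.mem_union, Set.mem_compl_iff] at hω ⊢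
        by_cases hA' : M < √(n : ℝ) * ‖A n ω‖
        · exact Or.inl hA'
        · exact Or.inr fun h => absurd (h (not_lt.mp hA')) (not_lt.mpr hω)
    _ ≤ a / 2 + a / 2 := (measure_union_le _ _).trans (add_le_add h1 h2.le)
    _ = a := ENNReal.add_halves a

/-! ### Smoothness of the population functions -/

/-- Directional derivatives are limits of difference quotients with step 1/m, with m shifted so that
all points stay in the ball where f is measurable in a. The derivative is a finite combination of
them. -/
lemma measurable_fderiv_of_measurable {α : Type*} [MeasurableSpace α] {J : ℕ} {f : α → Vec J → ℝ}
    {p₀ : Vec J} {r : ℝ} (hr : 0 < r) (hm : ∀ p ∈ Metric.ball p₀ r, Measurable fun a => f a p)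
    (hd : ∀ a, DifferentiableAt ℝ (f a) p₀) : Measurable fun a => fderiv ℝ (f a) p₀ := by
  have hcoord : ∀ x : Vec J, Measurable fun a => fderiv ℝ (f a) p₀ x := by
    intro x
    have hlim : ∀ a, Tendsto (fun m : ℕ =>
        (m : ℝ) • (f a (p₀ + (m : ℝ)⁻¹ • x) - f a p₀)) atTop (𝓝 (fderiv ℝ (f a) p₀ x)) := by
      intro a
      have h := (hd a).hasFDerivAt.lim_real x
      exact h.comp tendsto_natCast_atTop_atTop
    obtain ⟨m₀, hm₀⟩ := exists_nat_gt (‖x‖ / r)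
    have hball : ∀ m : ℕ, p₀ + ((m + (m₀ + 1) : ℕ) : ℝ)⁻¹ • x ∈ Metric.ball p₀ r := by
      intro m
      have hpos : (0 : ℝ) < ((m + (m₀ + 1) : ℕ) : ℝ) := by positivity
      rw [Metric.mem_ball, dist_eq_norm, add_sub_cancel_left, norm_smul, norm_inv,
        Real.norm_of_nonneg hpos.le, inv_mul_lt_iff₀ hpos]
      rw [div_lt_iff₀ hr] at hm₀
      refine hm₀.trans_le ?_
      gcongr
      linarith [(Nat.cast_nonneg m : (0 : ℝ) ≤ m)]
    refine measurable_of_tendsto_metrizable (f := fun (m : ℕ) a =>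
      ((m + (m₀ + 1) : ℕ) : ℝ) • (f a (p₀ + ((m + (m₀ + 1) : ℕ) : ℝ)⁻¹ • x) - f a p₀))
      (fun m => ?_) (tendsto_pi_nhds.mpr fun a =>
        (hlim a).comp (tendsto_add_atTop_nat (m₀ + 1)))
    exact ((hm _ (hball m)).sub (hm _ (Metric.mem_ball_self hr))).const_smul
      (((m + (m₀ + 1) : ℕ) : ℝ))
  have hrep : (fun a => fderiv ℝ (f a) p₀) = fun a => ∑ j : Fin J,
      (fderiv ℝ (f a) p₀ (EuclideanSpace.single j 1)) •
        (EuclideanSpace.proj j : Vec J →L[ℝ] ℝ) := by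
    funext a
    refine ContinuousLinearMap.ext fun x => ?_
    have hx : x = ∑ j : Fin J, x j • EuclideanSpace.single j (1 : ℝ) := by
      ext i
      simp [Finset.sum_apply, Pi.single_apply]
    conv_lhs => rw [hx, map_sum]
    rw [sum_apply]
    refine Finset.sum_congr rfl fun j _ => ?_
    simp [mul_comm]
  rw [hrep]
  exact Finset.measurable_sum _ fun j _ => (hcoord _).smul_const _

lemma differentiableAt_integral_mul {α : Type*} [MeasurableSpace α] {Q : Measure α}
    [IsProbabilityMeasure Q] {J : ℕ} {g : α → ℝ} (hg : Measurable g) (hg1 : ∀ a, |g a| ≤ 1)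
    {f : α → Vec J → ℝ} {p₀ : Vec J} {r : ℝ} (hr : 0 < r)
    (hm : ∀ p ∈ Metric.ball p₀ r, Measurable fun a => f a p)
    (hd : ∀ a, ∀ p ∈ Metric.ball p₀ r, DifferentiableAt ℝ (f a) p) {c : ℝ}
    (hc : ∀ a, ∀ p ∈ Metric.ball p₀ r, ‖fderiv ℝ (f a) p‖ ≤ c)
    (hi : Integrable (fun a => g a * f a p₀) Q) :
    DifferentiableAt ℝ (fun p => ∫ a, g a * f a p ∂Q) p₀ := by
  have hball := Metric.ball_mem_nhds p₀ hr
  refine (hasFDerivAt_integral_of_dominated_of_fderiv_le (F := fun p a => g a * f a p)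
    (F' := fun p a => g a • fderiv ℝ (f a) p) (bound := fun _ => 1 * c) hball ?_ hi ?_ ?_ ?_
    ?_).differentiableAt
  · filter_upwards [hball] with p hp
    exact (hg.mul (hm p hp)).aestronglyMeasurable
  · exact (hg.smul (measurable_fderiv_of_measurable hr hm
      fun a => hd a p₀ (Metric.mem_ball_self hr))).aestronglyMeasurable
  · refine Eventually.of_forall fun a p hp => ?_
    rw [norm_smul]
    exact mul_le_mul (hg1 a) (hc a p hp) (norm_nonneg _) zero_le_one
  · exact integrable_const _
  · exact Eventually.of_forall fun a p hp => (hd a p hp).hasFDerivAt.const_mul (g a)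

namespace RegularResponse

variable {𝒳 𝓑 : Type*} [MeasurableSpace 𝒳] [MeasurableSpace 𝓑] {J : ℕ}
  {Q : Measure (Rec 𝒳 𝓑)} {S : Set (Vec J)} {p₀ : Vec J} {e : 𝒳 → ℝ}
  {v : 𝓑 → Vec J → ℝ} {μ : Bool → 𝒳 → Vec J → ℝ} {κ K L C h : ℝ}

/-- The response itself may jump in p. Its mean equals a mixture of the conditional means, which are
smooth, and only that representation is differentiated under the integral. -/
lemma differentiableAt_meanResp (H : RegularResponse Q S p₀ e v μ κ K L C h)
    [IsProbabilityMeasure Q] {π : 𝒳 → ℝ} (hπ : IsRule π) {r c : ℝ} (hr : 0 < r)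
    (hball : Metric.ball p₀ r ⊆ S)
    (hd : ∀ w x, ∀ p ∈ Metric.ball p₀ r, DifferentiableAt ℝ (μ w x) p)
    (hc : ∀ w x, ∀ p ∈ Metric.ball p₀ r, ‖fderiv ℝ (μ w x) p‖ ≤ c) :
    DifferentiableAt ℝ (meanResp Q v π) p₀ := by
  have hb : ∀ w x, |armProb π w x| ≤ 1 := fun w x => by
    have := armProb_mem hπ.2 w x; rw [abs_of_nonneg this.1]; exact this.2
  have h1 : DifferentiableAt ℝ
      (fun p => ∑ w, ∫ r : Rec 𝒳 𝓑, armProb π w r.1 * μ w r.1 p ∂Q) p₀ := by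
    refine DifferentiableAt.fun_sum fun w _ => ?_
    exact differentiableAt_integral_mul ((measurable_armProb hπ.1 w).comp measurable_fst)
      (fun a => hb w a.1) hr (fun p hp => (H.measurable_mu w p (hball hp)).comp measurable_fst)
      (fun a p hp => hd w a.1 p hp) (fun a p hp => hc w a.1 p hp)
      (H.integrable_bdd_mul_mu (measurable_armProb hπ.1 w) (hb w) w H.mem_S)
  refine h1.congr_of_eventuallyEq ?_
  filter_upwards [Metric.ball_mem_nhds p₀ hr] with p hp
  exact H.meanResp_eq hπ (hball hp)

lemma abs_meanResp_sub_le [IsProbabilityMeasure Q] (hv : Measurable fun q : 𝓑 × Vec J => v q.1 q.2)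
    (hK : ∀ b, ∀ p ∈ S, |v b p| ≤ K) {π : 𝒳 → ℝ} (hπ : IsRule π) {p p' : Vec J} (hp : p ∈ S)
    (hp' : p' ∈ S) {a : ℝ} (ha : 0 ≤ a)
    (hL : ∀ w, ∫ r : Rec 𝒳 𝓑, (v (r.pot w) p - v (r.pot w) p') ^ 2 ∂Q ≤ a) :
    |meanResp Q v π p - meanResp Q v π p'| ≤ 2 * √a := by
  have hb : ∀ w x, |armProb π w x| ≤ 1 := fun w x => by
    have := armProb_mem hπ.2 w x; rw [abs_of_nonneg this.1]; exact this.2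
  have hvp : ∀ p w, Measurable fun r : Rec 𝒳 𝓑 => v (r.pot w) p := fun p w =>
    (hv.comp (measurable_id.prodMk measurable_const)).comp (measurable_pot w)
  have hint : ∀ q ∈ S, ∀ w, Integrable (fun r : Rec 𝒳 𝓑 => armProb π w r.1 * v (r.pot w) q) Q := by
    intro q hq w
    refine Integrable.of_bound (C := 1 * K) (((measurable_armProb hπ.1 w).comp
      measurable_fst).mul (hvp q w)).aestronglyMeasurable (Eventually.of_forall fun r => ?_)
    rw [Real.norm_eq_abs, abs_mul]
    exact mul_le_mul (hb _ _) (hK _ q hq) (abs_nonneg _) zero_le_one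
  have hw : ∀ w, |∫ r : Rec 𝒳 𝓑, armProb π w r.1 * (v (r.pot w) p - v (r.pot w) p') ∂Q| ≤ √a := by
    intro w
    have hdm : Measurable fun r : Rec 𝒳 𝓑 => v (r.pot w) p - v (r.pot w) p' :=
      (hvp p w).sub (hvp p' w)
    have hd2 : MemLp (fun r : Rec 𝒳 𝓑 => v (r.pot w) p - v (r.pot w) p') 2 Q :=
      MemLp.of_bound hdm.aestronglyMeasurable (K + K) (Eventually.of_forall fun r =>
        (abs_sub _ _).trans (add_le_add (hK _ p hp) (hK _ p' hp')))
    have hg2 : MemLp (fun r : Rec 𝒳 𝓑 => armProb π w r.1) 2 Q :=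
      MemLp.of_bound ((measurable_armProb hπ.1 w).comp measurable_fst).aestronglyMeasurable 1
        (Eventually.of_forall fun r => hb w r.1)
    have hone : ∫ r : Rec 𝒳 𝓑, armProb π w r.1 ^ 2 ∂Q ≤ 1 ^ 2 := by
      have h1 : ∫ r : Rec 𝒳 𝓑, armProb π w r.1 ^ 2 ∂Q ≤ ∫ _ : Rec 𝒳 𝓑, (1 : ℝ) ∂Q := by
        refine integral_mono hg2.integrable_sq (integrable_const _) fun r => ?_
        have := hb w r.1
        change armProb π w r.1 ^ 2 ≤ 1
        rw [← sq_abs]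
        exact pow_le_one₀ (abs_nonneg _) this
      simpa using h1
    have := integral_abs_mul_le hg2 hd2 zero_le_one (Real.sqrt_nonneg a) hone
      (by rw [Real.sq_sqrt ha]; exact hL w)
    refine (abs_integral_le_integral_abs).trans ?_
    simpa only [abs_mul, one_mul] using this
  have heq : meanResp Q v π p - meanResp Q v π p'
      = ∑ w, ∫ r : Rec 𝒳 𝓑, armProb π w r.1 * (v (r.pot w) p - v (r.pot w) p') ∂Q := by
    unfold meanResp
    rw [integral_finsetSum _ fun w _ => hint p hp w, integral_finsetSum _ fun w _ => hint p' hp' w,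
      ← Finset.sum_sub_distrib]
    refine Finset.sum_congr rfl fun w _ => ?_
    rw [← integral_sub (hint p hp w) (hint p' hp' w)]
    simp only [mul_sub]
  rw [heq]
  refine (Finset.abs_sum_le_sum_abs _ _).trans ((Finset.sum_le_sum fun w _ => hw w).trans ?_)
  simp

/-- Compactness arguments need continuity on all of S, boundary included, where the conditional
means are not assumed smooth; L² continuity in the cutoffs suffices. -/
lemma continuousOn_meanResp [IsProbabilityMeasure Q]
    (hv : Measurable fun q : 𝓑 × Vec J => v q.1 q.2) (hK : ∀ b, ∀ p ∈ S, |v b p| ≤ K)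
    {π : 𝒳 → ℝ} (hπ : IsRule π) (hL0 : 0 ≤ L)
    (hL : ∀ w, ∀ p ∈ S, ∀ p' ∈ S,
      ∫ r : Rec 𝒳 𝓑, (v (r.pot w) p - v (r.pot w) p') ^ 2 ∂Q ≤ L * ‖p - p'‖) :
    ContinuousOn (meanResp Q v π) S := by
  intro p' hp'
  rw [ContinuousWithinAt, tendsto_iff_norm_sub_tendsto_zero]
  have h0 : Tendsto (fun p => 2 * √(L * ‖p - p'‖)) (𝓝[S] p') (𝓝 0) := by
    have : Continuous fun p : Vec J => 2 * √(L * ‖p - p'‖) := by fun_prop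
    simpa using (this.tendsto p').mono_left nhdsWithin_le_nhds
  refine tendsto_of_tendsto_of_tendsto_of_le_of_le' tendsto_const_nhds h0
    (Eventually.of_forall fun _ => norm_nonneg _) ?_
  filter_upwards [self_mem_nhdsWithin] with p hp
  exact abs_meanResp_sub_le hv hK hπ hp hp' (by positivity) fun w => hL w p hp p' hp'

end RegularResponse

namespace Model

variable {Ω 𝒳 𝓑 : Type*} [MeasurableSpace Ω] [MeasurableSpace 𝒳] [MeasurableSpace 𝓑] {J : ℕ}
  (M : Model Ω 𝒳 𝓑 J)

lemma measurable_sum_armProb_mul {π : 𝒳 → ℝ} (hπ : IsRule π) {v : 𝓑 → Vec J → ℝ}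
    (hv : Measurable fun q : 𝓑 × Vec J => v q.1 q.2) (p : Vec J) :
    Measurable fun r : Rec 𝒳 𝓑 => ∑ w, armProb π w r.1 * v (r.pot w) p :=
  Finset.measurable_sum _ fun w _ => ((measurable_armProb hπ.1 w).comp measurable_fst).mul
    ((hv.comp (measurable_id.prodMk measurable_const)).comp (measurable_pot w))

lemma measurable_d_apply (j : Fin J) : Measurable fun q : 𝓑 × Vec J => M.d q.1 q.2 j :=
  (EuclideanSpace.proj j : Vec J →L[ℝ] ℝ).continuous.measurable.comp M.measurable_d

lemma meanOutcome_eq {π : 𝒳 → ℝ} (hπ : IsRule π) :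
    M.meanOutcome π = RegularResponse.meanResp M.lawRec M.y π := by
  funext p
  rw [RegularResponse.meanResp, M.integral_lawRec (measurable_sum_armProb_mul hπ M.measurable_y p)]
  simp_rw [pot_participant]
  rfl

lemma netDemand_apply {π : 𝒳 → ℝ} (hπ : IsRule π) {p : Vec J} {K : ℝ}
    (hK : ∀ b, ‖M.d b p‖ ≤ K) (j : Fin J) :
    M.netDemand π p j
      = RegularResponse.meanResp M.lawRec (fun b p => M.d b p j) π p - M.sStar j := by
  have := M.isProb
  have hb : ∀ w x, |armProb π w x| ≤ 1 := fun w x => by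
    have := armProb_mem hπ.2 w x; rw [abs_of_nonneg this.1]; exact this.2
  have hint : Integrable (fun ω => ∑ w, armProb π w (M.X 0 ω) • M.d (M.B w 0 ω) p) M.P := by
    refine integrable_finsetSum _ fun w _ => ?_
    refine Integrable.of_bound (C := 1 * K) ?_ (Eventually.of_forall fun ω => ?_)
    · exact (((measurable_armProb hπ.1 w).comp (M.measurable_X 0)).smul
        (M.measurable_d.comp ((M.measurable_B w 0).prodMk measurable_const))).aestronglyMeasurable
    · rw [norm_smul]
      exact mul_le_mul (hb _ _) (hK _) (norm_nonneg _) zero_le_one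
  have h1 := (EuclideanSpace.proj j : Vec J →L[ℝ] ℝ).integral_comp_comm hint
  rw [RegularResponse.meanResp,
    M.integral_lawRec (measurable_sum_armProb_mul hπ (v := fun b p => M.d b p j)
      (M.measurable_d_apply j) p)]
  simp_rw [pot_participant]
  rw [netDemand, PiLp.sub_apply]
  congr 1
  refine Eq.trans h1.symm ?_
  refine integral_congr_ae (Eventually.of_forall fun ω => ?_)
  simp [participant]

lemma continuousOn_netDemand {π : 𝒳 → ℝ} (hπ : IsRule π) {K L : ℝ}
    (hK : ∀ b, ∀ p ∈ M.S, ‖M.d b p‖ ≤ K) (hL0 : 0 ≤ L)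
    (hL : ∀ w, ∀ p ∈ M.S, ∀ p' ∈ M.S, ∀ j,
      ∫ ω, (M.d (M.B w 0 ω) p j - M.d (M.B w 0 ω) p' j) ^ 2 ∂M.P ≤ L * ‖p - p'‖) :
    ContinuousOn (M.netDemand π) M.S := by
  have := M.isProbabilityMeasure_lawRec
  have hj : ∀ j, ContinuousOn (fun p => M.netDemand π p j) M.S := by
    intro j
    have h1 : ContinuousOn (fun p => RegularResponse.meanResp M.lawRec (fun b p => M.d b p j) π p
        - M.sStar j) M.S := by
      refine ContinuousOn.sub ?_ continuousOn_const
      refine RegularResponse.continuousOn_meanResp (K := K) (M.measurable_d_apply j)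
        (fun b p hp => (PiLp.norm_apply_le _ j).trans (hK b p hp)) hπ hL0 fun w p hp p' hp' => ?_
      rw [M.integral_lawRec]
      · simp_rw [pot_participant]
        exact hL w p hp p' hp' j
      · exact ((((M.measurable_d_apply j).comp (measurable_id.prodMk measurable_const)).comp
          (measurable_pot w)).sub (((M.measurable_d_apply j).comp
          (measurable_id.prodMk measurable_const)).comp (measurable_pot w))).pow_const 2
    exact h1.congr fun p hp => M.netDemand_apply hπ (fun b => hK b p hp) j
  have h2 : ContinuousOn (fun p => (M.netDemand π p).ofLp) M.S := continuousOn_pi.mpr hj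
  exact (PiLp.continuous_toLp 2 _).comp_continuousOn h2

/-- Positivity of the singular values makes the Jacobian of net demand injective and non-trivial. -/
lemma hasFDerivAt_of_singularValues_pos {z : Vec J → Vec J} {p : Vec J}
    (h : ∀ i < J, 0 < (fderiv ℝ z p).toLinearMap.singularValues i) :
    HasFDerivAt z (fderiv ℝ z p) p ∧ Function.Injective (fderiv ℝ z p) := by
  have hinj : Function.Injective (fderiv ℝ z p) := by
    have : Function.Injective (fderiv ℝ z p).toLinearMap := by
      rw [LinearMap.injective_iff_forall_lt_finrank_singularValues_pos]
      simpa using h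
    exact this
  refine ⟨?_, hinj⟩
  -- Differentiability comes for free: where it fails, `fderiv` is zero by default, and the zero map
  -- is injective only if J = 0.
  rcases Nat.eq_zero_or_pos J with rfl | hJ
  · exact (hasFDerivAt_of_subsingleton z p).congr_fderiv (Subsingleton.elim _ _)
  · by_contra hcon
    have hnd : ¬ DifferentiableAt ℝ z p := fun hd => hcon hd.hasFDerivAt
    rw [fderiv_zero_of_not_differentiableAt hnd] at hinj
    have : Nontrivial (Vec J) := by
      have : Nonempty (Fin J) := ⟨⟨0, hJ⟩⟩
      infer_instance
    obtain ⟨x, hx⟩ := exists_ne (0 : Vec J)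
    exact hx (hinj (by simp))

end Model

/-! ### The estimators of outcomes and allocations -/

namespace Study

variable {Ω 𝒳 𝓑 Z : Type*} [MeasurableSpace Ω] [MeasurableSpace 𝒳] [MeasurableSpace 𝓑]
  [MeasurableSpace Z] {J : ℕ} (T : Study Ω 𝒳 𝓑 Z J)

lemma tendsto_sqrt_mul_of_isLittleO {f : ℕ → ℝ}
    (hf : f =o[atTop] fun n : ℕ => (√(n : ℝ))⁻¹) :
    Tendsto (fun n : ℕ => √(n : ℝ) * f n) atTop (𝓝 0) := by
  refine hf.tendsto_div_nhds_zero.congr fun n => ?_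
  rw [div_inv_eq_mul, mul_comm]

/-- The expansion for a scalar response whose conditional means are part of the nuisance
functions. -/
lemma isExpansionError_response {η : Nuisance 𝒳 J} (hη : T.IsTrueNuisance η)
    (hId : T.Identification η) {κ : ℝ} (hκ0 : 0 < κ)
    (hover : ∀ n k, ∀ᵐ ω ∂T.P, ∀ᵐ x ∂T.lawX, T.eHat n k ω x ∈ Set.Ioo κ (1 - κ))
    {pStar : (𝒳 → ℝ) → Vec J} {π : 𝒳 → ℝ} (hπ : IsRule π) {rhoMu rhoE rhoTheta : ℕ → ℝ}
    (h0 : ∀ n, 0 ≤ rhoMu n ∧ 0 ≤ rhoE n ∧ 0 ≤ rhoTheta n) (hE0 : Tendsto rhoE atTop (𝓝 0))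
    (hMθ : Tendsto (fun n => rhoMu n + rhoTheta n) atTop (𝓝 0))
    (hEM : (fun n => rhoE n * rhoMu n) =o[atTop] (fun n : ℕ => (√(n : ℝ))⁻¹))
    (hEθ : (fun n => rhoE n * rhoTheta n) =o[atTop] (fun n : ℕ => (√(n : ℝ))⁻¹))
    (hfit : ∀ k, HighProb T.P fun n => T.goodFit η pStar (rhoMu n) (rhoE n) (rhoTheta n) π n k)
    (hS : IsCompact T.S) {c₁ : ℝ} (hc₁ : 0 < c₁) (hball : Metric.ball (pStar π) c₁ ⊆ T.S)
    {v : 𝓑 → Vec J → ℝ} {μ : Bool → 𝒳 → Vec J → ℝ} (hv : Measurable fun q : 𝓑 × Vec J => v q.1 q.2)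
    {K L C h c' : ℝ} (hK0 : 0 ≤ K) (hL0 : 0 ≤ L) (hC0 : 0 ≤ C) (hh0 : 0 ≤ h) (hc' : 0 ≤ c')
    (hK : ∀ b, ∀ p ∈ T.S, |v b p| ≤ K) (hμm : ∀ w, ∀ p ∈ T.S, Measurable fun x => μ w x p)
    (hμ : ∀ w, ∀ p ∈ T.S, (fun ω => μ w (T.X 0 ω) p) =ᵐ[T.P]
      T.P[fun ω => v (T.B w 0 ω) p | MeasurableSpace.comap (T.X 0) inferInstance])
    (hlip : ∀ w x, ∀ p ∈ Metric.ball (pStar π) c₁, |μ w x p - μ w x (pStar π)| ≤ c' * ‖p - pStar π‖)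
    (hL : ∀ w, ∀ p ∈ T.S, ∫ ω, (v (T.B w 0 ω) p - v (T.B w 0 ω) (pStar π)) ^ 2 ∂T.P
      ≤ L * ‖p - pStar π‖)
    (hcov : PolynomialCovering ((fun p b => v b p) '' T.S) C h)
    {mh : Fin 3 → (n : ℕ) → Z → (Fin n → Rec 𝒳 𝓑) → Bool → 𝒳 → ℝ}
    (hm : ∀ k n w, Measurable fun q : (Z × (Fin n → Rec 𝒳 𝓑)) × 𝒳 => mh k n q.1.1 q.1.2 w q.2)
    (hmI : ∀ k n z, IndepOfCoords (T.recI k n z) (mh k n z))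
    (hmh : ∀ k n ω w x, |mh k n (T.seed ω) (T.sample n ω) w x - μ w x (T.pTilde π n k ω)|
      ≤ √((T.muYHat π n k ω w x - η.muY w x (T.pTilde π n k ω)) ^ 2 +
          ‖T.muDHat π n k ω w x - η.muD w x (T.pTilde π n k ω)‖ ^ 2)) :
    RegularResponse T.lawRec T.S (pStar π) (fun x => clip κ (η.e x)) v μ κ K (L + c' + 2 * K / c₁)
      C h ∧
    IsExpansionError T.P T.S (pStar π) (T.pHat π) fun n ω =>
      (n : ℝ)⁻¹ * scoreDiff π (fun x => clip κ (η.e x)) v μ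
          (fun k => T.clippedEHat κ k n (T.seed ω) (T.sample n ω))
          (fun k => mh k n (T.seed ω) (T.sample n ω)) (T.foldOf n ω) (pStar π) (T.pHat π n ω)
          (T.sample n ω)
        - (RegularResponse.meanResp T.lawRec v π (T.pHat π n ω)
          - RegularResponse.meanResp T.lawRec v π (pStar π)) := by
  have hM0 : Tendsto rhoMu atTop (𝓝 0) := squeeze_zero (fun n => (h0 n).1)
    (fun n => le_add_of_nonneg_right (h0 n).2.2) hMθ
  have hθ0 : Tendsto rhoTheta atTop (𝓝 0) := squeeze_zero (fun n => (h0 n).2.2)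
    (fun n => le_add_of_nonneg_left (h0 n).1) hMθ
  obtain ⟨hκ, heq⟩ := T.ae_propensity_mem hη.measurable_e 0 (fun n => hover n 0) hE0
    ((hfit 0).mono (Eventually.of_forall fun n ω hω => hω.2.1))
  have hee : ∀ᵐ r ∂T.lawRec, clip κ (η.e r.1) = η.e r.1 := by
    rw [← T.map_fst_lawRec] at heq
    exact ae_of_ae_map measurable_fst.aemeasurable heq
  have H : RegularResponse T.lawRec T.S (pStar π) (fun x => clip κ (η.e x)) v μ κ K
      (L + c' + 2 * K / c₁) C h :=
    T.regularResponse hη hId hκ0 ((measurable_clip κ).comp hη.measurable_e)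
      (fun x => clip_mem hκ _) hee hS.measurableSet hc₁ hball hv hK0 hL0 hC0 hh0 hc' hK hμm hμ hlip
      hL hcov
  refine ⟨H, T.isExpansionError_scoreDiff hId H hκ hπ hm hmI (ρ := fun n => 2 * rhoE n)
    (ρ' := fun n => 2 * (rhoMu n + c' * rhoTheta n)) (fun n => ?_) (fun n => ?_) ?_ ?_ ?_
    (fun k => T.highProb_isGoodFit hη.measurable_e h0 hθ0 (hfit k)
      (fun w => hμm w _ H.mem_S) hc₁ hc' hlip (hm k) (hmh k)) hS.isBounded⟩
  · have := (h0 n).2.1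
    positivity
  · obtain ⟨h1, h2, h3⟩ := h0 n
    positivity
  · simpa using hE0.const_mul 2
  · simpa using (hM0.add (hθ0.const_mul c')).const_mul 2
  -- The product of the two doubled rates is 4 rhoE rhoMu + 4 c' rhoE rhoTheta, so both product
  -- conditions enter here.
  · have h1 := ((tendsto_sqrt_mul_of_isLittleO hEM).const_mul 4).add
      ((tendsto_sqrt_mul_of_isLittleO hEθ).const_mul (4 * c'))
    rw [mul_zero, mul_zero, add_zero] at h1
    refine h1.congr fun n => ?_
    ring

/-- The average of `n` centered square-integrable scores is of order `n ^ (-1 / 2)`. -/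
lemma exists_tight_average {η : Nuisance 𝒳 J} (hId : T.Identification η) {f : Rec 𝒳 𝓑 → ℝ}
    (hf : MemLp f 2 T.lawRec) {s : ℝ} (hs : ∫ r, f r ∂T.lawRec = s) {a : ℝ≥0∞} (ha : 0 < a) :
    ∃ M : ℝ, 0 ≤ M ∧ ∀ᶠ n : ℕ in atTop,
      T.P {ω | M < √(n : ℝ) * |(n : ℝ)⁻¹ * ∑ i, (f (T.sample n ω i) - s)|} ≤ a := by
  have := T.isProb
  have := T.isProbabilityMeasure_lawRec
  have := T.isProbabilityMeasure_seed
  set b := ∫ r, f r ^ 2 ∂T.lawRec with hb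
  have hlim : Tendsto (fun m : ℕ => ENNReal.ofReal (b / (m : ℝ) ^ 2)) atTop (𝓝 0) := by
    rw [← ENNReal.ofReal_zero]
    refine ENNReal.tendsto_ofReal (Tendsto.const_div_atTop ?_ b)
    exact (tendsto_pow_atTop (by norm_num)).comp tendsto_natCast_atTop_atTop
  -- Chebyshev at the threshold m √n leaves b/m², so m is taken large enough to bring this below a.
  obtain ⟨m, hm1, hm⟩ := ((eventually_ge_atTop 1).and (hlim.eventually_lt_const ha)).exists
  refine ⟨m, Nat.cast_nonneg _, ?_⟩
  filter_upwards [eventually_ge_atTop 1] with n hn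
  have hn0 : (0 : ℝ) < n := by exact_mod_cast hn
  have hm0 : (0 : ℝ) < m := by exact_mod_cast hm1
  have hsq : √(n : ℝ) * √(n : ℝ) = n := Real.mul_self_sqrt hn0.le
  have hs0 : 0 < √(n : ℝ) := Real.sqrt_pos.mpr hn0
  set E : Set (Fin n → Rec 𝒳 𝓑) := {u | m * √(n : ℝ) ≤ |∑ i, (f (u i) - s)|} with hE
  have hcheb := pi_abs_sum_sub_ge_le (Q := T.lawRec) (Finset.univ : Finset (Fin n)) hf
    (s := b) le_rfl (t := m * √(n : ℝ)) (by positivity)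
  rw [hs] at hcheb
  calc _ ≤ T.P ((fun ω => (T.seed ω, T.sample n ω)) ⁻¹' (Set.univ ×ˢ E)) := by
        refine measure_mono fun ω hω => ?_
        simp only [Set.mem_ofPred_eq] at hω
        refine ⟨Set.mem_univ _, ?_⟩
        rw [abs_mul, abs_of_pos (inv_pos.mpr hn0)] at hω
        have h1 : √(n : ℝ) * ((n : ℝ)⁻¹ * |∑ i, (f (T.sample n ω i) - s)|)
            = (√(n : ℝ))⁻¹ * |∑ i, (f (T.sample n ω i) - s)| := by
          nth_rewrite 2 [← hsq]
          field_simp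
        rw [h1, lt_inv_mul_iff₀ hs0] at hω
        change m * √(n : ℝ) ≤ |∑ i, (f (T.sample n ω i) - s)|
        linarith
    _ ≤ ((T.P.map T.seed).prod (Measure.pi fun _ : Fin n => T.lawRec)) (Set.univ ×ˢ E) := by
        rw [← T.map_seed_sample hId n]
        exact Measure.le_map_apply (T.measurable_seed_sample n).aemeasurable _
    _ ≤ ENNReal.ofReal (b / (m : ℝ) ^ 2) := by
        rw [Measure.prod_prod, measure_univ, one_mul]
        refine hcheb.trans (ENNReal.ofReal_le_ofReal (le_of_eq ?_))
        rw [mul_pow, sq (√(n : ℝ)), hsq]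
        simp only [Finset.card_univ, Fintype.card_fin]
        field_simp
    _ ≤ a := hm.le

lemma exists_tight_norm {A : ℕ → Ω → Vec J} (h : ∀ j, ∀ a : ℝ≥0∞, 0 < a → ∃ M : ℝ, 0 ≤ M ∧
      ∀ᶠ n : ℕ in atTop, T.P {ω | M < √(n : ℝ) * |A n ω j|} ≤ a) {a : ℝ≥0∞} (ha : 0 < a) :
    ∃ M : ℝ, 0 ≤ M ∧ ∀ᶠ n : ℕ in atTop, T.P {ω | M < √(n : ℝ) * ‖A n ω‖} ≤ a := by
  have ha' : 0 < a / (J + 1 : ℕ) := ENNReal.div_pos ha.ne' (ENNReal.natCast_ne_top _)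
  choose M hM0 hM using fun j => h j _ ha'
  refine ⟨∑ j, M j, Finset.sum_nonneg fun j _ => hM0 j, ?_⟩
  filter_upwards [eventually_all.mpr hM] with n hn
  calc _ ≤ T.P (⋃ j, {ω | M j < √(n : ℝ) * |A n ω j|}) := by
        refine measure_mono fun ω hω => ?_
        by_contra hcon
        simp only [Set.mem_iUnion, Set.mem_ofPred_eq, not_exists, not_lt] at hcon hω
        have h1 : √(n : ℝ) * ‖A n ω‖ ≤ ∑ j, √(n : ℝ) * |A n ω j| := by
          rw [← Finset.mul_sum]
          gcongr
          exact euclidean_norm_le_sum_abs _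
        linarith [Finset.sum_le_sum fun j (_ : j ∈ Finset.univ) => hcon j]
    _ ≤ ∑ j, T.P {ω | M j < √(n : ℝ) * |A n ω j|} := measure_iUnion_fintype_le _ _
    _ ≤ ∑ _j : Fin J, a / (J + 1 : ℕ) := Finset.sum_le_sum fun j _ => hn j
    _ = J * (a / (J + 1 : ℕ)) := by simp
    _ ≤ (J + 1 : ℕ) * (a / (J + 1 : ℕ)) := by
        gcongr
        exact Nat.le_succ J
    _ ≤ a := ENNReal.mul_div_le

end Study

/-! ### The estimators as averages of scalar scores, and the conclusion -/

lemma drScore_apply {J : ℕ} (w W : Bool) (e : ℝ) (μ v : Vec J) (j : Fin J) :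
    (drScore w W e μ v) j = drScore w W e (μ j) (v j) := by
  simp [drScore]

namespace Study

variable {Ω 𝒳 𝓑 Z : Type*} [MeasurableSpace Ω] [MeasurableSpace 𝒳] [MeasurableSpace 𝓑]
  [MeasurableSpace Z] {J : ℕ} (T : Study Ω 𝒳 𝓑 Z J)

/-- The average true net-demand score, with the propensity score `e`. -/
def netDemandScore (η : Nuisance 𝒳 J) (e : 𝒳 → ℝ) (π : 𝒳 → ℝ) (p : Vec J) (n : ℕ) (ω : Ω) :
    Vec J :=
  (n : ℝ)⁻¹ • ∑ i : Fin n, ((∑ w, armProb π w (T.X i ω) •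
    drScore w (T.W i ω) (e (T.X i ω)) (η.muD w (T.X i ω) p) (T.d (T.obsB i ω) p)) - T.sStar)

lemma netDemandScore_apply (η : Nuisance 𝒳 J) (e : 𝒳 → ℝ) (π : 𝒳 → ℝ) (p : Vec J) (n : ℕ) (ω : Ω)
    (j : Fin J) : T.netDemandScore η e π p n ω j = (n : ℝ)⁻¹ * ∑ i, (recScore π e
      (fun w x => η.muD w x p j) (T.d (T.sample n ω i).obs p j) (T.sample n ω i) - T.sStar j) := by
  simp only [netDemandScore, PiLp.smul_apply, WithLp.ofLp_sum, Finset.sum_apply, PiLp.sub_apply,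
    smul_eq_mul, drScore_apply, recScore, sample, Model.obs_participant]
  rfl

section Sample

variable {κ : ℝ} {n : ℕ} {ω : Ω}
  (h : ∀ i : Fin n, T.eHat n (T.foldOf n ω i) ω (T.X i ω) ∈ Set.Ioo κ (1 - κ))

include h in
lemma clippedEHat_eq (i : Fin n) :
    T.clippedEHat κ (T.foldOf n ω i) n (T.seed ω) (T.sample n ω) (T.X i ω)
      = T.eHat n (T.foldOf n ω i) ω (T.X i ω) :=
  clip_eq ⟨(h i).1.le, (h i).2.le⟩

include h in
lemma vHat_eq_sum_recScore (π : 𝒳 → ℝ) :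
    T.vHat π n ω = (n : ℝ)⁻¹ * ∑ i : Fin n, recScore π
      (T.clippedEHat κ (T.foldOf n ω i) n (T.seed ω) (T.sample n ω))
      (T.recMuY π n (T.foldOf n ω i) (T.seed ω) (T.sample n ω))
      (T.y (T.sample n ω i).obs (T.pHat π n ω)) (T.sample n ω i) := by
  unfold vHat recScore
  congr 1
  refine Finset.sum_congr rfl fun i _ => Finset.sum_congr rfl fun w _ => ?_
  have h1 := T.clippedEHat_eq h i
  have h2 : Rec.obs (T.sample n ω i) = T.obsB i ω := T.obs_participant i ω
  change _ = armProb π w (T.X i ω) * drScore w (T.W i ω)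
    (T.clippedEHat κ (T.foldOf n ω i) n (T.seed ω) (T.sample n ω) (T.X i ω))
    (T.recMuY π n (T.foldOf n ω i) (T.seed ω) (T.sample n ω) w (T.X i ω)) _
  rw [h1, h2, muYHat_eq]

include h in
lemma netDemandHat_apply (π : 𝒳 → ℝ) (p : Vec J) (j : Fin J) :
    T.netDemandHat π n ω p j = (n : ℝ)⁻¹ * ∑ i : Fin n, recScore π
      (T.clippedEHat κ (T.foldOf n ω i) n (T.seed ω) (T.sample n ω))
      (fun w x => T.recMuD π n (T.foldOf n ω i) (T.seed ω) (T.sample n ω) w x j)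
      (T.d (T.sample n ω i).obs p j) (T.sample n ω i) - T.sStar j := by
  simp only [netDemandHat, PiLp.sub_apply, PiLp.smul_apply, WithLp.ofLp_sum, Finset.sum_apply,
    smul_eq_mul, drScore_apply]
  unfold recScore
  congr 2
  refine Finset.sum_congr rfl fun i _ => Finset.sum_congr rfl fun w _ => ?_
  have h1 := T.clippedEHat_eq h i
  have h2 : Rec.obs (T.sample n ω i) = T.obsB i ω := T.obs_participant i ω
  change _ = armProb π w (T.X i ω) * drScore w (T.W i ω)
    (T.clippedEHat κ (T.foldOf n ω i) n (T.seed ω) (T.sample n ω) (T.X i ω))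
    (T.recMuD π n (T.foldOf n ω i) (T.seed ω) (T.sample n ω) w (T.X i ω) j) _
  rw [h1, h2, muDHat_eq]

end Sample

/-- By linearity ν passes through the average, so the correction in the efficient score is ν applied
to the average net-demand score. The hypothesis allows a truncated propensity score that agrees with
the true one at the sample points. -/
lemma sum_efficientScore {η : Nuisance 𝒳 J} {e : 𝒳 → ℝ} {π : 𝒳 → ℝ} {p : Vec J} {n : ℕ} {ω : Ω}
    (h : ∀ i : Fin n, e (T.X i ω) = η.e (T.X i ω)) :
    (n : ℝ)⁻¹ * ∑ i : Fin n, T.efficientScore η π p i ω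
      = (n : ℝ)⁻¹ * ∑ i : Fin n, recScore π e (fun w x => η.muY w x p)
          (T.y (T.sample n ω i).obs p) (T.sample n ω i)
        - T.nu π p (T.netDemandScore η e π p n ω) := by
  unfold netDemandScore
  rw [map_smul, map_sum, smul_eq_mul, ← mul_sub, ← Finset.sum_sub_distrib]
  congr 1
  refine Finset.sum_congr rfl fun i _ => ?_
  have h2 : Rec.obs (T.sample n ω i) = T.obsB i ω := T.obs_participant i ω
  unfold recScore
  change _ = (∑ w, armProb π w (T.X i ω) * drScore w (T.W i ω) (e (T.X i ω))
    (η.muY w (T.X i ω) p) _) - _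
  rw [h2, h i]
  rfl

lemma ae_forall_covariate {η : Nuisance 𝒳 J} (hId : T.Identification η) {q : 𝒳 → Prop}
    (h : ∀ᵐ x ∂T.lawX, q x) : ∀ᵐ ω ∂T.P, ∀ i, q (T.X i ω) := by
  refine ae_all_iff.mpr fun i => ?_
  have h1 := (hId.identDistrib i).comp measurable_fst
  have h2 : T.P.map (T.X i) = T.lawX := h1.map_eq
  rw [← h2] at h
  exact ae_of_ae_map (T.measurable_X i).aemeasurable h

/-- The estimated value of a rule is, up to `o_p(n ^ (-1 / 2))`, the average of the efficient scores
at the continuum cutoffs. -/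
theorem tendstoInMeasure_vHat (Pol : Set (𝒳 → ℝ)) (hPol : ∀ π ∈ Pol, IsRule π)
    (η : Nuisance 𝒳 J) (hη : T.IsTrueNuisance η)
    (pStar : (𝒳 → ℝ) → Vec J) (c' c₃ c₄ : ℝ)
    (hId : T.Identification η)
    (hOut : T.RegularOutcomes Pol η pStar c' c₃ c₄)
    (hEq : T.RegularEquilibrium Pol pStar c' c₃)
    (hNuis : T.NuisanceConditions Pol η pStar) :
    ∀ π ∈ Pol, TendstoInMeasure T.P
      (fun (n : ℕ) ω => √(n : ℝ) * (T.vHat π n ω -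
        (n : ℝ)⁻¹ * ∑ i : Fin n, T.efficientScore η π (pStar π) i ω))
      atTop (fun _ => 0) := by
  intro π hπP
  have hπ := hPol π hπP
  have := T.isProb
  have := T.isProbabilityMeasure_lawRec
  obtain ⟨κ, hκ0, hover⟩ := hNuis.overlap
  obtain ⟨rhoMu, rhoE, rhoTheta, h0, hE0, hMθ, hEM, hEθ, hfit'⟩ := hNuis.rates
  have hfit : ∀ k, HighProb T.P fun n =>
    T.goodFit η pStar (rhoMu n) (rhoE n) (rhoTheta n) π n k := hfit' π hπP
  obtain ⟨rhoG, hG, hclear⟩ := hNuis.clearing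
  obtain ⟨hd, hy, C, hhd, hhy, hC, hcovd, hcovy⟩ := hOut.entropy
  obtain ⟨K, hK⟩ := hOut.bounded
  obtain ⟨L, hL0, hL⟩ := hOut.weakly_continuous
  obtain ⟨c₁, hc₁, hball'⟩ := hEq.ball_subset
  have hball := hball' π hπP
  have hint : Metric.ball (pStar π) c₁ ⊆ interior T.S :=
    interior_maximal hball Metric.isOpen_ball
  have hp₀ : pStar π ∈ T.S := hball (Metric.mem_ball_self hc₁)
  have hc'0 := hOut.c'_pos.le
  -- A sample point supplies a submission, from which the bound K is seen to be nonnegative.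
  obtain ⟨ω₀⟩ : Nonempty Ω := nonempty_of_isProbabilityMeasure T.P
  have hK0 : 0 ≤ K := (abs_nonneg _).trans (hK (T.B true 0 ω₀) _ hp₀).1
  have hdiffY : ∀ w x, ∀ p ∈ Metric.ball (pStar π) c₁, DifferentiableAt ℝ (η.muY w x) p :=
    fun w x p hp => ((hOut.smooth_muY w x).1.differentiableOn (by norm_num)).differentiableAt
      (isOpen_interior.mem_nhds (hint hp))
  have hdiffD : ∀ w x, ∀ p ∈ Metric.ball (pStar π) c₁, DifferentiableAt ℝ (η.muD w x) p :=
    fun w x p hp => ((hOut.smooth_muD w x).1.differentiableOn (by norm_num)).differentiableAt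
      (isOpen_interior.mem_nhds (hint hp))
  have hbdY : ∀ w x, ∀ p ∈ Metric.ball (pStar π) c₁, ‖fderiv ℝ (η.muY w x) p‖ ≤ c' :=
    fun w x p hp => ((hOut.smooth_muY w x).2 p (hint hp)).1
  have hlipY : ∀ w x, ∀ p ∈ Metric.ball (pStar π) c₁,
      |η.muY w x p - η.muY w x (pStar π)| ≤ c' * ‖p - pStar π‖ := fun w x p hp =>
    (convex_ball _ _).norm_image_sub_le_of_norm_fderiv_le (hdiffY w x) (hbdY w x)
      (Metric.mem_ball_self hc₁) hp
  have hlipD : ∀ w x, ∀ p ∈ Metric.ball (pStar π) c₁,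
      ‖η.muD w x p - η.muD w x (pStar π)‖ ≤ c' * ‖p - pStar π‖ := fun w x p hp =>
    (convex_ball _ _).norm_image_sub_le_of_norm_fderiv_le (hdiffD w x)
      (fun p hp => ((hOut.smooth_muD w x).2 p (hint hp)).1) (Metric.mem_ball_self hc₁) hp
  have hKd : ∀ (j : Fin J) b, ∀ p ∈ T.S, |T.d b p j| ≤ K := fun j b p hp =>
    (PiLp.norm_apply_le _ j).trans (hK b p hp).2
  have hproj : ∀ j, Measurable fun x : Vec J => x j := fun j =>
    (EuclideanSpace.proj j : Vec J →L[ℝ] ℝ).continuous.measurable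
  have hcondD : ∀ (j : Fin J) w, ∀ p ∈ T.S, (fun ω => η.muD w (T.X 0 ω) p j) =ᵐ[T.P]
      T.P[fun ω => T.d (T.B w 0 ω) p j | MeasurableSpace.comap (T.X 0) inferInstance] := by
    intro j w p hp
    have hi : Integrable (fun ω => T.d (T.B w 0 ω) p) T.P :=
      Integrable.of_bound (T.measurable_d.comp ((T.measurable_B w 0).prodMk
        measurable_const)).aestronglyMeasurable K (Eventually.of_forall fun ω => (hK _ p hp).2)
    have h1 := (EuclideanSpace.proj j : Vec J →L[ℝ] ℝ).comp_condExp_comm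
      (m := MeasurableSpace.comap (T.X 0) inferInstance) hi
    refine EventuallyEq.trans ?_ h1
    filter_upwards [hη.muD_eq w p hp] with ω hω
    simp [← hω]
  -- the expansions of the outcome and of the allocation scores
  have hY := T.isExpansionError_response hη hId hκ0 hover hπ h0 hE0 hMθ hEM hEθ hfit hEq.compact
    hc₁ hball T.measurable_y hK0 hL0.le hC.le hhy.le hc'0 (fun b p hp => (hK b p hp).1)
    hη.measurable_muY hη.muY_eq hlipY (fun w p hp => (hL w p hp _ hp₀).2) hcovy
    (mh := fun k n => T.recMuY π n k)
    (fun k n w => T.measurable_recMuY hπ.1 k w (measurable_fst.comp measurable_fst)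
      (measurable_snd.comp measurable_fst) measurable_snd)
    (fun k n z => T.indep_recMuY π n k z)
    (fun k n ω w x => by
      rw [← Study.muYHat_eq]
      refine Real.abs_le_sqrt ?_
      exact le_add_of_nonneg_right (sq_nonneg _))
  have hD := fun j : Fin J => T.isExpansionError_response hη hId hκ0 hover hπ h0 hE0 hMθ hEM hEθ
    hfit hEq.compact hc₁ hball (v := fun b p => T.d b p j) (μ := fun w x p => η.muD w x p j)
    (T.measurable_d_apply j) hK0 hL0.le hC.le hhd.le hc'0 (hKd j)
    (fun w p hp => (hproj j).comp (hη.measurable_muD w p hp)) (hcondD j)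
    (fun w x p hp => (PiLp.norm_apply_le (η.muD w x p - η.muD w x (pStar π)) j).trans
      (hlipD w x p hp)) (fun w p hp => (hL w p hp _ hp₀).1 j) (hcovd j)
    (mh := fun k n z u w x => T.recMuD π n k z u w x j)
    (fun k n w => (hproj j).comp (T.measurable_recMuD hπ.1 k w (measurable_fst.comp measurable_fst)
      (measurable_snd.comp measurable_fst) measurable_snd))
    (fun k n z u u' huu => by simp only [T.indep_recMuD π n k z u u' huu])
    (fun k n ω w x => by
      simp only [← Study.muDHat_eq]
      refine Real.abs_le_sqrt ?_
      have h1 := PiLp.norm_apply_le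
        (T.muDHat π n k ω w x - η.muD w x (T.pTilde π n k ω)) j
      rw [Real.norm_eq_abs, PiLp.sub_apply] at h1
      rw [← sq_abs]
      exact (pow_le_pow_left₀ (abs_nonneg _) h1 2).trans (le_add_of_nonneg_left (sq_nonneg _)))
  -- the population functions
  obtain ⟨hzd, hinj⟩ := Model.hasFDerivAt_of_singularValues_pos fun i hi =>
    hOut.c₃_pos.trans_le (hOut.singular_values π hπP i hi).1
  have hyd : HasFDerivAt (T.meanOutcome π) (fderiv ℝ (T.meanOutcome π) (pStar π)) (pStar π) := by
    refine DifferentiableAt.hasFDerivAt ?_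
    rw [T.meanOutcome_eq hπ]
    exact hY.1.differentiableAt_meanResp hπ hc₁ hball hdiffY hbdY
  have hz0 := hEq.clears π hπP
  have hzapp : ∀ p ∈ T.S, ∀ j, T.netDemand π p j
      = RegularResponse.meanResp T.lawRec (fun b p => T.d b p j) π p - T.sStar j := fun p hp j =>
    T.netDemand_apply hπ (fun b => (hK b p hp).2) j
  have hmean0 : ∀ j, RegularResponse.meanResp T.lawRec (fun b p => T.d b p j) π (pStar π)
      = T.sStar j := fun j => by
    have := hzapp _ hp₀ j
    rw [hz0] at this
    simp only [PiLp.zero_apply] at this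
    linarith
  obtain ⟨c, hc, hlow⟩ := exists_mul_norm_sub_le hEq.compact
    (T.continuousOn_netDemand hπ (fun b p hp => (hK b p hp).2) hL0.le
      fun w p hp p' hp' j => (hL w p hp p' hp').1 j) hzd hinj hz0 (hEq.unique π hπP)
  obtain ⟨hκ, heq⟩ := T.ae_propensity_mem hη.measurable_e 0 (fun n => hover n 0) hE0
    ((hfit 0).mono (Eventually.of_forall fun n ω hω => hω.2.1))
  -- At the sample points truncation is invisible, for the estimated and for the true propensity
  -- score.
  have hsample : HighProb T.P fun n => {ω |
      (∀ i : Fin n, T.eHat n (T.foldOf n ω i) ω (T.X i ω) ∈ Set.Ioo κ (1 - κ)) ∧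
      ∀ i : Fin n, clip κ (η.e (T.X i ω)) = η.e (T.X i ω)} := by
    refine HighProb.of_ae fun n => ?_
    filter_upwards [T.ae_eHat_mem hId n (hover n), T.ae_forall_covariate hId heq] with ω h1 h2
    exact ⟨h1, fun i => h2 i⟩
  refine tendstoInMeasure_of_isExpansionError (ν := T.nu π (pStar π)) hc hlow
    (fun δ hδ => eventually_abs_sub_sub_le hyd hzd hinj hz0 hδ) hY.2 (fun j => (hD j).2)
    (A := T.netDemandScore η (fun x => clip κ (η.e x)) π (pStar π))
    (G := fun n ω => T.netDemandHat π n ω (T.pHat π n ω))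
    (Study.tendsto_sqrt_mul_of_isLittleO hG) (hclear π hπP)
    (fun a ha => T.exists_tight_norm (fun j a ha => ?_) ha) ?_ ?_
  -- The average true score is of order n^(-1/2): it is unbiased for the mean allocation, which at
  -- p₀ equals the capacity.
  · simp only [Study.netDemandScore_apply]
    exact T.exists_tight_average hId ((hD j).1.memLp_trueScore hπ)
      (((hD j).1.integral_recScore hπ).trans (hmean0 j)) ha
  -- The clearing identity, coordinate by coordinate; the capacities cancel between z and the mean
  -- response at p₀.
  · refine hsample.mono ?_
    filter_upwards [eventually_ge_atTop 1] with n hn ω hω hpS j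
    have hn0 : (n : ℝ) ≠ 0 := by positivity
    rw [T.netDemandHat_apply hω.1, T.netDemandScore_apply, hzapp _ hpS, hmean0, Study.scoreDiff,
      Finset.sum_sub_distrib, Finset.sum_sub_distrib]
    simp only [Finset.sum_const, Finset.card_univ, Fintype.card_fin, nsmul_eq_mul]
    field_simp
    ring
  -- The error of the value estimator is the outcome expansion plus ν of the average net-demand
  -- score, by definition of the efficient score.
  · refine hsample.mono (Eventually.of_forall fun n ω hω => ?_)
    simp only [Set.mem_ofPred_eq]
    rw [T.vHat_eq_sum_recScore hω.1, T.sum_efficientScore (e := fun x => clip κ (η.e x)) hω.2,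
      T.meanOutcome_eq hπ, Study.scoreDiff, Finset.sum_sub_distrib]
    ring

end Study

end CutoffMarket

end

theorem mainTheorem2 {Ω 𝒳 𝓑 Z : Type*} [MeasurableSpace Ω] [MeasurableSpace 𝒳]
    [MeasurableSpace 𝓑] [MeasurableSpace Z] {J : ℕ}
    (T : CutoffMarket.Study Ω 𝒳 𝓑 Z J)
    (Pol : Set (𝒳 → ℝ)) (hPol : ∀ π ∈ Pol, CutoffMarket.IsRule π)
    (η : CutoffMarket.Nuisance 𝒳 J) (hη : T.IsTrueNuisance η)
    (pStar : (𝒳 → ℝ) → CutoffMarket.Vec J) (c' c₃ c₄ : ℝ)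
    (hId : T.Identification η)
    (hCut : T.CutoffMechanism)
    (hOut : T.RegularOutcomes Pol η pStar c' c₃ c₄)
    (hEq : T.RegularEquilibrium Pol pStar c' c₃)
    (hNuis : T.NuisanceConditions Pol η pStar) :
    ∀ π ∈ Pol, TendstoInMeasure T.P
      (fun (n : ℕ) ω => √(n : ℝ) * (T.vHat π n ω -
        (n : ℝ)⁻¹ * ∑ i : Fin n, T.efficientScore η π (pStar π) i ω))
      atTop (fun _ => 0) := by
  exact T.tendstoInMeasure_vHat Pol hPol η hη pStar c' c₃ c₄ hId hOut hEq hNuis
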